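/- Let $p,q,r\ge 1$ and consider the multivariate ARMAX system $$A(z)y_{k+1}=B(z)u_k+C(z)w_{k+1},\qquad k\ge 0,$$ where $z$ is the back-shift operator, $A(z)=I_n+A_1z+\cdots+A_pz^p$, $B(z)=B_1+B_2z+\cdots+B_qz^{q-1}$, $C(z)=I_n+C_1z+\cdots+C_rz^r$, with outputs $y_k\in\mathbb R^n$, inputs $u_k\in\mathbb R^l$, noise $w_k\in\mathbb R^n$ on a probability space, and $y_j=0$, $u_j=0$ for $j\le 0$. Let $d=np+lq+nr$ and $\Theta=[-A_1,\dots,-A_p,B_1,\dots,B_q,C_1,\dots,C_r]^\top\in\mathbb R^{d\times n}$. Let $\mathcal F_k=\sigma\{y_k,\dots,y_0,u_{k-1},\dots,u_0,w_k,\dots,w_1\}$. $\|\cdot\|$ is the Euclidean norm of vectors and the Frobenius norm of matrices, and $\mathrm{sgn}(x)=1$ if $x\ge 0$, $\mathrm{sgn}(x)=-1$ if $x<0$. Algorithm. Let $\bar p>p$, $\bar q>q$, $\bar r>r$ be integers, $\mu>0$, and let $(\lambda_N)$ be a positive sequence (it may depend on the sample path). (Step 1) Put $\bar P_0=\mu^{-1}I$,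 $\alpha_0=0$, $\widehat w_j=0$ for $j\le 0$, and for $N\ge 1$ $$\psi_{N-1}=[y_{N-1}^\top,\dots,y_{N-\bar p}^\top,u_{N-1}^\top,\dots,u_{N-\bar q}^\top,\widehat w_{N-1}^\top,\dots,\widehat w_{N-\bar r}^\top]^\top,\quad b_{N-1}=(1+\psi_{N-1}^\top\bar P_{N-1}\psi_{N-1})^{-1},$$ $$\bar P_N=\bar P_{N-1}-b_{N-1}\bar P_{N-1}\psi_{N-1}\psi_{N-1}^\top\bar P_{N-1},\quad \alpha_N=\alpha_{N-1}+b_{N-1}\bar P_{N-1}\psi_{N-1}(y_N^\top-\psi_{N-1}^\top\alpha_{N-1}),\quad \widehat w_N=y_N-\alpha_N^\top\psi_{N-1}.$$ (Step 2) Put $\varphi_N=[y_N^\top,\dots,y_{N-p+1}^\top,u_N^\top,\dots,u_{N-q+1}^\top,\widehat w_N^\top,\dots,\widehat w_{N-r+1}^\top]^\top$, $P_0=\mu^{-1}I_d$, $\Theta_0=0$, $\Xi_0=\Xi_{-1}=0$, and for $N\ge 0$, with $a_N=(1+\varphi_N^\top P_N\varphi_N)^{-1}$, $$P_{N+1}=P_N-a_NP_N\varphi_N\varphi_N^\top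 P_N,\qquad \Theta_{N+1}=\Theta_N+a_NP_N\varphi_N(y_{N+1}^\top-\varphi_N^\top\Theta_N)+\mu P_{N+1}(\Xi_N-\Xi_{N-1}).$$ (Step 3) Let $\lambda_{\max}(N)$ and $\lambda_{\min}(N)$ be the largest and smallest eigenvalues of $\mu I_d+\sum_{k=1}^N\varphi_k\varphi_k^\top$. Put $\widehat\Theta_{N+1}(s,t)=\Theta_{N+1}(s,t)+\mathrm{sgn}(\Theta_{N+1}(s,t))\sqrt{\log\lambda_{\max}(N)/\lambda_{\min}(N)}$ and $$\Xi_{N+1}(s,t)=\mathrm{sgn}(\Theta_{N+1}(s,t))\max\Big\{|\Theta_{N+1}(s,t)|-\frac{\lambda_N}{\mu|\widehat\Theta_{N+1}(s,t)|},\,0\Big\}.$$ (Where $\log\lambda_{\max}(N)<0$, which under assumption 4 happens for finitely many $N$ only, the square root is read as $0$, and a quotient with denominator $0$ is read as $0$.) Assumptions. 1. $\{w_k,\mathcal F_k\}_{k\ge1}$ is a martingale difference sequence, $\mathbb E[w_{k+1}\mid\mathcal F_k]=0$ for $k\ge 1$, and for some $\beta>2$, $\sup_{k\ge 1}\mathbb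 E[\|w_{k+1}\|^\beta\mid\mathcal F_k]<\infty$ a.s. 2. $\varphi_k$ is $\mathcal F_k$-measurable for each $k\ge 1$. 3. $\det C(z)\ne 0$ for all complex $z$ with $|z|\le 1$. 4. $\lambda_{\min}(N)\to\infty$ and $\log\lambda_{\max}(N)/\lambda_{\min}(N)\to 0$ a.s. as $N\to\infty$. 5. $\lambda_N=O\big(\sqrt{\log\lambda_{\max}(N)/\lambda_{\min}(N)}\big)$ and $\log\lambda_{\max}(N)/\lambda_{\min}(N)=o(\lambda_N)$ a.s. Orders. Let $K>0$ and $\lambda\in(0,1)$ be such that $C^{-1}(z)=\sum_{i\ge0}D_iz^i$ for $|z|\le 1$ with $\|D_i\|\le K\lambda^i$ for all $i\ge 0$, let $\|C(z)\|_\infty^2=\max_{|z|=1}\lambda_{\max}\{C(z)C^\top(z^{-1})\}$, and let $\bar p=p+k$, $\bar q=q+k$, $\bar r=r+k$, where $k$ is any positive integer with $$k>\frac{\log\big[\|C(z)\|_\infty^{-1}K^{-1}(1-\lambda)\big]}{\log\lambda}-1 .$$ Theorem. Under these assumptions, $$\|\Theta_{N+1}-\Theta\|=O\left(\sqrt{\frac{\log\lambda_{\max}(N)}{\lambda_{\min}(N)}}\right)\quad\text{a.s.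 as } N\to\infty.$$ -/

import Mathlib

open MeasureTheory ProbabilityTheory Filter Topology Asymptotics
open scoped ENNReal Matrix Matrix.Norms.Frobenius

noncomputable section

namespace ARMAX

/-! ### Generalities -/

/-- The largest eigenvalue of a real symmetric (or complex Hermitian) matrix. -/
def lamMax {𝕜 ι : Type*} [RCLike 𝕜] [Fintype ι] [DecidableEq ι] (M : Matrix ι ι 𝕜) : ℝ :=
  sSup (spectrum ℝ M)

/-- The smallest eigenvalue of a real symmetric (or complex Hermitian) matrix. -/
def lamMin {𝕜 ι : Type*} [RCLike 𝕜] [Fintype ι] [DecidableEq ι] (M : Matrix ι ι 𝕜) : ℝ :=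
  sInf (spectrum ℝ M)

/-- The sign function with the convention `sgn 0 = 1`. -/
def sgn (x : ℝ) : ℝ := if 0 ≤ x then 1 else -1

/-! ### The system -/

/-- The index set of a regression vector: `p` lagged outputs in `ℝⁿ`, `q` lagged inputs in `ℝˡ`
and `r` lagged noises in `ℝⁿ`, in all `d = np + lq + nr` coordinates. -/
abbrev RegIdx (n l p q r : ℕ) : Type :=
  (Fin p × Fin n) ⊕ (Fin q × Fin l) ⊕ (Fin r × Fin n)

/-- `[y_kᵀ, …, y_{k-p+1}ᵀ, u_kᵀ, …, u_{k-q+1}ᵀ, e_kᵀ, …, e_{k-r+1}ᵀ]ᵀ`. -/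
def regressor {n l : ℕ} (p q r : ℕ) (y : ℤ → Fin n → ℝ) (u : ℤ → Fin l → ℝ)
    (e : ℤ → Fin n → ℝ) (k : ℤ) : RegIdx n l p q r → ℝ
  | .inl (i, a) => y (k - (i : ℕ)) a
  | .inr (.inl (j, b)) => u (k - (j : ℕ)) b
  | .inr (.inr (ν, c)) => e (k - (ν : ℕ)) c

/-- The parameter matrix `Θ = [-A₁, …, -A_p, B₁, …, B_q, C₁, …, C_r]ᵀ ∈ ℝ^{d × n}`.
The matrices are numbered from `0`: `A i` is `A_{i+1}`, and so on. -/
def paramMatrix {n l p q r : ℕ} (A : Fin p → Matrix (Fin n) (Fin n) ℝ)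
    (B : Fin q → Matrix (Fin n) (Fin l) ℝ) (C : Fin r → Matrix (Fin n) (Fin n) ℝ) :
    Matrix (RegIdx n l p q r) (Fin n) ℝ :=
  Matrix.of fun s t => match s with
    | .inl (i, a) => -(A i t a)
    | .inr (.inl (j, b)) => B j t b
    | .inr (.inr (ν, c)) => C ν t c

/-- One path of the system `A(z) y_{k+1} = B(z) u_k + C(z) w_{k+1}`, `k ≥ 0`, where `z` is the
back-shift, `A(z) = I + A₁ z + ⋯ + A_p z^p`, `B(z) = B₁ + B₂ z + ⋯ + B_q z^{q-1}` and
`C(z) = I + C₁ z + ⋯ + C_r z^r`, with `y_j = 0` and `u_j = 0` for `j ≤ 0`. -/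
structure IsSystemPath {n l p q r : ℕ} (A : Fin p → Matrix (Fin n) (Fin n) ℝ)
    (B : Fin q → Matrix (Fin n) (Fin l) ℝ) (C : Fin r → Matrix (Fin n) (Fin n) ℝ)
    (y : ℤ → Fin n → ℝ) (u : ℤ → Fin l → ℝ) (w : ℤ → Fin n → ℝ) : Prop where
  output_init : ∀ j ≤ 0, y j = 0
  input_init : ∀ j ≤ 0, u j = 0
  dynamics : ∀ k : ℤ, 0 ≤ k →
    y (k + 1) + ∑ i, A i *ᵥ y (k - (i : ℕ)) =
      ∑ j, B j *ᵥ u (k - (j : ℕ)) + (w (k + 1) + ∑ ν, C ν *ᵥ w (k - (ν : ℕ)))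

/-! ### The noise polynomial `C(z)` -/

/-- `C(z) = I + C₁ z + ⋯ + C_r z^r` at a complex number `z`. -/
def noisePoly {n r : ℕ} (C : Fin r → Matrix (Fin n) (Fin n) ℝ) (z : ℂ) :
    Matrix (Fin n) (Fin n) ℂ :=
  1 + ∑ ν : Fin r, z ^ ((ν : ℕ) + 1) • (C ν).map ((↑) : ℝ → ℂ)

/-- `‖C(z)‖_∞`, where `‖C(z)‖_∞² = max_{|z|=1} λ_max {C(z) Cᵀ(z⁻¹)}`. -/
def noisePolySupNorm {n r : ℕ} (C : Fin r → Matrix (Fin n) (Fin n) ℝ) : ℝ :=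
  Real.sqrt (sSup ((fun z : ℂ => lamMax (noisePoly C z * (noisePoly C z⁻¹)ᵀ)) '' {z | ‖z‖ = 1}))

/-- `K > 0` and `ρ ∈ (0,1)` are constants for the expansion of `C(z)⁻¹`:
`C(z)⁻¹ = ∑ D_i z^i` for `|z| ≤ 1`, with `‖D_i‖ ≤ K ρ^i` (Frobenius norm) for all `i ≥ 0`. -/
structure IsInverseDecay {n r : ℕ} (C : Fin r → Matrix (Fin n) (Fin n) ℝ) (K ρ : ℝ) : Prop where
  K_pos : 0 < K
  ρ_pos : 0 < ρ
  ρ_lt_one : ρ < 1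
  expansion : ∃ D : ℕ → Matrix (Fin n) (Fin n) ℝ,
    (∀ z : ℂ, ‖z‖ ≤ 1 → HasSum (fun i => z ^ i • (D i).map ((↑) : ℝ → ℂ)) (noisePoly C z)⁻¹) ∧
    ∀ i, ‖D i‖ ≤ K * ρ ^ i

/-! ### The algorithm, along one path -/

/-- The gain `(1 + φᵀ P φ)⁻¹`. -/
def gain {ι : Type*} [Fintype ι] (P : Matrix ι ι ℝ) (φ : ι → ℝ) : ℝ :=
  (1 + φ ⬝ᵥ (P *ᵥ φ))⁻¹

/-- `P - a P φ φᵀ P` with the gain `a`. -/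
def covStep {ι : Type*} [Fintype ι] (P : Matrix ι ι ℝ) (φ : ι → ℝ) : Matrix ι ι ℝ :=
  P - gain P φ • (P * Matrix.vecMulVec φ φ * P)

/-- `X + a P φ (yᵀ - φᵀ X)` with the gain `a`. -/
def lsStep {ι κ : Type*} [Fintype ι] (P : Matrix ι ι ℝ) (φ : ι → ℝ)
    (X : Matrix ι κ ℝ) (y : κ → ℝ) : Matrix ι κ ℝ :=
  X + gain P φ • (P * Matrix.vecMulVec φ (y - Xᵀ *ᵥ φ))

/-- The state of the noise estimator after time `N`: the estimates `ŵ_j`, `j ≤ N` (zero at the times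
`j ≤ 0` and `j > N`), the matrix `P̄_N` and the parameter estimate `α_N`. -/
structure NoiseState (n : ℕ) (ι : Type*) where
  what : ℤ → Fin n → ℝ
  Pbar : Matrix ι ι ℝ
  α : Matrix ι (Fin n) ℝ

/-- Step 1, a posteriori noise estimation with the orders `p' q' r'` (those written `p̄ q̄ r̄`):
`P̄_0 = μ⁻¹ I`, `α_0 = 0`, `ŵ_j = 0` for `j ≤ 0`, and for `N ≥ 0`, with
`ψ_N = [y_Nᵀ ⋯ y_{N-p'+1}ᵀ u_Nᵀ ⋯ u_{N-q'+1}ᵀ ŵ_Nᵀ ⋯ ŵ_{N-r'+1}ᵀ]ᵀ`, the updates of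
`P̄_{N+1}` and `α_{N+1}` and the estimate `ŵ_{N+1} = y_{N+1} - α_{N+1}ᵀ ψ_N`. -/
def noiseState {n l : ℕ} (p' q' r' : ℕ) (μ : ℝ) (y : ℤ → Fin n → ℝ) (u : ℤ → Fin l → ℝ) :
    ℕ → NoiseState n (RegIdx n l p' q' r')
  | 0 => ⟨fun _ => 0, μ⁻¹ • 1, 0⟩
  | N + 1 =>
    let S := noiseState p' q' r' μ y u N
    let ψ := regressor p' q' r' y u S.what N
    let α' := lsStep S.Pbar ψ S.α (y (N + 1))
    ⟨Function.update S.what (N + 1) (y (N + 1) - α'ᵀ *ᵥ ψ), covStep S.Pbar ψ, α'⟩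

/-- The noise estimates `ŵ_j`, `j ∈ ℤ` (zero for `j ≤ 0`). -/
def noiseEst {n l : ℕ} (p' q' r' : ℕ) (μ : ℝ) (y : ℤ → Fin n → ℝ) (u : ℤ → Fin l → ℝ)
    (j : ℤ) : Fin n → ℝ :=
  (noiseState p' q' r' μ y u j.toNat).what j

/-- `φ_N = [y_Nᵀ ⋯ y_{N-p+1}ᵀ u_Nᵀ ⋯ u_{N-q+1}ᵀ ŵ_Nᵀ ⋯ ŵ_{N-r+1}ᵀ]ᵀ`. -/
def phi {n l : ℕ} (p q r p' q' r' : ℕ) (μ : ℝ) (y : ℤ → Fin n → ℝ) (u : ℤ → Fin l → ℝ)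
    (N : ℕ) : RegIdx n l p q r → ℝ :=
  regressor p q r y u (noiseEst p' q' r' μ y u) N

/-- `μ I_d + ∑_{k=1}^N φ_k φ_kᵀ`. -/
def infoMatrix {n l : ℕ} (p q r p' q' r' : ℕ) (μ : ℝ) (y : ℤ → Fin n → ℝ) (u : ℤ → Fin l → ℝ)
    (N : ℕ) : Matrix (RegIdx n l p q r) (RegIdx n l p q r) ℝ :=
  μ • 1 + ∑ k ∈ Finset.Icc 1 N,
    Matrix.vecMulVec (phi p q r p' q' r' μ y u k) (phi p q r p' q' r' μ y u k)

/-- `λ_max(N)`, the largest eigenvalue of `μ I_d + ∑_{k=1}^N φ_k φ_kᵀ`. -/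
def lmax {n l : ℕ} (p q r p' q' r' : ℕ) (μ : ℝ) (y : ℤ → Fin n → ℝ) (u : ℤ → Fin l → ℝ)
    (N : ℕ) : ℝ :=
  lamMax (infoMatrix p q r p' q' r' μ y u N)

/-- `λ_min(N)`, the smallest eigenvalue of `μ I_d + ∑_{k=1}^N φ_k φ_kᵀ`. -/
def lmin {n l : ℕ} (p q r p' q' r' : ℕ) (μ : ℝ) (y : ℤ → Fin n → ℝ) (u : ℤ → Fin l → ℝ)
    (N : ℕ) : ℝ :=
  lamMin (infoMatrix p q r p' q' r' μ y u N)

/-- `log λ_max(N) / λ_min(N)`. -/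
def ratio {n l : ℕ} (p q r p' q' r' : ℕ) (μ : ℝ) (y : ℤ → Fin n → ℝ) (u : ℤ → Fin l → ℝ)
    (N : ℕ) : ℝ :=
  Real.log (lmax p q r p' q' r' μ y u N) / lmin p q r p' q' r' μ y u N

/-- The state of the recursion for the parameter: `P_N`, `Θ_N`, `Ξ_N` and `Ξ_{N-1}`. -/
structure ParamState (n : ℕ) (ι : Type*) where
  P : Matrix ι ι ℝ
  Θ : Matrix ι (Fin n) ℝ
  Ξ : Matrix ι (Fin n) ℝ
  Ξprev : Matrix ι (Fin n) ℝ

/-- Steps 2 and 3: `P_0 = μ⁻¹ I`, `Θ_0 = 0`, `Ξ_0 = Ξ_{-1} = 0`, and for `N ≥ 0` the updates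
`P_{N+1} = P_N - a_N P_N φ_N φ_Nᵀ P_N`,
`Θ_{N+1} = Θ_N + a_N P_N φ_N (y_{N+1}ᵀ - φ_Nᵀ Θ_N) + μ P_{N+1} (Ξ_N - Ξ_{N-1})`,
`Θ̂_{N+1}(s,t) = Θ_{N+1}(s,t) + sgn (Θ_{N+1}(s,t)) √(log λ_max(N) / λ_min(N))`,
`Ξ_{N+1}(s,t) = sgn (Θ_{N+1}(s,t)) max {|Θ_{N+1}(s,t)| - λ_N / (μ |Θ̂_{N+1}(s,t)|), 0}`.
The sequence `lam` is `(λ_N)`. Its term `λ_0 > 0` is a dummy: `φ_0 = 0` gives `Θ_1 = 0`, hence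
`Ξ_1 = 0` for every such value. -/
def paramState {n l : ℕ} (p q r p' q' r' : ℕ) (μ : ℝ) (lam : ℕ → ℝ) (y : ℤ → Fin n → ℝ)
    (u : ℤ → Fin l → ℝ) : ℕ → ParamState n (RegIdx n l p q r)
  | 0 => ⟨μ⁻¹ • 1, 0, 0, 0⟩
  | N + 1 =>
    let S := paramState p q r p' q' r' μ lam y u N
    let φ := phi p q r p' q' r' μ y u N
    let P' := covStep S.P φ
    let Θ' := lsStep S.P φ S.Θ (y (N + 1)) + μ • (P' * (S.Ξ - S.Ξprev))
    let Θhat := Θ'.map fun x => x + sgn x * Real.sqrt (ratio p q r p' q' r' μ y u N)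
    let Ξ' := Matrix.of fun s t => sgn (Θ' s t) * max (|Θ' s t| - lam N / (μ * |Θhat s t|)) 0
    ⟨P', Θ', Ξ', S.Ξ⟩

/-- The recursive estimate `Θ_N`. -/
def thetaEst {n l : ℕ} (p q r p' q' r' : ℕ) (μ : ℝ) (lam : ℕ → ℝ) (y : ℤ → Fin n → ℝ)
    (u : ℤ → Fin l → ℝ) (N : ℕ) : Matrix (RegIdx n l p q r) (Fin n) ℝ :=
  (paramState p q r p' q' r' μ lam y u N).Θ

/-! ### The filtration and the noise -/

/-- `𝓕_k = σ {y_k, …, y_0, u_{k-1}, …, u_0, w_k, …, w_1}`. -/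
@[reducible] def sigmaAlg {Ω : Type*} {n l : ℕ} (y : ℤ → Ω → Fin n → ℝ) (u : ℤ → Ω → Fin l → ℝ)
    (w : ℤ → Ω → Fin n → ℝ) (k : ℕ) : MeasurableSpace Ω :=
  (⨆ j ∈ Set.Icc (0 : ℤ) k, MeasurableSpace.comap (y j) inferInstance) ⊔
    (⨆ j ∈ Set.Ico (0 : ℤ) k, MeasurableSpace.comap (u j) inferInstance) ⊔
    (⨆ j ∈ Set.Icc (1 : ℤ) k, MeasurableSpace.comap (w j) inferInstance)

/-- `{w_k, 𝓕_k}_{k ≥ 1}` is a martingale difference sequence (it is adapted by the choice of `𝓕_k`)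
and `sup_{k ≥ 1} 𝔼[‖w_{k+1}‖^β | 𝓕_k] < ∞` almost surely for some `β > 2`, with the Euclidean
norm. -/
structure IsMartingaleDifferenceNoise {Ω : Type*} {n : ℕ} [MeasurableSpace Ω] (P : Measure Ω)
    (𝓕 : ℕ → MeasurableSpace Ω) (w : ℤ → Ω → Fin n → ℝ) : Prop where
  integrable : ∀ k : ℕ, 1 ≤ k → Integrable (w k) P
  condExp_eq_zero : ∀ k : ℕ, 1 ≤ k → P[w (k + 1) | 𝓕 k] =ᵐ[P] 0
  moment : ∃ β : ℝ, 2 < β ∧ ∀ᵐ ω ∂P,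
    (⨆ k ≥ 1,
      (P⁻[fun ω' => ENNReal.ofReal (‖WithLp.toLp 2 (w (k + 1 : ℕ) ω')‖ ^ β) | 𝓕 k]) ω) < ∞

end ARMAX

end

/-! The thresholding is a vanishing perturbation of ordinary recursive least squares. Unrolling the
recursion gives `Θ_{N+1} = X_{N+1} + μ P_{N+1} Ξ_N` with `X` the plain least squares estimate
(`paramState_Θ`). Since `‖P_{N+1} Ξ_N‖ ≤ ‖Ξ_N‖ / λ_min(N)` and thresholding only shrinks entries,
`‖Θ_{N+1}‖ ≤ const + ‖Θ_N‖ / 2` once `λ_min(N) ≥ 2μ`. So `Θ_N` is bounded and the perturbation is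
`O(1 / λ_min)`, which is below the claimed rate (`thetaEst_sub_isBigO`).

For `X`, let `Q_N = P_N⁻¹` and let `V_N` be the sum over columns of `(θ - X_N)ᵀ Q_N (θ - X_N)`. As
`V_{N+1} ≥ λ_min(N) ‖θ - X_{N+1}‖²`, it suffices that `V_{N+1} = O(log λ_max(N))`. Write the output
as `θᵀφ + w + e`, where `e` comes from using `ŵ` in place of `w`, and let `s` be the a posteriori
prediction error. One step lowers `V` by at least `s² + 2es + 2ws` (`rlsEnergy_succ_le`). The term
`ws` splits into a martingale transform, absorbed by a small multiple of `∑ s²`, and leverage times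
`w²`, whose sum is of the order of the sum of leverages, hence of `log det Q_N`
(`ae_rlsEnergy_add_sum_le`, `sum_rlsLeverage_le`). What remains is `∑ e²`, controlled by `∑ ‖ŵ -
w‖²`.

The noise errors are handled without a positive-real condition on `C`. Multiply the system by the
truncation `F` of `C⁻¹` at degree `k`. This raises each order by `k`, which is why the estimator has
orders `p + k`, `q + k`, `r + k`, and turns the noise polynomial into `F C = I - T C` with `T` the
tail of the series. The condition on `k` says that the bounds for `T` and `C` on the unit circle
have product below `1` (`exists_truncated_inverse`). By Parseval (`sum_sq_conv_le`) the model error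
`e` of the long regression satisfies `∑ e² ≤ const + γ ∑ x²`, where `x = ŵ - w` and `γ < 1`. Since
`x = s + e`, the decrease `s² + 2es` equals `x² - e²`, so the energy inequality bounds `∑ x²`
(`exists_sum_noise_error_le`). -/

namespace ARMAX

/-! ### Partial-sum inequalities and square-integrable martingales. -/

theorem sum_div_rpow_partial_sum_le (c : ℕ → ℝ) (hc : ∀ k, 0 ≤ c k) {δ : ℝ} (hδ : 1 < δ)
    (N : ℕ) :
    ∑ k ∈ Finset.range N, c k / (1 + ∑ j ∈ Finset.range (k + 1), c j) ^ δ ≤ 1 / (δ - 1) := by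
  have hpos : ∀ k, 1 ≤ 1 + ∑ j ∈ Finset.range k, c j := fun k => by
    have := Finset.sum_nonneg (s := Finset.range k) (fun j _ => hc j)
    linarith
  have ha : 0 < δ - 1 := by linarith
  -- Comparison with the integral of `x ^ (-δ)`. The remainder `T_N ^ (-(δ - 1))` is kept so that
  -- the induction telescopes.
  have key : ∀ N, ∑ k ∈ Finset.range N, c k / (1 + ∑ j ∈ Finset.range (k + 1), c j) ^ δ ≤
      (1 - (1 + ∑ j ∈ Finset.range N, c j) ^ (-(δ - 1))) / (δ - 1) := by
    intro N
    induction N with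
    | zero => simp
    | succ N ih =>
      rw [Finset.sum_range_succ]
      have h1 := hpos N
      have h2 := hpos (N + 1)
      set T := 1 + ∑ j ∈ Finset.range N, c j with hT
      set T' := 1 + ∑ j ∈ Finset.range (N + 1), c j with hT'
      have hTT : T' = T + c N := by rw [hT, hT', Finset.sum_range_succ]; ring
      have hT0 : 0 < T := by linarith
      have hT0' : 0 < T' := by linarith
      have hstep : c N / T' ^ δ * (δ - 1) ≤ T ^ (-(δ - 1)) - T' ^ (-(δ - 1)) := by
        have e1 : T' ^ δ = T' * T' ^ (δ - 1) := by
          rw [← Real.rpow_one_add' hT0'.le (by linarith)]; ring_nf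
        have hlog := Real.one_sub_inv_le_log_of_pos (div_pos hT0' hT0)
        have e2 : T ^ (-(δ - 1)) = T' ^ (-(δ - 1)) * (T' / T) ^ (δ - 1) := by
          rw [Real.div_rpow hT0'.le hT0.le, Real.rpow_neg hT0.le, Real.rpow_neg hT0'.le]
          have := (Real.rpow_pos_of_pos hT0' (δ - 1)).ne'
          field_simp
        -- Combine `x ^ a ≥ 1 + a log x` with `log x ≥ 1 - 1 / x`.
        have e3 : 1 + (δ - 1) * (c N / T') ≤ (T' / T) ^ (δ - 1) := by
          rw [Real.rpow_def_of_pos (div_pos hT0' hT0)]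
          have e4 : 1 - (T' / T)⁻¹ = c N / T' := by
            rw [inv_div, eq_div_iff hT0'.ne', sub_mul, div_mul_cancel₀ _ hT0'.ne', hTT]; ring
          rw [e4] at hlog
          have := Real.add_one_le_exp (Real.log (T' / T) * (δ - 1))
          nlinarith
        have e5 : 0 < T' ^ (-(δ - 1)) := Real.rpow_pos_of_pos hT0' _
        rw [e2, e1]
        have e6 : c N / (T' * T' ^ (δ - 1)) * (δ - 1) =
            T' ^ (-(δ - 1)) * ((δ - 1) * (c N / T')) := by
          rw [Real.rpow_neg hT0'.le]
          have := (Real.rpow_pos_of_pos hT0' (δ - 1)).ne'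
          field_simp
        rw [e6]
        nlinarith
      rw [le_div_iff₀ ha] at ih ⊢
      rw [add_mul]
      linarith
  refine (key N).trans ?_
  gcongr
  have : 0 ≤ (1 + ∑ j ∈ Finset.range N, c j) ^ (-(δ - 1)) :=
    Real.rpow_nonneg (by linarith [hpos N]) _
  linarith

/-- Summation by parts, in the role of Kronecker's lemma: it removes a normaliser `T` from a sum
known to be bounded. The difference in `key` changes by `-(T (N + 1) - T N) * ∑_{k < N} a k` at each
step. -/
theorem abs_sum_mul_le_of_abs_sum_le (a T : ℕ → ℝ) (hT : Monotone T) (hT0 : 0 ≤ T 0) {b : ℝ}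
    (hb : ∀ N, |∑ k ∈ Finset.range N, a k| ≤ b) (N : ℕ) :
    |∑ k ∈ Finset.range N, T (k + 1) * a k| ≤ 2 * b * T N := by
  have hb0 : 0 ≤ b := (abs_nonneg _).trans (hb 0)
  have key : |∑ k ∈ Finset.range N, T (k + 1) * a k - T N * ∑ k ∈ Finset.range N, a k| ≤
      b * (T N - T 0) := by
    induction N with
    | zero => simp
    | succ N ih =>
      rw [Finset.sum_range_succ, Finset.sum_range_succ]
      have h1 : (T (N + 1) - T N) * ∑ k ∈ Finset.range N, a k ≤ (T (N + 1) - T N) * b :=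
        mul_le_mul_of_nonneg_left (abs_le.1 (hb N)).2 (sub_nonneg.2 (hT (Nat.le_succ N)))
      have h2 : (T (N + 1) - T N) * -b ≤ (T (N + 1) - T N) * ∑ k ∈ Finset.range N, a k :=
        mul_le_mul_of_nonneg_left (abs_le.1 (hb N)).1 (sub_nonneg.2 (hT (Nat.le_succ N)))
      rw [abs_le] at ih ⊢
      constructor <;> nlinarith [ih.1, ih.2]
  have hTN : 0 ≤ T N := hT0.trans (hT (Nat.zero_le N))
  have h1 : T N * ∑ k ∈ Finset.range N, a k ≤ T N * b :=
    mul_le_mul_of_nonneg_left (abs_le.1 (hb N)).2 hTN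
  have h2 : T N * -b ≤ T N * ∑ k ∈ Finset.range N, a k :=
    mul_le_mul_of_nonneg_left (abs_le.1 (hb N)).1 hTN
  rw [abs_le] at key ⊢
  have := mul_nonneg hb0 hT0
  constructor <;> nlinarith [key.1, key.2]

variable {Ω : Type*} {m0 : MeasurableSpace Ω} {P : Measure Ω}

/-- Martingale increments are orthogonal, so the second moments of the partial sums are at most `R`.
An `L¹`-bounded martingale converges almost surely, hence is pathwise bounded. -/
theorem ae_abs_sum_le_of_martingale_diff [IsProbabilityMeasure P] (F : Filtration ℕ m0)
    (d : ℕ → Ω → ℝ) (hd : ∀ k, StronglyMeasurable[F (k + 1)] (d k)) (hL2 : ∀ k, MemLp (d k) 2 P)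
    (h0 : ∀ k, P[d k | F k] =ᵐ[P] 0) (R : ℝ)
    (hR : ∀ N, ∑ k ∈ Finset.range N, ∫ ω, d k ω ^ 2 ∂P ≤ R) :
    ∀ᵐ ω ∂P, ∃ b, ∀ N, |∑ k ∈ Finset.range N, d k ω| ≤ b := by
  set M : ℕ → Ω → ℝ := fun N => ∑ k ∈ Finset.range N, d k with hM
  have hint : ∀ k, Integrable (d k) P := fun k => (hL2 k).integrable (by norm_num)
  have hMint : ∀ N, Integrable (M N) P := fun N => integrable_finsetSum' _ fun k _ => hint k
  have hML2 : ∀ N, MemLp (M N) 2 P := fun N => memLp_finsetSum' _ fun k _ => hL2 k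
  have hadp : StronglyAdapted F M := fun N =>
    Finset.stronglyMeasurable_sum _ fun k hk =>
      (hd k).mono (F.mono (Finset.mem_range.1 hk))
  have hmart : Martingale M F P := by
    refine martingale_nat hadp hMint fun N => ?_
    have e : M (N + 1) = M N + d N := Finset.sum_range_succ _ _
    rw [e]
    have h1 := condExp_add (hMint N) (hint N) (F N)
    rw [condExp_of_stronglyMeasurable (F.le N) (hadp N) (hMint N)] at h1
    filter_upwards [h1, h0 N] with ω h1 h2
    rw [h1, Pi.add_apply, h2]; simp
  have hsq : ∀ N, ∫ ω, M N ω ^ 2 ∂P = ∑ k ∈ Finset.range N, ∫ ω, d k ω ^ 2 ∂P := by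
    intro N
    induction N with
    | zero => simp [hM]
    | succ N ih =>
      have e : ∀ ω, M (N + 1) ω ^ 2 = M N ω ^ 2 + 2 * (M N * d N) ω + d N ω ^ 2 := fun ω => by
        have : M (N + 1) = M N + d N := Finset.sum_range_succ _ _
        rw [this]; simp only [Pi.add_apply, Pi.mul_apply]; ring
      have i1 : Integrable (M N * d N) P := (hML2 N).integrable_mul (hL2 N)
      have i2 : ∫ ω, (M N * d N) ω ∂P = 0 := by
        rw [← integral_condExp (F.le N)]
        have h1 := condExp_mul_of_stronglyMeasurable_left (hadp N) i1 (hint N)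
        rw [integral_congr_ae (g := fun _ => 0)]
        · simp
        filter_upwards [h1, h0 N] with ω h1 h2
        rw [h1, Pi.mul_apply, h2]; simp
      simp_rw [e]
      rw [integral_add, integral_add, integral_const_mul, i2, ih, Finset.sum_range_succ]
      · simp
      · exact (hML2 N).integrable_sq
      · exact i1.const_mul 2
      · exact (hML2 N).integrable_sq.add (i1.const_mul 2)
      · exact (hL2 N).integrable_sq
  have hbdd : ∀ N, eLpNorm (M N) 1 P ≤ (1 + R).toNNReal := by
    intro N
    rw [eLpNorm_one_eq_lintegral_enorm, ← ofReal_integral_norm_eq_lintegral_enorm (hMint N)]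
    refine ENNReal.ofReal_le_ofReal ?_
    calc ∫ ω, ‖M N ω‖ ∂P ≤ ∫ ω, (1 + M N ω ^ 2) ∂P := by
          refine integral_mono (hMint N).norm ((integrable_const 1).add (hML2 N).integrable_sq) ?_
          intro ω
          simp only [Real.norm_eq_abs]
          nlinarith [sq_nonneg (|M N ω| - 1), sq_abs (M N ω), abs_nonneg (M N ω)]
      _ = 1 + ∑ k ∈ Finset.range N, ∫ ω, d k ω ^ 2 ∂P := by
          rw [integral_add (integrable_const 1) (hML2 N).integrable_sq, hsq]; simp
      _ ≤ 1 + R := by linarith [hR N]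
  filter_upwards [hmart.submartingale.exists_ae_tendsto_of_bdd hbdd] with ω hω
  obtain ⟨c, hc⟩ := hω
  obtain ⟨b, hb⟩ := (Metric.isBounded_range_of_tendsto _ hc).exists_norm_le
  refine ⟨b, fun N => ?_⟩
  have := hb _ ⟨N, rfl⟩
  simpa [hM, Finset.sum_apply] using this

end ARMAX

/-! ### Martingale transforms of noise with uniformly bounded conditional moments. -/

namespace ARMAX

/-- A martingale difference sequence `w k`, known at time `k + 1`, whose conditional `β`-th moments
are bounded by the constant `M`. -/
structure IsBoundedMomentNoise {Ω : Type*} {m0 : MeasurableSpace Ω} (P : Measure Ω)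
    (F : Filtration ℕ m0) (w : ℕ → Ω → ℝ) (β : ℝ) (M : NNReal) : Prop where
  measurable : ∀ k, Measurable[F (k + 1)] (w k)
  integrable : ∀ k, Integrable (w k) P
  condExp_eq_zero : ∀ k, P[w k | F k] =ᵐ[P] 0
  moment : ∀ k A, MeasurableSet[F k] A →
    ∫⁻ ω in A, ENNReal.ofReal (|w k ω| ^ β) ∂P ≤ M * P A

variable {Ω : Type*} {m0 : MeasurableSpace Ω} {P : Measure Ω}

/-- On `m` the measure with density `h` is at most `M • P`; integrate the `m`-measurable `g` against
both. -/
theorem lintegral_mul_le_of_setLIntegral_le {Ω : Type*} {m m0 : MeasurableSpace Ω}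
    {P : Measure Ω} (hm : m ≤ m0)
    {h : Ω → ℝ≥0∞} (hh : Measurable h) {M : ℝ≥0∞}
    (H : ∀ A, MeasurableSet[m] A → ∫⁻ ω in A, h ω ∂P ≤ M * P A) {g : Ω → ℝ≥0∞}
    (hg : Measurable[m] g) : ∫⁻ ω, g ω * h ω ∂P ≤ M * ∫⁻ ω, g ω ∂P := by
  have h1 : ∫⁻ ω, g ω * h ω ∂P = ∫⁻ ω, g ω ∂(P.withDensity h) := by
    rw [lintegral_withDensity_eq_lintegral_mul _ hh (hg.mono hm le_rfl)]
    simp [mul_comm]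
  rw [h1, ← lintegral_trim hm hg, ← lintegral_trim hm hg, ← smul_eq_mul (a := M),
    ← lintegral_smul_measure]
  refine lintegral_mono' ?_ le_rfl
  refine Measure.le_iff.2 fun A hA => ?_
  rw [trim_measurableSet_eq hm hA, withDensity_apply _ (hm A hA), Measure.smul_apply,
    trim_measurableSet_eq hm hA]
  exact H A hA

namespace IsBoundedMomentNoise

variable {F : Filtration ℕ m0} {w : ℕ → Ω → ℝ} {β : ℝ} {M : NNReal}

theorem lintegral_mul_le (hw : IsBoundedMomentNoise P F w β M) (k : ℕ) {g : Ω → ℝ≥0∞}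
    (hg : Measurable[F k] g) :
    ∫⁻ ω, g ω * ENNReal.ofReal (|w k ω| ^ β) ∂P ≤ M * ∫⁻ ω, g ω ∂P := by
  refine lintegral_mul_le_of_setLIntegral_le (F.le k) ?_ (hw.moment k) hg
  have h : Measurable (w k) := (hw.measurable k).mono (F.le _) le_rfl
  fun_prop

theorem mono (hw : IsBoundedMomentNoise P F w β M) {β' : ℝ} (h0 : 0 ≤ β') (h : β' ≤ β) :
    IsBoundedMomentNoise P F w β' (M + 1) where
  measurable := hw.measurable
  integrable := hw.integrable
  condExp_eq_zero := hw.condExp_eq_zero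
  moment k A hA := by
    have hle : ∀ x : ℝ, 0 ≤ x → x ^ β' ≤ x ^ β + 1 := fun x hx => by
      rcases le_total x 1 with h1 | h1
      · have := Real.rpow_le_one hx h1 h0
        have := Real.rpow_nonneg hx β
        linarith
      · have := Real.rpow_le_rpow_of_exponent_le h1 h
        linarith
    calc ∫⁻ ω in A, ENNReal.ofReal (|w k ω| ^ β') ∂P
        ≤ ∫⁻ ω in A, (ENNReal.ofReal (|w k ω| ^ β) + 1) ∂P := by
          refine lintegral_mono fun ω => ?_
          rw [← ENNReal.ofReal_one, ← ENNReal.ofReal_add (Real.rpow_nonneg (abs_nonneg _) _)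
            zero_le_one]
          exact ENNReal.ofReal_le_ofReal (hle _ (abs_nonneg _))
      _ = ∫⁻ ω in A, ENNReal.ofReal (|w k ω| ^ β) ∂P + P A := by
          rw [lintegral_add_right _ measurable_const]; simp
      _ ≤ (M + 1 : NNReal) * P A := by
          push_cast
          rw [add_mul, one_mul]
          gcongr
          exact hw.moment k A hA

theorem lintegral_mul_sq_le (hw : IsBoundedMomentNoise P F w β M) (hβ : 2 ≤ β) (k : ℕ)
    {g : Ω → ℝ≥0∞} (hg : Measurable[F k] g) :
    ∫⁻ ω, g ω * ENNReal.ofReal (w k ω ^ 2) ∂P ≤ (M + 1 : NNReal) * ∫⁻ ω, g ω ∂P := by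
  have := (hw.mono (β' := 2) (by norm_num) hβ).lintegral_mul_le k hg
  simpa using this

/-- With `X = 1 + ∑ f²`, the weights `f k / X_{k+1} ^ (3/4)` are square-summable with a
deterministic bound. The normalised transform is thus an `L²`-bounded martingale, and summation by
parts restores the normaliser. The exponent must exceed `1/2` for summability and be below `1` for
the later absorption into `ε ∑ f²`. -/
theorem ae_exists_abs_sum_mul_le [IsProbabilityMeasure P] (hw : IsBoundedMomentNoise P F w β M)
    (hβ : 2 ≤ β) (f : ℕ → Ω → ℝ) (hf : ∀ k, Measurable[F k] (f k)) :
    ∀ᵐ ω ∂P, ∃ b, ∀ N, |∑ k ∈ Finset.range N, f k ω * w k ω| ≤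
      b * (1 + ∑ k ∈ Finset.range N, f k ω ^ 2) ^ (3 / 4 : ℝ) := by
  set X : ℕ → Ω → ℝ := fun N ω => 1 + ∑ k ∈ Finset.range N, f k ω ^ 2 with hX
  have hX1 : ∀ N ω, 1 ≤ X N ω := fun N ω => by
    have := Finset.sum_nonneg (s := Finset.range N) (fun j _ => sq_nonneg (f j ω))
    simp only [hX]; linarith
  -- The normaliser of term `k` includes `f k` itself; it is still known at time `k` because `f` is
  -- predictable.
  have hXmeas : ∀ k, Measurable[F k] (X (k + 1)) := fun k => by
    have : ∀ j ∈ Finset.range (k + 1), Measurable[F k] (fun ω => f j ω ^ 2) := fun j hj =>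
      ((hf j).mono (F.mono (by have := Finset.mem_range.1 hj; omega)) le_rfl).pow_const 2
    exact (Finset.measurable_fun_sum _ this).const_add 1
  set T : ℕ → Ω → ℝ := fun N ω => X N ω ^ (3 / 4 : ℝ) with hT
  set g : ℕ → Ω → ℝ := fun k ω => f k ω / T (k + 1) ω with hg
  have hTpos : ∀ N ω, 0 < T N ω := fun N ω => Real.rpow_pos_of_pos (by linarith [hX1 N ω]) _
  have hTsq : ∀ N ω, T N ω ^ 2 = X N ω ^ (3 / 2 : ℝ) := fun N ω => by
    rw [hT]; dsimp only
    rw [← Real.rpow_natCast, ← Real.rpow_mul (by linarith [hX1 N ω])]; norm_num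
  have hgsq : ∀ k ω, g k ω ^ 2 = f k ω ^ 2 / X (k + 1) ω ^ (3 / 2 : ℝ) := fun k ω => by
    simp only [hg]; rw [div_pow, hTsq]
  have hgmeas : ∀ k, Measurable[F k] (g k) := fun k =>
    (hf k).div ((hXmeas k).pow_const _)
  have hw0 : ∀ k, Measurable (w k) := fun k => (hw.measurable k).mono (F.le _) le_rfl
  have hg0 : ∀ k, Measurable (g k) := fun k => (hgmeas k).mono (F.le _) le_rfl
  have hlin : ∀ k, ∫⁻ ω, ENNReal.ofReal ((g k ω * w k ω) ^ 2) ∂P ≤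
      (M + 1 : NNReal) * ∫⁻ ω, ENNReal.ofReal (g k ω ^ 2) ∂P := fun k => by
    have := hw.lintegral_mul_sq_le hβ k (g := fun ω => ENNReal.ofReal (g k ω ^ 2))
      (((hgmeas k).pow_const 2).ennreal_ofReal)
    refine le_trans (le_of_eq ?_) this
    refine lintegral_congr fun ω => ?_
    rw [mul_pow, ENNReal.ofReal_mul (sq_nonneg _)]
  have hsum : ∀ N, ∑ k ∈ Finset.range N, ∫⁻ ω, ENNReal.ofReal (g k ω ^ 2) ∂P ≤ 2 := fun N => by
    rw [← lintegral_finsetSum _ fun k _ => ((hg0 k).pow_const 2).ennreal_ofReal]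
    calc _ ≤ ∫⁻ ω, 2 ∂P := by
          refine lintegral_mono fun ω => ?_
          rw [← ENNReal.ofReal_sum_of_nonneg fun _ _ => sq_nonneg _]
          have := sum_div_rpow_partial_sum_le (fun k => f k ω ^ 2) (fun k => sq_nonneg _)
            (δ := 3 / 2) (by norm_num) N
          rw [← ENNReal.ofReal_ofNat 2]
          refine ENNReal.ofReal_le_ofReal ?_
          simp_rw [hgsq]
          exact this.trans (by norm_num)
      _ = 2 := by simp
  have hfin : ∀ k, ∫⁻ ω, ENNReal.ofReal ((g k ω * w k ω) ^ 2) ∂P ≠ ∞ := fun k => by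
    refine ((hlin k).trans_lt ?_).ne
    refine ENNReal.mul_lt_top ENNReal.coe_lt_top (lt_of_le_of_lt ?_ (ENNReal.ofNat_lt_top (n := 2)))
    exact (Finset.single_le_sum (f := fun k => ∫⁻ ω, ENNReal.ofReal (g k ω ^ 2) ∂P)
      (fun _ _ => zero_le) (Finset.self_mem_range_succ k)).trans (hsum (k + 1))
  have hL2 : ∀ k, MemLp (fun ω => g k ω * w k ω) 2 P := fun k => by
    refine (memLp_two_iff_integrable_sq ((hg0 k).mul (hw0 k)).aestronglyMeasurable).2 ?_
    refine ⟨(((hg0 k).mul (hw0 k)).pow_const 2).aestronglyMeasurable, ?_⟩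
    rw [hasFiniteIntegral_iff_ofReal (Eventually.of_forall fun _ => sq_nonneg _)]
    exact (hfin k).lt_top
  have hbd := ae_abs_sum_le_of_martingale_diff (P := P) F (fun k ω => g k ω * w k ω)
    (fun k => (((hgmeas k).mono (F.mono (Nat.le_succ k)) le_rfl).mul
      (hw.measurable k)).stronglyMeasurable) hL2 (fun k => by
        have h1 := condExp_mul_of_stronglyMeasurable_left (μ := P) (m := F k)
          (hgmeas k).stronglyMeasurable ((hL2 k).integrable (by norm_num)) (hw.integrable k)
        filter_upwards [h1, hw.condExp_eq_zero k] with ω h1 h2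
        refine h1.trans ?_
        rw [Pi.mul_apply, h2]; simp) ((M + 1 : NNReal) * 2) (fun N => by
        have e : ∀ k, ∫ ω, (g k ω * w k ω) ^ 2 ∂P =
            (∫⁻ ω, ENNReal.ofReal ((g k ω * w k ω) ^ 2) ∂P).toReal := fun k =>
          integral_eq_lintegral_of_nonneg_ae (Eventually.of_forall fun _ => sq_nonneg _)
            (((hg0 k).mul (hw0 k)).pow_const 2).aestronglyMeasurable
        simp_rw [e]
        rw [← ENNReal.toReal_sum fun k _ => hfin k]
        refine ENNReal.toReal_le_of_le_ofReal (by positivity) ?_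
        calc _ ≤ ∑ k ∈ Finset.range N, ((M + 1 : NNReal) : ℝ≥0∞) *
              ∫⁻ ω, ENNReal.ofReal (g k ω ^ 2) ∂P := Finset.sum_le_sum fun k _ => hlin k
          _ ≤ (M + 1 : NNReal) * 2 := by rw [← Finset.mul_sum]; gcongr; exact hsum N
          _ = _ := by
            rw [ENNReal.ofReal_mul (by positivity), ENNReal.ofReal_coe_nnreal]; simp)
  filter_upwards [hbd] with ω hω
  obtain ⟨b, hb⟩ := hω
  refine ⟨2 * b, fun N => ?_⟩
  have hmono : Monotone fun N => T N ω := monotone_nat_of_le_succ fun N => by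
    refine Real.rpow_le_rpow (by linarith [hX1 N ω]) ?_ (by norm_num)
    simp only [hX]; rw [Finset.sum_range_succ]; nlinarith [sq_nonneg (f N ω)]
  have := abs_sum_mul_le_of_abs_sum_le _ (fun N => T N ω) hmono (hTpos 0 ω).le hb N
  refine le_trans (le_of_eq ?_) this
  congr 1
  refine Finset.sum_congr rfl fun k _ => ?_
  have := (hTpos (k + 1) ω).ne'
  simp only [hg]; field_simp

end IsBoundedMomentNoise

end ARMAX

/-! ### Weighted sums of squared noise. -/

namespace ARMAX

theorem condExp_le_of_setIntegral_le {Ω : Type*} {m m0 : MeasurableSpace Ω} {P : Measure Ω}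
    [IsFiniteMeasure P] (hm : m ≤ m0) {Y g : Ω → ℝ} (hY : Integrable Y P) (hg : Integrable g P)
    (hgm : StronglyMeasurable[m] g)
    (H : ∀ A, MeasurableSet[m] A → ∫ ω in A, Y ω ∂P ≤ ∫ ω in A, g ω ∂P) :
    P[Y | m] ≤ᵐ[P] g := by
  refine ae_le_of_ae_le_trim (hm := hm) ?_
  refine ae_le_of_forall_setIntegral_le (integrable_condExp.trim hm stronglyMeasurable_condExp)
    (hg.trim hm hgm) fun A hA _ => ?_
  rw [← setIntegral_trim hm stronglyMeasurable_condExp hA, ← setIntegral_trim hm hgm hA,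
    setIntegral_condExp hm hY hA]
  exact H A hA

theorem integral_sub_condExp_sq_le {Ω : Type*} {m m0 : MeasurableSpace Ω} {P : Measure Ω}
    [IsFiniteMeasure P] (hm : m ≤ m0) {Y : Ω → ℝ} (hY : MemLp Y 2 P) :
    ∫ ω, (Y ω - (P[Y | m]) ω) ^ 2 ∂P ≤ ∫ ω, Y ω ^ 2 ∂P := by
  have h1 : ∫ ω, (Y ω - (P[Y | m]) ω) ^ 2 ∂P = ∫ ω, (Var[Y; P | m]) ω ∂P := by
    rw [condVar, integral_condExp hm]; rfl
  have h2 : ∫ ω, Y ω ^ 2 ∂P = ∫ ω, (P[Y ^ 2 | m]) ω ∂P := by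
    rw [integral_condExp hm]; rfl
  rw [h1, h2]
  exact integral_mono_ae integrable_condVar integrable_condExp (condVar_ae_le_condExp_sq hm hY)

namespace IsBoundedMomentNoise

variable {Ω : Type*} {m0 : MeasurableSpace Ω} {P : Measure Ω}
variable {F : Filtration ℕ m0} {w : ℕ → Ω → ℝ} {β : ℝ} {M : NNReal}

/-- The squares `w²` need not have second moments, so they are truncated. For `Z = c w² / T` with
`T` the running sum of weights, `∑ E Z ^ (β/2)` is finite, hence `Z ≤ 1` eventually by
Borel–Cantelli. The truncated `Y` has summable second moments, so its centred sums are bounded, and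
its compensator is at most `(M + 1) c / T`. Summation by parts removes `T`. -/
theorem ae_exists_sum_mul_sq_le [IsProbabilityMeasure P] (hw : IsBoundedMomentNoise P F w β M)
    (hβ : 2 < β) (hβ4 : β ≤ 4) (c : ℕ → Ω → ℝ) (hc : ∀ k, Measurable[F k] (c k))
    (hc0 : ∀ k ω, 0 ≤ c k ω) (hc1 : ∀ k ω, c k ω ≤ 1) :
    ∀ᵐ ω ∂P, ∃ b, ∀ N, ∑ k ∈ Finset.range N, c k ω * w k ω ^ 2 ≤
      b * (1 + ∑ k ∈ Finset.range N, c k ω) := by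
  set δ : ℝ := β / 2 with hδ
  have hδ1 : 1 < δ := by rw [hδ]; linarith
  have hδ2 : δ ≤ 2 := by rw [hδ]; linarith
  set T : ℕ → Ω → ℝ := fun N ω => 1 + ∑ k ∈ Finset.range N, c k ω with hT
  have hT1 : ∀ N ω, 1 ≤ T N ω := fun N ω => by
    have := Finset.sum_nonneg (s := Finset.range N) (fun j _ => hc0 j ω)
    simp only [hT]; linarith
  have hTpos : ∀ N ω, 0 < T N ω := fun N ω => by linarith [hT1 N ω]
  have hTmeas : ∀ k, Measurable[F k] (T (k + 1)) := fun k => by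
    have : ∀ j ∈ Finset.range (k + 1), Measurable[F k] (fun ω => c j ω) := fun j hj =>
      (hc j).mono (F.mono (by have := Finset.mem_range.1 hj; omega)) le_rfl
    exact (Finset.measurable_fun_sum _ this).const_add 1
  set g : ℕ → Ω → ℝ := fun k ω => c k ω / T (k + 1) ω with hg
  have hgmeas : ∀ k, Measurable[F k] (g k) := fun k => (hc k).div (hTmeas k)
  have hgn : ∀ k ω, 0 ≤ g k ω := fun k ω => div_nonneg (hc0 k ω) (hTpos _ _).le
  have hg1 : ∀ k ω, g k ω ≤ 1 := fun k ω =>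
    div_le_one_of_le₀ ((hc1 k ω).trans (hT1 _ _)) (hTpos _ _).le
  have hw0 : ∀ k, Measurable (w k) := fun k => (hw.measurable k).mono (F.le _) le_rfl
  have hg0 : ∀ k, Measurable (g k) := fun k => (hgmeas k).mono (F.le _) le_rfl
  have hgint : ∀ k, Integrable (g k) P := fun k =>
    Integrable.of_bound (hg0 k).aestronglyMeasurable 1 (Eventually.of_forall fun ω => by
      rw [Real.norm_eq_abs, abs_of_nonneg (hgn k ω)]; exact hg1 k ω)
  set Z : ℕ → Ω → ℝ := fun k ω => g k ω * w k ω ^ 2 with hZ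
  have hZn : ∀ k ω, 0 ≤ Z k ω := fun k ω => mul_nonneg (hgn k ω) (sq_nonneg _)
  have hZmeas : ∀ k, Measurable[F (k + 1)] (Z k) := fun k =>
    ((hgmeas k).mono (F.mono (Nat.le_succ k)) le_rfl).mul ((hw.measurable k).pow_const 2)
  have hZ0 : ∀ k, Measurable (Z k) := fun k => (hZmeas k).mono (F.le _) le_rfl
  have hZδ : ∀ k ω, Z k ω ^ δ = g k ω ^ δ * |w k ω| ^ β := fun k ω => by
    simp only [hZ]
    rw [Real.mul_rpow (hgn k ω) (sq_nonneg _), ← sq_abs, ← Real.rpow_natCast,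
      ← Real.rpow_mul (abs_nonneg _)]
    congr 2; rw [hδ]; push_cast; ring
  have hlin : ∀ k, ∫⁻ ω, ENNReal.ofReal (Z k ω ^ δ) ∂P ≤
      M * ∫⁻ ω, ENNReal.ofReal (g k ω ^ δ) ∂P := fun k => by
    refine le_trans (le_of_eq ?_) (hw.lintegral_mul_le k
      (g := fun ω => ENNReal.ofReal (g k ω ^ δ)) ((hgmeas k).pow_const _).ennreal_ofReal)
    refine lintegral_congr fun ω => ?_
    rw [hZδ, ENNReal.ofReal_mul (Real.rpow_nonneg (hgn k ω) _)]
  have hsum : ∀ N, ∑ k ∈ Finset.range N, ∫⁻ ω, ENNReal.ofReal (g k ω ^ δ) ∂P ≤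
      ENNReal.ofReal (1 / (δ - 1)) := fun N => by
    rw [← lintegral_finsetSum _ fun k _ => ((hg0 k).pow_const _).ennreal_ofReal]
    calc _ ≤ ∫⁻ ω, ENNReal.ofReal (1 / (δ - 1)) ∂P := by
          refine lintegral_mono fun ω => ?_
          rw [← ENNReal.ofReal_sum_of_nonneg fun k _ => Real.rpow_nonneg (hgn k ω) _]
          refine ENNReal.ofReal_le_ofReal (le_trans (Finset.sum_le_sum fun k _ => ?_)
            (sum_div_rpow_partial_sum_le (fun k => c k ω) (fun k => hc0 k ω) hδ1 N))
          simp only [hg]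
          rw [Real.div_rpow (hc0 k ω) (hTpos _ _).le]
          refine div_le_div_of_nonneg_right ?_ (Real.rpow_nonneg (hTpos _ _).le _)
          calc c k ω ^ δ ≤ c k ω ^ (1 : ℝ) :=
                Real.rpow_le_rpow_of_exponent_ge_of_imp (hc0 k ω) (hc1 k ω) hδ1.le (by
                  intro _ h; linarith)
            _ = c k ω := Real.rpow_one _
      _ = _ := by simp
  set R : ℝ≥0∞ := M * ENNReal.ofReal (1 / (δ - 1)) with hR
  have hRfin : R ≠ ∞ := ENNReal.mul_ne_top ENNReal.coe_ne_top ENNReal.ofReal_ne_top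
  have hZsum : ∀ N, ∑ k ∈ Finset.range N, ∫⁻ ω, ENNReal.ofReal (Z k ω ^ δ) ∂P ≤ R := fun N => by
    refine (Finset.sum_le_sum fun k _ => hlin k).trans ?_
    rw [← Finset.mul_sum]
    exact mul_le_mul' le_rfl (hsum N)
  -- the values exceeding one are finitely many
  have hBC : ∀ᵐ ω ∂P, ∀ᶠ k in atTop, ω ∉ {ω | 1 < Z k ω} := by
    refine ae_eventually_notMem (ne_top_of_le_ne_top hRfin ?_)
    refine ENNReal.tsum_le_of_sum_range_le fun N => le_trans (Finset.sum_le_sum fun k _ => ?_)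
      (hZsum N)
    have hms : MeasurableSet {ω | 1 < Z k ω} := measurableSet_lt measurable_const (hZ0 k)
    rw [← lintegral_indicator_one hms]
    refine lintegral_mono fun ω => ?_
    by_cases h : ω ∈ {ω | 1 < Z k ω}
    · rw [Set.indicator_of_mem h, Pi.one_apply, ← ENNReal.ofReal_one]
      exact ENNReal.ofReal_le_ofReal (Real.one_le_rpow (le_of_lt h) (by linarith))
    · rw [Set.indicator_of_notMem h]; exact zero_le
  set Y : ℕ → Ω → ℝ := fun k ω => if Z k ω ≤ 1 then Z k ω else 0 with hY
  have hYn : ∀ k ω, 0 ≤ Y k ω := fun k ω => by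
    simp only [hY]; split_ifs
    · exact hZn k ω
    · exact le_rfl
  have hY1 : ∀ k ω, Y k ω ≤ 1 := fun k ω => by
    simp only [hY]; split_ifs with h
    · exact h
    · exact zero_le_one
  have hYZ : ∀ k ω, Y k ω ≤ Z k ω := fun k ω => by
    simp only [hY]; split_ifs with h
    · exact le_rfl
    · exact hZn k ω
  -- On `[0, 1]` a power with exponent `δ ≤ 2` dominates the square; this uses `β ≤ 4`.
  have hYsq : ∀ k ω, Y k ω ^ 2 ≤ Z k ω ^ δ := fun k ω => by
    simp only [hY]; split_ifs with h
    · rw [← Real.rpow_natCast]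
      exact Real.rpow_le_rpow_of_exponent_ge_of_imp (hZn k ω) h (by exact_mod_cast hδ2) (by
        intro _ h; norm_num at h)
    · simpa using Real.rpow_nonneg (hZn k ω) _
  have hYmeas : ∀ k, Measurable[F (k + 1)] (Y k) := fun k =>
    Measurable.ite (measurableSet_le (hZmeas k) measurable_const) (hZmeas k) measurable_const
  have hY0 : ∀ k, Measurable (Y k) := fun k => (hYmeas k).mono (F.le _) le_rfl
  have hYL2 : ∀ k, MemLp (Y k) 2 P := fun k =>
    MemLp.of_bound (hY0 k).aestronglyMeasurable 1 (Eventually.of_forall fun ω => by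
      rw [Real.norm_eq_abs, abs_of_nonneg (hYn k ω)]; exact hY1 k ω)
  have hYint : ∀ k, Integrable (Y k) P := fun k => (hYL2 k).integrable (by norm_num)
  have hYsum : ∀ N, ∑ k ∈ Finset.range N, ∫ ω, Y k ω ^ 2 ∂P ≤ R.toReal := fun N => by
    have hle : ∀ k, ∫⁻ ω, ENNReal.ofReal (Y k ω ^ 2) ∂P ≤ ∫⁻ ω, ENNReal.ofReal (Z k ω ^ δ) ∂P :=
      fun k => lintegral_mono fun ω => ENNReal.ofReal_le_ofReal (hYsq k ω)
    have e : ∀ k, ∫ ω, Y k ω ^ 2 ∂P = (∫⁻ ω, ENNReal.ofReal (Y k ω ^ 2) ∂P).toReal := fun k =>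
      integral_eq_lintegral_of_nonneg_ae (Eventually.of_forall fun _ => sq_nonneg _)
        ((hY0 k).pow_const 2).aestronglyMeasurable
    have hfin : ∀ k, ∫⁻ ω, ENNReal.ofReal (Y k ω ^ 2) ∂P ≠ ∞ := fun k =>
      ne_top_of_le_ne_top hRfin ((hle k).trans ((Finset.single_le_sum
        (f := fun k => ∫⁻ ω, ENNReal.ofReal (Z k ω ^ δ) ∂P)
        (fun _ _ => zero_le) (Finset.self_mem_range_succ k)).trans (hZsum (k + 1))))
    simp_rw [e]
    rw [← ENNReal.toReal_sum fun k _ => hfin k]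
    exact ENNReal.toReal_mono hRfin ((Finset.sum_le_sum fun k _ => hle k).trans (hZsum N))
  have hbd := ae_abs_sum_le_of_martingale_diff (P := P) F (fun k ω => Y k ω - (P[Y k | F k]) ω)
    (fun k => (hYmeas k).stronglyMeasurable.sub
      (stronglyMeasurable_condExp.mono (F.mono (Nat.le_succ k))))
    (fun k => (hYL2 k).sub (MemLp.condExp (by norm_num) (hYL2 k)))
    (fun k => by
      have h1 := condExp_sub (hYint k) (integrable_condExp (μ := P) (m := F k) (f := Y k)) (F k)
      rw [condExp_of_stronglyMeasurable (F.le k) stronglyMeasurable_condExp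
        integrable_condExp] at h1
      filter_upwards [h1] with ω h1
      refine h1.trans ?_
      simp)
    R.toReal
    (fun N => (Finset.sum_le_sum fun k _ =>
      integral_sub_condExp_sq_le (F.le k) (hYL2 k)).trans (hYsum N))
  have hcond : ∀ k, P[Y k | F k] ≤ᵐ[P] fun ω => (M + 1) * g k ω := fun k => by
    refine condExp_le_of_setIntegral_le (F.le k) (hYint k) ((hgint k).const_mul _)
      ((hgmeas k).const_mul _).stronglyMeasurable fun A hA => ?_
    have hA0 : MeasurableSet A := F.le k A hA
    rw [integral_const_mul, integral_eq_lintegral_of_nonneg_ae (Eventually.of_forall (hYn k))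
      (hY0 k).aestronglyMeasurable, integral_eq_lintegral_of_nonneg_ae
      (Eventually.of_forall (hgn k)) (hg0 k).aestronglyMeasurable]
    have hgfin : ∫⁻ ω in A, ENNReal.ofReal (g k ω) ∂P ≠ ∞ := by
      have := (hgint k).integrableOn (s := A) |>.2
      rw [hasFiniteIntegral_iff_ofReal (Eventually.of_forall (hgn k))] at this
      exact this.ne
    have : ((M : ℝ) + 1) = ((M + 1 : NNReal) : ℝ≥0∞).toReal := by
      rw [ENNReal.coe_toReal]; push_cast; rfl
    rw [this, ← ENNReal.toReal_mul]
    refine ENNReal.toReal_mono (ENNReal.mul_ne_top ENNReal.coe_ne_top hgfin) ?_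
    have h2 := hw.lintegral_mul_sq_le hβ.le k
      (g := A.indicator fun ω => ENNReal.ofReal (g k ω))
      ((hgmeas k).ennreal_ofReal.indicator hA)
    rw [lintegral_indicator hA0] at h2
    refine le_trans ?_ h2
    rw [← lintegral_indicator hA0]
    refine lintegral_mono fun ω => ?_
    by_cases h : ω ∈ A
    · simp only [Set.indicator_of_mem h]
      rw [← ENNReal.ofReal_mul (hgn k ω)]
      exact ENNReal.ofReal_le_ofReal (hYZ k ω)
    · simp [Set.indicator_of_notMem h]
  filter_upwards [hBC, hbd, ae_all_iff.2 hcond] with ω hω1 hω2 hω3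
  obtain ⟨K, hK⟩ := eventually_atTop.1 hω1
  obtain ⟨b, hb⟩ := hω2
  have hb0 : 0 ≤ b := (abs_nonneg _).trans (hb 0)
  -- Pays for the truncation: all `k` with `Z k > 1` are below `K`.
  set C0 := ∑ k ∈ Finset.range K, T (k + 1) ω * (Z k ω - Y k ω) with hC0
  have hterm : ∀ k, 0 ≤ T (k + 1) ω * (Z k ω - Y k ω) := fun k =>
    mul_nonneg (hTpos _ _).le (sub_nonneg.2 (hYZ k ω))
  have hC0n : 0 ≤ C0 := Finset.sum_nonneg fun k _ => hterm k
  refine ⟨C0 + 2 * b + (M + 1), fun N => ?_⟩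
  have hmono : Monotone fun N => T N ω := monotone_nat_of_le_succ fun N => by
    simp only [hT]; rw [Finset.sum_range_succ]; linarith [hc0 N ω]
  have habel := (abs_le.1 (abs_sum_mul_le_of_abs_sum_le _ (fun N => T N ω) hmono
    (hTpos 0 ω).le hb N)).2
  have h1 : ∑ k ∈ Finset.range N, T (k + 1) ω * (Z k ω - Y k ω) ≤ C0 := by
    refine (Finset.sum_le_sum_of_subset_of_nonneg (Finset.range_mono (le_max_left N K))
      fun k _ _ => hterm k).trans (le_of_eq ?_)
    symm
    refine Finset.sum_subset (Finset.range_mono (le_max_right N K)) fun k _ hk => ?_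
    have hk : K ≤ k := by simpa using hk
    have : Z k ω ≤ 1 := not_lt.1 (hK k hk)
    simp [hY, this]
  have h2 : ∑ k ∈ Finset.range N, T (k + 1) ω * (P[Y k | F k]) ω ≤
      ∑ k ∈ Finset.range N, (M + 1) * c k ω := by
    refine Finset.sum_le_sum fun k _ => ?_
    refine (mul_le_mul_of_nonneg_left (hω3 k) (hTpos (k + 1) ω).le).trans (le_of_eq ?_)
    have := (hTpos (k + 1) ω).ne'
    simp only [hg]; field_simp
  have h3 : ∑ k ∈ Finset.range N, c k ω * w k ω ^ 2 =
      ∑ k ∈ Finset.range N, T (k + 1) ω * (Z k ω - Y k ω) +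
      ∑ k ∈ Finset.range N, T (k + 1) ω * (Y k ω - (P[Y k | F k]) ω) +
      ∑ k ∈ Finset.range N, T (k + 1) ω * (P[Y k | F k]) ω := by
    rw [← Finset.sum_add_distrib, ← Finset.sum_add_distrib]
    refine Finset.sum_congr rfl fun k _ => ?_
    have := (hTpos (k + 1) ω).ne'
    simp only [hZ, hg]; field_simp; ring
  rw [← Finset.mul_sum] at h2
  have hTN := hT1 N ω
  have h4 : ∑ k ∈ Finset.range N, c k ω ≤ T N ω := by simp only [hT]; linarith
  have hM : (0 : ℝ) ≤ M + 1 := by positivity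
  have h5 := mul_le_mul_of_nonneg_left h4 hM
  change _ ≤ _ * T N ω
  nlinarith

end IsBoundedMomentNoise

end ARMAX

/-! ### Localisation: from uniform to pathwise moment bounds. -/

namespace ARMAX

/-- A martingale difference sequence `w k`, `k ≥ 1`, known at time `k + 1`, whose conditional
moments of some order above two are pathwise bounded. -/
structure IsMomentNoise {Ω : Type*} {m0 : MeasurableSpace Ω} (P : Measure Ω)
    (F : Filtration ℕ m0) (w : ℕ → Ω → ℝ) : Prop where
  measurable : ∀ k, Measurable[F (k + 1)] (w k)
  integrable : ∀ k, 1 ≤ k → Integrable (w k) P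
  condExp_eq_zero : ∀ k, 1 ≤ k → P[w k | F k] =ᵐ[P] 0
  moment : ∃ β : ℝ, 2 < β ∧ ∃ Z : ℕ → Ω → ℝ≥0∞, (∀ k, Measurable[F k] (Z k)) ∧
    (∀ k, 1 ≤ k → ∀ A, MeasurableSet[F k] A →
      ∫⁻ ω in A, ENNReal.ofReal (|w k ω| ^ β) ∂P ≤ ∫⁻ ω in A, Z k ω ∂P) ∧
    ∀ᵐ ω ∂P, (⨆ k ≥ 1, Z k ω) < ∞

/-- With `z = (1 + x) ^ (1/4)`, either `z ≥ B / ε`, and then `B z³ ≤ ε z⁴`, or `z³` is bounded. -/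
theorem exists_mul_rpow_le (b : ℝ) {ε : ℝ} (hε : 0 < ε) :
    ∃ b', ∀ x, 0 ≤ x → b * (1 + x) ^ (3 / 4 : ℝ) ≤ ε * x + b' := by
  set B := max b 1 with hB
  have hB1 : 0 < B := lt_of_lt_of_le one_pos (le_max_right b 1)
  refine ⟨ε + B * (B / ε) ^ 3, fun x hx => ?_⟩
  set z := (1 + x) ^ (1 / 4 : ℝ) with hz
  have hx1 : 0 ≤ 1 + x := by linarith
  have hz0 : 0 ≤ z := Real.rpow_nonneg hx1 _
  have h4 : z ^ 4 = 1 + x := by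
    rw [hz, ← Real.rpow_natCast, ← Real.rpow_mul hx1]; norm_num
  have h3 : (1 + x) ^ (3 / 4 : ℝ) = z ^ 3 := by
    rw [hz, ← Real.rpow_natCast, ← Real.rpow_mul hx1]; norm_num
  rw [h3]
  have h1 : b * z ^ 3 ≤ B * z ^ 3 := mul_le_mul_of_nonneg_right (le_max_left b 1) (by positivity)
  have h2 : B * z ^ 3 ≤ ε * z ^ 4 + B * (B / ε) ^ 3 := by
    rcases le_total (B / ε) z with h | h
    · have : B ≤ z * ε := (div_le_iff₀ hε).1 h
      have h5 : B * z ^ 3 ≤ z * ε * z ^ 3 := mul_le_mul_of_nonneg_right this (by positivity)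
      have h6 : 0 ≤ B * (B / ε) ^ 3 := by positivity
      nlinarith
    · have : z ^ 3 ≤ (B / ε) ^ 3 := pow_le_pow_left₀ hz0 h 3
      have h5 := mul_le_mul_of_nonneg_left this hB1.le
      have h6 : 0 ≤ ε * z ^ 4 := by positivity
      linarith
  rw [h4] at h2
  linarith

variable {Ω : Type*} {m0 : MeasurableSpace Ω} {P : Measure Ω}
variable {F : Filtration ℕ m0} {w : ℕ → Ω → ℝ}

/-- Multiply `w k` by the indicator of `{k ≥ 1, Z k ≤ M}`. This event is known at time `k`, so the
result is again a martingale difference, now with moments bounded by `M`. Almost every path has a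
finite supremum of `Z`, so some integer `M` leaves it unchanged from time `1` on. -/
theorem ae_of_forall_truncation {β : ℝ} (hβ : 0 < β)
    (hwm : ∀ k, Measurable[F (k + 1)] (w k)) (hint : ∀ k, 1 ≤ k → Integrable (w k) P)
    (h0 : ∀ k, 1 ≤ k → P[w k | F k] =ᵐ[P] 0)
    (Z : ℕ → Ω → ℝ≥0∞) (hZ : ∀ k, Measurable[F k] (Z k))
    (hmom : ∀ k, 1 ≤ k → ∀ A, MeasurableSet[F k] A →
      ∫⁻ ω in A, ENNReal.ofReal (|w k ω| ^ β) ∂P ≤ ∫⁻ ω in A, Z k ω ∂P)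
    (hfin : ∀ᵐ ω ∂P, (⨆ k ≥ 1, Z k ω) < ∞) {Q : (ℕ → ℝ) → Ω → Prop}
    (H : ∀ w' M, IsBoundedMomentNoise P F w' β M → ∀ᵐ ω ∂P, Q (fun k => w' k ω) ω) :
    ∀ᵐ ω ∂P, Q (fun k => if 1 ≤ k then w k ω else 0) ω := by
  set G : ℕ → ℕ → Set Ω := fun M k => {ω | 1 ≤ k ∧ Z k ω ≤ M} with hG
  have hGm : ∀ M k, MeasurableSet[F k] (G M k) := fun M k => by
    refine MeasurableSet.inter (MeasurableSet.const _) ?_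
    exact measurableSet_le (hZ k) measurable_const
  have key : ∀ M : ℕ, IsBoundedMomentNoise P F (fun k => (G M k).indicator (w k)) β M := by
    intro M
    refine ⟨fun k => (hwm k).indicator (F.mono (Nat.le_succ k) _ (hGm M k)), fun k => ?_,
      fun k => ?_, fun k A hA => ?_⟩
    · rcases Nat.eq_zero_or_pos k with hk | hk
      · have : G M k = ∅ := by ext ω; simp [hG, hk]
        simp [this]
      · exact (hint k hk).indicator (F.le k _ (hGm M k))
    · rcases Nat.eq_zero_or_pos k with hk | hk
      · have : G M k = ∅ := by ext ω; simp [hG, hk]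
        rw [this, Set.indicator_empty']
        exact (condExp_zero (μ := P) (m := F k) (E := ℝ)).eventuallyEq
      · filter_upwards [condExp_indicator (hint k hk) (hGm M k), h0 k hk] with ω h1 h2
        rw [h1, Set.indicator_apply, h2]; simp
    · rcases Nat.eq_zero_or_pos k with hk | hk
      · have : G M k = ∅ := by ext ω; simp [hG, hk]
        simp [this, Real.zero_rpow hβ.ne']
      have e : ∀ ω, ENNReal.ofReal (|(G M k).indicator (w k) ω| ^ β) =
          (G M k).indicator (fun ω => ENNReal.ofReal (|w k ω| ^ β)) ω := fun ω => by
        by_cases h : ω ∈ G M k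
        · simp [h]
        · simp [h, Real.zero_rpow hβ.ne']
      simp_rw [e]
      have hG0 : MeasurableSet (G M k) := F.le k _ (hGm M k)
      rw [lintegral_indicator hG0, Measure.restrict_restrict hG0]
      refine (hmom k hk _ ((hGm M k).inter hA)).trans ?_
      calc ∫⁻ ω in G M k ∩ A, Z k ω ∂P ≤ ∫⁻ ω in G M k ∩ A, M ∂P :=
            setLIntegral_mono measurable_const fun ω hω => hω.1.2
        _ = M * P (G M k ∩ A) := by simp
        _ ≤ M * P A := by gcongr; exact Set.inter_subset_right
        _ = _ := by simp
  have hall := ae_all_iff.2 fun M : ℕ => H _ M (key M)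
  filter_upwards [hall, hfin] with ω hω hf
  obtain ⟨M, hM⟩ := ENNReal.exists_nat_gt hf.ne
  have e : (fun k => if 1 ≤ k then w k ω else 0) = fun k => (G M k).indicator (w k) ω := by
    funext k
    by_cases hk : 1 ≤ k
    · have : ω ∈ G M k := ⟨hk, (le_iSup₂ (f := fun k (_ : k ≥ 1) => Z k ω) k hk).trans hM.le⟩
      rw [Set.indicator_of_mem this, if_pos hk]
    · have : ω ∉ G M k := fun h => hk h.1
      rw [Set.indicator_of_notMem this, if_neg hk]
  rw [e]
  exact hω M

namespace IsMomentNoise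

theorem ae_exists_sum_mul_sq_le [IsProbabilityMeasure P] (hw : IsMomentNoise P F w)
    (c : ℕ → Ω → ℝ) (hc : ∀ k, Measurable[F k] (c k)) (hc0 : ∀ k ω, 0 ≤ c k ω)
    (hc1 : ∀ k ω, c k ω ≤ 1) :
    ∀ᵐ ω ∂P, ∃ b, ∀ N, ∑ k ∈ Finset.range N, c k ω * w k ω ^ 2 ≤
      b * (1 + ∑ k ∈ Finset.range N, c k ω) := by
  obtain ⟨β, hβ, Z, hZ, hmom, hfin⟩ := hw.moment
  have := ae_of_forall_truncation (by linarith) hw.measurable hw.integrable hw.condExp_eq_zero Z hZ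
    hmom hfin (Q := fun w ω => ∃ b, ∀ N, ∑ k ∈ Finset.range N, c k ω * w k ^ 2 ≤
      b * (1 + ∑ k ∈ Finset.range N, c k ω)) (fun w' M hw' =>
        (hw'.mono (β' := min β 4) (le_min (by linarith) (by norm_num))
          (min_le_left _ _)).ae_exists_sum_mul_sq_le (lt_min hβ (by norm_num))
          (min_le_right _ _) c hc hc0 hc1)
  filter_upwards [this] with ω hω
  obtain ⟨b, hb⟩ := hω
  -- The localised noise is zero at `k = 0`; as `c 0 ≤ 1`, the missing term costs at most `w 0 ^ 2`.
  refine ⟨b + w 0 ω ^ 2, fun N => ?_⟩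
  have hS : 0 ≤ ∑ k ∈ Finset.range N, c k ω := Finset.sum_nonneg fun k _ => hc0 k ω
  have h1 : ∑ k ∈ Finset.range N, c k ω * w k ω ^ 2 ≤
      ∑ k ∈ Finset.range N, c k ω * (if 1 ≤ k then w k ω else 0) ^ 2 + w 0 ω ^ 2 := by
    rcases N with _ | N
    · simpa using sq_nonneg (w 0 ω)
    rw [Finset.sum_range_succ', Finset.sum_range_succ']
    have := mul_le_mul_of_nonneg_right (hc1 0 ω) (sq_nonneg (w 0 ω))
    simp only [le_add_iff_nonneg_left, zero_le, if_true, nonpos_iff_eq_zero, one_ne_zero, if_false]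
    linarith
  nlinarith [hb N, sq_nonneg (w 0 ω)]

/-- Predictability is asked only from time `K` on, because early model errors involve noise at
nonpositive times. The finitely many early terms go into the constant. -/
theorem ae_forall_exists_abs_sum_mul_le [IsProbabilityMeasure P] (hw : IsMomentNoise P F w)
    (f : ℕ → Ω → ℝ) (K : ℕ) (hf : ∀ k, K ≤ k → Measurable[F k] (f k)) :
    ∀ᵐ ω ∂P, ∀ ε > 0, ∃ b, ∀ N, |∑ k ∈ Finset.range N, f k ω * w k ω| ≤
      ε * ∑ k ∈ Finset.range N, f k ω ^ 2 + b := by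
  obtain ⟨β, hβ, Z, hZ, hmom, hfin⟩ := hw.moment
  set f' : ℕ → Ω → ℝ := fun k => if K ≤ k then f k else 0 with hf'
  have hf'm : ∀ k, Measurable[F k] (f' k) := fun k => by
    by_cases hk : K ≤ k
    · simpa [hf', hk] using hf k hk
    · simp only [hf', hk, if_false]
      exact @measurable_const _ _ _ (F k) (0 : ℝ)
  have := ae_of_forall_truncation (by linarith) hw.measurable hw.integrable hw.condExp_eq_zero Z hZ
    hmom hfin (Q := fun w ω => ∃ b, ∀ N, |∑ k ∈ Finset.range N, f' k ω * w k| ≤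
      b * (1 + ∑ k ∈ Finset.range N, f' k ω ^ 2) ^ (3 / 4 : ℝ)) (fun w' M hw' =>
        hw'.ae_exists_abs_sum_mul_le hβ.le f' hf'm)
  filter_upwards [this] with ω hω ε hε
  obtain ⟨b, hb⟩ := hω
  obtain ⟨b', hb'⟩ := exists_mul_rpow_le b hε
  set D := ∑ k ∈ Finset.range (K + 1), |f k ω * w k ω| with hD
  refine ⟨b' + D, fun N => ?_⟩
  have h1 : ∑ k ∈ Finset.range N, f' k ω ^ 2 ≤ ∑ k ∈ Finset.range N, f k ω ^ 2 :=
    Finset.sum_le_sum fun k _ => by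
      by_cases hk : K ≤ k
      · simp [hf', hk]
      · simp [hf', hk]; exact sq_nonneg _
  have h2 : |∑ k ∈ Finset.range N, f k ω * w k ω -
      ∑ k ∈ Finset.range N, f' k ω * (if 1 ≤ k then w k ω else 0)| ≤ D := by
    rw [← Finset.sum_sub_distrib]
    have hz : ∀ k, K + 1 ≤ k → f k ω * w k ω - f' k ω * (if 1 ≤ k then w k ω else 0) = 0 :=
      fun k hk => by simp [hf', show K ≤ k by omega, show 1 ≤ k by omega]
    calc _ ≤ ∑ k ∈ Finset.range N, |f k ω * w k ω - f' k ω * (if 1 ≤ k then w k ω else 0)| :=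
          Finset.abs_sum_le_sum_abs _ _
      _ ≤ ∑ k ∈ Finset.range (max N (K + 1)),
            |f k ω * w k ω - f' k ω * (if 1 ≤ k then w k ω else 0)| :=
          Finset.sum_le_sum_of_subset_of_nonneg (Finset.range_mono (le_max_left _ _))
            fun k _ _ => abs_nonneg _
      _ = ∑ k ∈ Finset.range (K + 1),
            |f k ω * w k ω - f' k ω * (if 1 ≤ k then w k ω else 0)| := by
          symm
          refine Finset.sum_subset (Finset.range_mono (le_max_right _ _)) fun k _ hk => ?_
          rw [hz k (by simpa using hk), abs_zero]
      _ ≤ D := by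
          refine Finset.sum_le_sum fun k _ => ?_
          by_cases hk : K ≤ k <;> by_cases hk1 : 1 ≤ k <;> simp [hf', hk, hk1]
          exact mul_nonneg (abs_nonneg _) (abs_nonneg _)
  have h3 := (hb N).trans (hb' _ (Finset.sum_nonneg fun k _ => sq_nonneg _))
  have h4 := mul_le_mul_of_nonneg_left h1 hε.le
  have h5 := abs_sub_abs_le_abs_sub (∑ k ∈ Finset.range N, f k ω * w k ω)
    (∑ k ∈ Finset.range N, f' k ω * (if 1 ≤ k then w k ω else 0))
  linarith

end IsMomentNoise

end ARMAX

/-! ### Recursive least squares: information matrix, leverages and energy. -/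

noncomputable section

namespace ARMAX

variable {ι κ : Type*} [Fintype ι]

theorem covStep_eq (P : Matrix ι ι ℝ) (φ : ι → ℝ) :
    covStep P φ = P - gain P φ • Matrix.vecMulVec (P *ᵥ φ) (φ ᵥ* P) := by
  rw [covStep, Matrix.mul_vecMulVec, Matrix.vecMulVec_mul]

theorem lsStep_apply (P : Matrix ι ι ℝ) (φ : ι → ℝ) (X : Matrix ι κ ℝ) (y : κ → ℝ) (i : ι)
    (t : κ) : lsStep P φ X y i t =
      X i t + gain P φ * ((P *ᵥ φ) i * (y t - φ ⬝ᵥ fun j => X j t)) := by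
  rw [lsStep, Matrix.mul_vecMulVec]
  simp only [Matrix.add_apply, Matrix.smul_apply, Matrix.vecMulVec_apply, Pi.sub_apply,
    smul_eq_mul, Matrix.mulVec, Matrix.transpose_apply]
  congr 4
  exact dotProduct_comm _ _

variable [DecidableEq ι]

/-- The matrices `P_N` of the recursive least squares algorithm with regressors `φ`. -/
def rlsCov (μ : ℝ) (φ : ℕ → ι → ℝ) : ℕ → Matrix ι ι ℝ
  | 0 => μ⁻¹ • 1
  | N + 1 => covStep (rlsCov μ φ N) (φ N)

/-- The estimates of the recursive least squares algorithm with regressors `φ` and outputs `y`,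
where `y N` is the output that follows the regressor `φ N`. -/
def rlsEst (μ : ℝ) (φ : ℕ → ι → ℝ) (y : ℕ → κ → ℝ) : ℕ → Matrix ι κ ℝ
  | 0 => 0
  | N + 1 => lsStep (rlsCov μ φ N) (φ N) (rlsEst μ φ y N) (y N)

/-- The information matrix `μ I + ∑_{k < N} φ_k φ_kᵀ`. -/
def rlsInfo (μ : ℝ) (φ : ℕ → ι → ℝ) (N : ℕ) : Matrix ι ι ℝ :=
  μ • 1 + ∑ k ∈ Finset.range N, Matrix.vecMulVec (φ k) (φ k)

/-- The quantity `φ_Nᵀ P_{N+1} φ_N = φ_Nᵀ P_N φ_N / (1 + φ_Nᵀ P_N φ_N)`. -/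
def rlsLeverage (μ : ℝ) (φ : ℕ → ι → ℝ) (N : ℕ) : ℝ :=
  gain (rlsCov μ φ N) (φ N) * (φ N ⬝ᵥ (rlsCov μ φ N *ᵥ φ N))

theorem rlsInfo_zero {ι : Type*} [DecidableEq ι] (μ : ℝ) (φ : ℕ → ι → ℝ) : rlsInfo μ φ 0 = μ • 1 := by simp [rlsInfo]

theorem rlsInfo_succ {ι : Type*} [DecidableEq ι] (μ : ℝ) (φ : ℕ → ι → ℝ) (N : ℕ) :
    rlsInfo μ φ (N + 1) = rlsInfo μ φ N + Matrix.vecMulVec (φ N) (φ N) := by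
  simp [rlsInfo, Finset.sum_range_succ, add_assoc]

theorem rlsInfo_transpose {ι : Type*} [DecidableEq ι] (μ : ℝ) (φ : ℕ → ι → ℝ) (N : ℕ) :
    (rlsInfo μ φ N)ᵀ = rlsInfo μ φ N := by
  induction N with
  | zero => simp [rlsInfo_zero]
  | succ N ih =>
    rw [rlsInfo_succ, Matrix.transpose_add, ih, Matrix.transpose_vecMulVec]

theorem dotProduct_rlsInfo_mulVec_succ (μ : ℝ) (φ : ℕ → ι → ℝ) (N : ℕ) (x : ι → ℝ) :
    x ⬝ᵥ (rlsInfo μ φ (N + 1) *ᵥ x) = x ⬝ᵥ (rlsInfo μ φ N *ᵥ x) + (φ N ⬝ᵥ x) ^ 2 := by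
  rw [rlsInfo_succ, Matrix.add_mulVec, dotProduct_add, Matrix.vecMulVec_mulVec]
  simp [dotProduct_comm x (φ N), sq]

theorem dotProduct_rlsInfo_mulVec_nonneg {μ : ℝ} (hμ : 0 < μ) (φ : ℕ → ι → ℝ) (N : ℕ)
    (x : ι → ℝ) : 0 ≤ x ⬝ᵥ (rlsInfo μ φ N *ᵥ x) := by
  induction N with
  | zero =>
    rw [rlsInfo_zero, Matrix.smul_mulVec, Matrix.one_mulVec, dotProduct_smul]
    exact mul_nonneg hμ.le (Finset.sum_nonneg fun i _ => mul_self_nonneg _)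
  | succ N ih =>
    rw [dotProduct_rlsInfo_mulVec_succ]
    positivity

theorem rlsInfo_posSemidef {μ : ℝ} (hμ : 0 < μ) (φ : ℕ → ι → ℝ) (N : ℕ) :
    (rlsInfo μ φ N).PosSemidef := by
  refine Matrix.PosSemidef.of_dotProduct_mulVec_nonneg ?_ fun x => ?_
  · rw [Matrix.IsHermitian, Matrix.conjTranspose_eq_transpose_of_trivial, rlsInfo_transpose]
  · simpa using dotProduct_rlsInfo_mulVec_nonneg hμ φ N x

/-- Sherman–Morrison. Nonnegativity of `φᵀ P φ = (Pφ)ᵀ Q (Pφ)` goes along in the induction, since it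
keeps the denominator of the gain away from zero. -/
theorem rlsCov_mul_rlsInfo {μ : ℝ} (hμ : 0 < μ) (φ : ℕ → ι → ℝ) (N : ℕ) :
    rlsCov μ φ N * rlsInfo μ φ N = 1 ∧ 0 ≤ φ N ⬝ᵥ (rlsCov μ φ N *ᵥ φ N) := by
  have hnn : ∀ N, rlsCov μ φ N * rlsInfo μ φ N = 1 →
      0 ≤ φ N ⬝ᵥ (rlsCov μ φ N *ᵥ φ N) := fun N h => by
    have h1 := dotProduct_rlsInfo_mulVec_nonneg hμ φ N (rlsCov μ φ N *ᵥ φ N)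
    rwa [Matrix.mulVec_mulVec, mul_eq_one_comm.1 h, Matrix.one_mulVec, dotProduct_comm] at h1
  suffices h : rlsCov μ φ N * rlsInfo μ φ N = 1 from ⟨h, hnn N h⟩
  induction N with
  | zero =>
    rw [rlsInfo_zero, rlsCov, smul_mul_smul_comm, inv_mul_cancel₀ hμ.ne']; simp
  | succ N ih =>
    have h0 := hnn N ih
    have hg : gain (rlsCov μ φ N) (φ N) * (1 + φ N ⬝ᵥ (rlsCov μ φ N *ᵥ φ N)) = 1 :=
      inv_mul_cancel₀ (by positivity)
    rw [rlsCov, covStep_eq, rlsInfo_succ, sub_mul, mul_add, mul_add, ih, smul_mul_assoc,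
      smul_mul_assoc, Matrix.vecMulVec_mul, Matrix.mul_vecMulVec, Matrix.vecMul_vecMul, ih,
      Matrix.vecMul_one, Matrix.vecMulVec_mul_vecMulVec, ← Matrix.dotProduct_mulVec]
    set z := rlsCov μ φ N *ᵥ φ N
    set a := gain (rlsCov μ φ N) (φ N)
    ext i j
    simp only [Matrix.sub_apply, Matrix.add_apply, Matrix.smul_apply, Matrix.vecMulVec_apply,
      smul_eq_mul, Pi.smul_apply]
    linear_combination (- (z i * φ N j)) * hg

theorem rlsLeverage_nonneg {μ : ℝ} (hμ : 0 < μ) (φ : ℕ → ι → ℝ) (N : ℕ) :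
    0 ≤ rlsLeverage μ φ N := by
  have h := (rlsCov_mul_rlsInfo hμ φ N).2
  exact mul_nonneg (inv_nonneg.2 (by linarith)) h

theorem rlsLeverage_le_one {μ : ℝ} (hμ : 0 < μ) (φ : ℕ → ι → ℝ) (N : ℕ) :
    rlsLeverage μ φ N ≤ 1 := by
  have h := (rlsCov_mul_rlsInfo hμ φ N).2
  rw [rlsLeverage, gain, inv_mul_le_one₀ (by linarith)]
  linarith

/-- Factor `Q_{N+1} = Q_N (1 + P_N φ φᵀ)` and apply the matrix determinant lemma. -/
theorem rlsInfo_det_succ {μ : ℝ} (hμ : 0 < μ) (φ : ℕ → ι → ℝ) (N : ℕ) :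
    (rlsInfo μ φ (N + 1)).det =
      (rlsInfo μ φ N).det * (1 + φ N ⬝ᵥ (rlsCov μ φ N *ᵥ φ N)) := by
  have h := mul_eq_one_comm.1 (rlsCov_mul_rlsInfo hμ φ N).1
  have e : rlsInfo μ φ (N + 1) = rlsInfo μ φ N *
      (1 + Matrix.vecMulVec (rlsCov μ φ N *ᵥ φ N) (φ N)) := by
    rw [rlsInfo_succ, mul_add, mul_one, Matrix.mul_vecMulVec, Matrix.mulVec_mulVec, h,
      Matrix.one_mulVec]
  rw [e, Matrix.det_mul, Matrix.vecMulVec_eq Unit, Matrix.det_one_add_replicateCol_mul_replicateRow]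

theorem rlsInfo_det_pos {μ : ℝ} (hμ : 0 < μ) (φ : ℕ → ι → ℝ) (N : ℕ) :
    0 < (rlsInfo μ φ N).det := by
  induction N with
  | zero => rw [rlsInfo_zero, Matrix.det_smul, Matrix.det_one]; positivity
  | succ N ih =>
    rw [rlsInfo_det_succ hμ]
    have h := (rlsCov_mul_rlsInfo hμ φ N).2
    positivity

theorem rlsInfo_trace (μ : ℝ) (φ : ℕ → ι → ℝ) (N : ℕ) :
    (rlsInfo μ φ N).trace =
      Fintype.card ι * μ + ∑ k ∈ Finset.range N, ∑ i, φ k i ^ 2 := by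
  rw [rlsInfo, Matrix.trace_add, Matrix.trace_smul, Matrix.trace_one, Matrix.trace_sum]
  simp only [Matrix.trace_vecMulVec, smul_eq_mul, mul_comm μ]
  simp only [dotProduct, sq]

/-- Each eigenvalue is at most the trace. The crude power is harmless because only logarithms of it
are used. -/
theorem det_le_trace_pow {A : Matrix ι ι ℝ} (hA : A.PosSemidef) :
    A.det ≤ A.trace ^ Fintype.card ι := by
  have h1 := hA.isHermitian.det_eq_prod_eigenvalues
  have h2 := hA.isHermitian.trace_eq_sum_eigenvalues
  simp only [RCLike.ofReal_real_eq_id, id] at h1 h2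
  rw [h1, h2, ← Finset.card_univ]
  rw [← Finset.prod_const]
  refine Finset.prod_le_prod (fun i _ => hA.eigenvalues_nonneg i) fun i hi => ?_
  exact Finset.single_le_sum (fun j _ => hA.eigenvalues_nonneg j) hi

/-- A leverage is `1 - 1 / (1 + φᵀ P φ) ≤ log (1 + φᵀ P φ)`, which is the increment of `log det Q`;
the sum telescopes. -/
theorem sum_rlsLeverage_le {μ : ℝ} (hμ : 0 < μ) (φ : ℕ → ι → ℝ) (N : ℕ) :
    ∑ k ∈ Finset.range N, rlsLeverage μ φ k ≤
      Fintype.card ι * Real.log (rlsInfo μ φ N).trace - Fintype.card ι * Real.log μ := by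
  have h1 : ∑ k ∈ Finset.range N, rlsLeverage μ φ k ≤
      Real.log (rlsInfo μ φ N).det - Real.log (rlsInfo μ φ 0).det := by
    induction N with
    | zero => simp
    | succ N ih =>
      have h := (rlsCov_mul_rlsInfo hμ φ N).2
      rw [Finset.sum_range_succ, rlsInfo_det_succ hμ,
        Real.log_mul (rlsInfo_det_pos hμ φ N).ne' (by positivity)]
      have h2 := Real.one_sub_inv_le_log_of_pos
        (show 0 < 1 + φ N ⬝ᵥ (rlsCov μ φ N *ᵥ φ N) by positivity)
      have h3 : rlsLeverage μ φ N = 1 - (1 + φ N ⬝ᵥ (rlsCov μ φ N *ᵥ φ N))⁻¹ := by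
        rw [rlsLeverage, gain]; field_simp; ring
      linarith
  have h2 : Real.log (rlsInfo μ φ 0).det = Fintype.card ι * Real.log μ := by
    rw [rlsInfo_zero, Matrix.det_smul, Matrix.det_one, mul_one, Real.log_pow]
  have h3 : Real.log (rlsInfo μ φ N).det ≤ Fintype.card ι * Real.log (rlsInfo μ φ N).trace := by
    rw [← Real.log_pow]
    exact Real.log_le_log (rlsInfo_det_pos hμ φ N) (det_le_trace_pow (rlsInfo_posSemidef hμ φ N))
  linarith

/-- The error of the estimate of one column of the parameter `θ`. -/
def rlsErr (μ : ℝ) (φ : ℕ → ι → ℝ) (y : ℕ → κ → ℝ) (θ : Matrix ι κ ℝ) (N : ℕ) (t : κ) : ι → ℝ :=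
  fun i => θ i t - rlsEst μ φ y N i t

/-- The a posteriori prediction error `(θ - θ_{N+1})ᵀ φ_N`. -/
def rlsPost (μ : ℝ) (φ : ℕ → ι → ℝ) (y : ℕ → κ → ℝ) (θ : Matrix ι κ ℝ) (N : ℕ) (t : κ) : ℝ :=
  φ N ⬝ᵥ rlsErr μ φ y θ (N + 1) t

theorem rlsErr_succ (μ : ℝ) (φ : ℕ → ι → ℝ) (y : ℕ → κ → ℝ) (θ : Matrix ι κ ℝ) (N : ℕ) (t : κ) :
    rlsErr μ φ y θ (N + 1) t = rlsErr μ φ y θ N t -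
      (gain (rlsCov μ φ N) (φ N) * (φ N ⬝ᵥ rlsErr μ φ y θ N t +
        (y N t - φ N ⬝ᵥ fun i => θ i t))) • (rlsCov μ φ N *ᵥ φ N) := by
  funext i
  have e : φ N ⬝ᵥ rlsErr μ φ y θ N t =
      (φ N ⬝ᵥ fun i => θ i t) - φ N ⬝ᵥ fun i => rlsEst μ φ y N i t := by
    rw [← dotProduct_sub]; rfl
  simp only [rlsErr, Pi.sub_apply, Pi.smul_apply, smul_eq_mul] at e ⊢
  rw [e, rlsEst, lsStep_apply]
  ring

/-- With `v = y_N - θᵀ φ_N`, the a posteriori error is an affine function of `v`. -/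
theorem rlsPost_eq (μ : ℝ) (φ : ℕ → ι → ℝ) (y : ℕ → κ → ℝ) (θ : Matrix ι κ ℝ) {hμ : 0 < μ} (N : ℕ)
    (t : κ) : rlsPost μ φ y θ N t =
      gain (rlsCov μ φ N) (φ N) * (φ N ⬝ᵥ rlsErr μ φ y θ N t) -
        rlsLeverage μ φ N * (y N t - φ N ⬝ᵥ fun i => θ i t) := by
  have h := (rlsCov_mul_rlsInfo hμ φ N).2
  have hg : gain (rlsCov μ φ N) (φ N) * (1 + φ N ⬝ᵥ (rlsCov μ φ N *ᵥ φ N)) = 1 :=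
    inv_mul_cancel₀ (by positivity)
  rw [rlsPost, rlsErr_succ, dotProduct_sub, dotProduct_smul, rlsLeverage, smul_eq_mul]
  linear_combination (- (φ N ⬝ᵥ rlsErr μ φ y θ N t)) * hg

/-- The Lyapunov function of recursive least squares, for one column of the parameter. -/
def rlsEnergy (μ : ℝ) (φ : ℕ → ι → ℝ) (y : ℕ → κ → ℝ) (θ : Matrix ι κ ℝ) (N : ℕ) (t : κ) : ℝ :=
  rlsErr μ φ y θ N t ⬝ᵥ (rlsInfo μ φ N *ᵥ rlsErr μ φ y θ N t)

/-- With `s` the a posteriori error and `v` the disturbance, the old error is the new one plus `(s +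
v) P_N φ`. Expanding the old energy in `Q_N` gives an identity, from which the nonnegative term `(s
+ v)² φᵀ P_N φ` is dropped. -/
theorem rlsEnergy_succ_le {μ : ℝ} (hμ : 0 < μ) (φ : ℕ → ι → ℝ) (y : ℕ → κ → ℝ)
    (θ : Matrix ι κ ℝ) (N : ℕ) (t : κ) :
    rlsEnergy μ φ y θ (N + 1) t ≤ rlsEnergy μ φ y θ N t - rlsPost μ φ y θ N t ^ 2 -
      2 * (y N t - φ N ⬝ᵥ fun i => θ i t) * rlsPost μ φ y θ N t := by
  obtain ⟨hPQ, hz0⟩ := rlsCov_mul_rlsInfo hμ φ N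
  have hQz : rlsInfo μ φ N *ᵥ (rlsCov μ φ N *ᵥ φ N) = φ N := by
    rw [Matrix.mulVec_mulVec, mul_eq_one_comm.1 hPQ, Matrix.one_mulVec]
  have hg : gain (rlsCov μ φ N) (φ N) * (1 + φ N ⬝ᵥ (rlsCov μ φ N *ᵥ φ N)) = 1 :=
    inv_mul_cancel₀ (by positivity)
  rw [rlsEnergy, dotProduct_rlsInfo_mulVec_succ]
  have hs : φ N ⬝ᵥ rlsErr μ φ y θ (N + 1) t = rlsPost μ φ y θ N t := rfl
  rw [hs]
  have hstep := rlsErr_succ μ φ y θ N t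
  have hs2 := rlsPost_eq (hμ := hμ) μ φ y θ N t
  rw [rlsLeverage] at hs2
  set x := rlsErr μ φ y θ N t with hx
  set x' := rlsErr μ φ y θ (N + 1) t with hx'
  set s := rlsPost μ φ y θ N t
  set v := y N t - φ N ⬝ᵥ fun i => θ i t
  set a := gain (rlsCov μ φ N) (φ N)
  set z := rlsCov μ φ N *ᵥ φ N
  have hsv : a * (φ N ⬝ᵥ x + v) = s + v := by rw [hs2]; linear_combination v * hg
  rw [hsv] at hstep
  have hxx : x = x' + (s + v) • z := by rw [hstep]; simp
  have hE : rlsEnergy μ φ y θ N t = x' ⬝ᵥ (rlsInfo μ φ N *ᵥ x') + 2 * (s + v) * s +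
      (s + v) ^ 2 * (φ N ⬝ᵥ z) := by
    rw [rlsEnergy, ← hx, hxx, Matrix.mulVec_add, Matrix.mulVec_smul, hQz, dotProduct_add,
      add_dotProduct, add_dotProduct, smul_dotProduct, smul_dotProduct, dotProduct_smul,
      dotProduct_smul, Matrix.dotProduct_mulVec z, ← Matrix.mulVec_transpose, rlsInfo_transpose,
      hQz, hs, dotProduct_comm z (φ N), dotProduct_comm x' (φ N), hs]
    simp only [smul_eq_mul]
    ring
  rw [hE]
  nlinarith [mul_nonneg (sq_nonneg (s + v)) hz0]

end ARMAX
end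

/-! ### Measurability of the recursion and the stochastic energy inequality. -/

noncomputable section

namespace ARMAX

section Measurability

variable {Ω ι κ : Type*} [Fintype ι] {mΩ : MeasurableSpace Ω}

theorem measurable_dotProduct {x z : Ω → ι → ℝ} (hx : ∀ i, Measurable fun ω => x ω i)
    (hz : ∀ i, Measurable fun ω => z ω i) : Measurable fun ω => x ω ⬝ᵥ z ω :=
  Finset.measurable_fun_sum _ fun i _ => (hx i).mul (hz i)

theorem measurable_mulVec {A : Ω → Matrix ι ι ℝ} {x : Ω → ι → ℝ}
    (hA : ∀ i j, Measurable fun ω => A ω i j) (hx : ∀ i, Measurable fun ω => x ω i) (i : ι) :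
    Measurable fun ω => (A ω *ᵥ x ω) i :=
  measurable_dotProduct (hA i) hx

theorem measurable_gain {A : Ω → Matrix ι ι ℝ} {x : Ω → ι → ℝ}
    (hA : ∀ i j, Measurable fun ω => A ω i j) (hx : ∀ i, Measurable fun ω => x ω i) :
    Measurable fun ω => gain (A ω) (x ω) :=
  ((measurable_dotProduct hx (measurable_mulVec hA hx)).const_add 1).inv

theorem measurable_covStep {A : Ω → Matrix ι ι ℝ} {x : Ω → ι → ℝ}
    (hA : ∀ i j, Measurable fun ω => A ω i j) (hx : ∀ i, Measurable fun ω => x ω i) (i j : ι) :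
    Measurable fun ω => covStep (A ω) (x ω) i j := by
  simp only [covStep_eq, Matrix.sub_apply, Matrix.smul_apply, Matrix.vecMulVec_apply, smul_eq_mul]
  exact (hA i j).sub ((measurable_gain hA hx).mul ((measurable_mulVec hA hx i).mul
    (measurable_dotProduct hx fun k => hA k j)))

theorem measurable_lsStep {A : Ω → Matrix ι ι ℝ} {x : Ω → ι → ℝ} {X : Ω → Matrix ι κ ℝ}
    {y : Ω → κ → ℝ} (hA : ∀ i j, Measurable fun ω => A ω i j)
    (hx : ∀ i, Measurable fun ω => x ω i) (hX : ∀ i t, Measurable fun ω => X ω i t)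
    (hy : ∀ t, Measurable fun ω => y ω t) (i : ι) (t : κ) :
    Measurable fun ω => lsStep (A ω) (x ω) (X ω) (y ω) i t := by
  simp only [lsStep_apply]
  exact (hX i t).add ((measurable_gain hA hx).mul ((measurable_mulVec hA hx i).mul
    ((hy t).sub (measurable_dotProduct hx fun k => hX k t))))

end Measurability

variable {Ω ι κ : Type*} [Fintype ι] [DecidableEq ι] {m0 : MeasurableSpace Ω} {P : Measure Ω}
  {F : Filtration ℕ m0} {φ : ℕ → Ω → ι → ℝ} {y w : ℕ → Ω → κ → ℝ}

theorem measurable_rlsCov (μ : ℝ) (hφ : ∀ k i, Measurable[F k] fun ω => φ k ω i) (N : ℕ) :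
    ∀ i j, Measurable[F N] fun ω => rlsCov μ (fun k => φ k ω) N i j := by
  induction N with
  | zero => intro i j; exact measurable_const
  | succ N ih =>
    intro i j
    exact (measurable_covStep ih (hφ N) i j).mono (F.mono (Nat.le_succ N)) le_rfl

theorem measurable_rlsEst (μ : ℝ) (hφ : ∀ k i, Measurable[F k] fun ω => φ k ω i)
    (hy : ∀ k t, Measurable[F (k + 1)] fun ω => y k ω t) (N : ℕ) :
    ∀ i t, Measurable[F N] fun ω => rlsEst μ (fun k => φ k ω) (fun k => y k ω) N i t := by
  induction N with
  | zero => intro i j; exact measurable_const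
  | succ N ih =>
    intro i j
    have hle := F.mono (Nat.le_succ N)
    exact measurable_lsStep (fun i j => (measurable_rlsCov μ hφ N i j).mono hle le_rfl)
      (fun i => (hφ N i).mono hle le_rfl) (fun i t => (ih i t).mono hle le_rfl) (hy N) i j

theorem measurable_rlsLeverage (μ : ℝ) (hφ : ∀ k i, Measurable[F k] fun ω => φ k ω i) (N : ℕ) :
    Measurable[F N] fun ω => rlsLeverage μ (fun k => φ k ω) N := by
  have h := measurable_rlsCov μ hφ N
  exact (measurable_gain h (hφ N)).mul (measurable_dotProduct (hφ N) (measurable_mulVec h (hφ N)))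

/-- The energy inequality of recursive least squares for the model `y = θᵀ φ + w + e`. -/
theorem ae_rlsEnergy_add_sum_le [Fintype κ] [IsProbabilityMeasure P] {μ : ℝ} (hμ : 0 < μ)
    (θ : Matrix ι κ ℝ) (hφ : ∀ k i, Measurable[F k] fun ω => φ k ω i)
    (hy : ∀ k t, Measurable[F (k + 1)] fun ω => y k ω t)
    (hw : ∀ t, IsMomentNoise P F fun k ω => w k ω t) (e : ℕ → Ω → κ → ℝ)
    (hye : ∀ k ω t, y k ω t = (φ k ω ⬝ᵥ fun i => θ i t) + w k ω t + e k ω t) (K : ℕ)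
    (he : ∀ k, K ≤ k → ∀ t, Measurable[F k] fun ω => e k ω t) :
    ∀ᵐ ω ∂P, ∀ ε > 0, ∃ b, ∀ N,
      ∑ t, rlsEnergy μ (fun k => φ k ω) (fun k => y k ω) θ N t +
        ∑ k ∈ Finset.range N, ∑ t, (rlsPost μ (fun k => φ k ω) (fun k => y k ω) θ k t ^ 2 +
          2 * e k ω t * rlsPost μ (fun k => φ k ω) (fun k => y k ω) θ k t) ≤
      ε * ∑ k ∈ Finset.range N, ∑ t, rlsPost μ (fun k => φ k ω) (fun k => y k ω) θ k t ^ 2 +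
        b * (1 + ∑ k ∈ Finset.range N, rlsLeverage μ (fun k => φ k ω) k) := by
  have key : ∀ t, ∀ᵐ ω ∂P, ∀ ε > 0, ∃ b, ∀ N,
      rlsEnergy μ (fun k => φ k ω) (fun k => y k ω) θ N t +
        ∑ k ∈ Finset.range N, (rlsPost μ (fun k => φ k ω) (fun k => y k ω) θ k t ^ 2 +
          2 * e k ω t * rlsPost μ (fun k => φ k ω) (fun k => y k ω) θ k t) ≤
      ε * ∑ k ∈ Finset.range N, rlsPost μ (fun k => φ k ω) (fun k => y k ω) θ k t ^ 2 +
        b * (1 + ∑ k ∈ Finset.range N, rlsLeverage μ (fun k => φ k ω) k) := by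
    intro t
    set s : ℕ → Ω → ℝ := fun k ω => rlsPost μ (fun k => φ k ω) (fun k => y k ω) θ k t with hs
    set c : ℕ → Ω → ℝ := fun k ω => rlsLeverage μ (fun k => φ k ω) k with hc
    have hc0 : ∀ k ω, 0 ≤ c k ω := fun k ω => rlsLeverage_nonneg hμ _ k
    have hc1 : ∀ k ω, c k ω ≤ 1 := fun k ω => rlsLeverage_le_one hμ _ k
    -- The a posteriori error contains the current noise with coefficient `-c`; adding `c w` back
    -- leaves its predictable part.
    set f : ℕ → Ω → ℝ := fun k ω => s k ω + c k ω * w k ω t with hf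
    have hfm : ∀ k, K ≤ k → Measurable[F k] (f k) := fun k hk => by
      have e1 : f k = fun ω => gain (rlsCov μ (fun k => φ k ω) k) (φ k ω) *
          (φ k ω ⬝ᵥ rlsErr μ (fun k => φ k ω) (fun k => y k ω) θ k t) - c k ω * e k ω t := by
        funext ω
        simp only [hf, hs, hc]
        rw [rlsPost_eq (hμ := hμ), hye k ω t]
        ring
      rw [e1]
      exact ((measurable_gain (measurable_rlsCov μ hφ k) (hφ k)).mul
        (measurable_dotProduct (hφ k) fun i =>
          (measurable_rlsEst μ hφ hy k i t).const_sub _)).sub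
        ((measurable_rlsLeverage μ hφ k).mul (he k hk t))
    filter_upwards [(hw t).ae_exists_sum_mul_sq_le c (measurable_rlsLeverage μ hφ) hc0 hc1,
      (hw t).ae_forall_exists_abs_sum_mul_le f K hfm] with ω hω1 hω2 ε hε
    obtain ⟨b2, hb2⟩ := hω1
    -- The cross term enters twice and `f² ≤ 2 s² + 2 c w²`, so `ε / 4` becomes `ε` in front of `∑
    -- s²`.
    obtain ⟨b1, hb1⟩ := hω2 (ε / 4) (by positivity)
    have hb10 : 0 ≤ b1 := by simpa using hb1 0
    set V := fun N => rlsEnergy μ (fun k => φ k ω) (fun k => y k ω) θ N t with hV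
    have hV0 : 0 ≤ V 0 := dotProduct_rlsInfo_mulVec_nonneg hμ _ _ _
    refine ⟨V 0 + 2 * b1 + (2 + ε) * b2, fun N => ?_⟩
    have hdet : V N + ∑ k ∈ Finset.range N, (s k ω ^ 2 + 2 * e k ω t * s k ω) ≤
        V 0 - 2 * ∑ k ∈ Finset.range N, w k ω t * s k ω := by
      induction N with
      | zero => simp
      | succ N ih =>
        rw [Finset.sum_range_succ, Finset.sum_range_succ]
        have := rlsEnergy_succ_le hμ (fun k => φ k ω) (fun k => y k ω) θ N t
        rw [hye N ω t] at this
        simp only [hV, hs] at ih this ⊢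
        linarith
    have hsplit : ∑ k ∈ Finset.range N, w k ω t * s k ω =
        ∑ k ∈ Finset.range N, f k ω * w k ω t - ∑ k ∈ Finset.range N, c k ω * w k ω t ^ 2 := by
      rw [← Finset.sum_sub_distrib]
      refine Finset.sum_congr rfl fun k _ => ?_
      simp only [hf]; ring
    have hfsq : ∑ k ∈ Finset.range N, f k ω ^ 2 ≤ 2 * ∑ k ∈ Finset.range N, s k ω ^ 2 +
        2 * ∑ k ∈ Finset.range N, c k ω * w k ω t ^ 2 := by
      rw [Finset.mul_sum, Finset.mul_sum, ← Finset.sum_add_distrib]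
      refine Finset.sum_le_sum fun k _ => ?_
      have h1 : c k ω ^ 2 * w k ω t ^ 2 ≤ c k ω * w k ω t ^ 2 :=
        mul_le_mul_of_nonneg_right (by nlinarith [hc0 k ω, hc1 k ω]) (sq_nonneg _)
      simp only [hf]
      nlinarith [sq_nonneg (s k ω - c k ω * w k ω t)]
    have h1 := (abs_le.1 (hb1 N)).1
    have h2 := hb2 N
    have hC : 0 ≤ ∑ k ∈ Finset.range N, c k ω := Finset.sum_nonneg fun k _ => hc0 k ω
    have h3 := mul_le_mul_of_nonneg_left hfsq hε.le
    have h4 := mul_le_mul_of_nonneg_left h2 hε.le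
    have h5 : 0 ≤ (V 0 + 2 * b1) * ∑ k ∈ Finset.range N, c k ω := by positivity
    change V N + ∑ k ∈ Finset.range N, (s k ω ^ 2 + 2 * e k ω t * s k ω) ≤
      ε * ∑ k ∈ Finset.range N, s k ω ^ 2 + _ * (1 + ∑ k ∈ Finset.range N, c k ω)
    nlinarith
  filter_upwards [ae_all_iff.2 key] with ω hω ε hε
  choose b hb using fun t => hω t ε hε
  refine ⟨∑ t, b t, fun N => ?_⟩
  have h := Finset.sum_le_sum fun t (_ : t ∈ Finset.univ) => hb t N
  rw [Finset.sum_add_distrib, Finset.sum_add_distrib, ← Finset.mul_sum, ← Finset.sum_mul] at h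
  rw [Finset.sum_comm (s := Finset.range N), Finset.sum_comm (s := Finset.range N)]
  exact h

end ARMAX
end

/-! ### Extreme eigenvalues and Parseval on the unit circle. -/

noncomputable section

namespace ARMAX

section Spectral

open scoped ComplexOrder

variable {𝕜 m : Type*} [RCLike 𝕜] [Fintype m] [DecidableEq m] {H : Matrix m m 𝕜}

theorem bddAbove_spectrum (hH : H.IsHermitian) : BddAbove (spectrum ℝ H) := by
  rw [hH.spectrum_real_eq_range_eigenvalues]; exact (Set.finite_range _).bddAbove

theorem bddBelow_spectrum (hH : H.IsHermitian) : BddBelow (spectrum ℝ H) := by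
  rw [hH.spectrum_real_eq_range_eigenvalues]; exact (Set.finite_range _).bddBelow

/-- The spectrum of `λ_max I - H` is the spectrum of `H` reflected, so it lies in `[0, ∞)`. This
turns the supremum in `lamMax` into a quadratic form bound. -/
theorem posSemidef_lamMax_smul_sub (hH : H.IsHermitian) :
    ((algebraMap ℝ (Matrix m m 𝕜) (lamMax H)) - H).PosSemidef := by
  have h1 : ((algebraMap ℝ (Matrix m m 𝕜) (lamMax H)) - H).IsHermitian := by
    refine Matrix.IsHermitian.sub ?_ hH
    rw [Algebra.algebraMap_eq_smul_one]
    exact Matrix.isHermitian_one.smul (IsSelfAdjoint.all _)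
  rw [h1.posSemidef_iff_eigenvalues_nonneg]
  intro i
  have h2 : h1.eigenvalues i ∈ spectrum ℝ ((algebraMap ℝ (Matrix m m 𝕜) (lamMax H)) - H) := by
    rw [h1.spectrum_real_eq_range_eigenvalues]; exact ⟨i, rfl⟩
  rw [← spectrum.singleton_sub_eq, Set.singleton_sub] at h2
  obtain ⟨a, ha, h⟩ := h2
  have := le_csSup (bddAbove_spectrum hH) ha
  simp only [Pi.zero_apply]
  rw [← h]
  exact sub_nonneg.2 this

theorem posSemidef_sub_lamMin_smul (hH : H.IsHermitian) :
    (H - (algebraMap ℝ (Matrix m m 𝕜) (lamMin H))).PosSemidef := by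
  have h1 : (H - (algebraMap ℝ (Matrix m m 𝕜) (lamMin H))).IsHermitian := by
    refine Matrix.IsHermitian.sub hH ?_
    rw [Algebra.algebraMap_eq_smul_one]
    exact Matrix.isHermitian_one.smul (IsSelfAdjoint.all _)
  rw [h1.posSemidef_iff_eigenvalues_nonneg]
  intro i
  have h2 : h1.eigenvalues i ∈ spectrum ℝ (H - (algebraMap ℝ (Matrix m m 𝕜) (lamMin H))) := by
    rw [h1.spectrum_real_eq_range_eigenvalues]; exact ⟨i, rfl⟩
  rw [← spectrum.sub_singleton_eq, Set.sub_singleton] at h2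
  obtain ⟨a, ha, h⟩ := h2
  have := csInf_le (bddBelow_spectrum hH) ha
  simp only [Pi.zero_apply]
  rw [← h]
  exact sub_nonneg.2 this

theorem trace_le_card_mul_lamMax {Q : Matrix m m ℝ} (hQ : Q.IsHermitian) :
    Q.trace ≤ Fintype.card m * lamMax Q := by
  have := (posSemidef_lamMax_smul_sub hQ).trace_nonneg
  rw [Matrix.trace_sub, Algebra.algebraMap_eq_smul_one, Matrix.trace_smul, Matrix.trace_one,
    smul_eq_mul] at this
  linarith

theorem lamMin_mul_le {Q : Matrix m m ℝ} (hQ : Q.IsHermitian) (x : m → ℝ) :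
    lamMin Q * ∑ i, x i ^ 2 ≤ x ⬝ᵥ (Q *ᵥ x) := by
  have := (posSemidef_sub_lamMin_smul hQ).dotProduct_mulVec_nonneg x
  rw [Matrix.sub_mulVec, dotProduct_sub, Algebra.algebraMap_eq_smul_one, Matrix.smul_mulVec,
    Matrix.one_mulVec, dotProduct_smul, star_trivial, smul_eq_mul] at this
  simp only [dotProduct, ← sq] at this ⊢
  simpa using this

theorem lamMin_le_lamMax [Nonempty m] (hH : H.IsHermitian) : lamMin H ≤ lamMax H := by
  have : hH.eigenvalues (Classical.arbitrary m) ∈ spectrum ℝ H := by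
    rw [hH.spectrum_real_eq_range_eigenvalues]; exact ⟨_, rfl⟩
  exact (csInf_le (bddBelow_spectrum hH) this).trans (le_csSup (bddAbove_spectrum hH) this)

/-- `‖A v‖² ≤ λ_max (A Aᴴ) ‖v‖²`. -/
theorem sum_norm_sq_mulVec_le (A : Matrix m m ℂ) (v : m → ℂ) :
    ∑ i, ‖(A *ᵥ v) i‖ ^ 2 ≤ lamMax (A * Aᴴ) * ∑ i, ‖v i‖ ^ 2 := by
  have hpsd : (A * Aᴴ).PosSemidef := Matrix.posSemidef_self_mul_conjTranspose A
  set L := lamMax (A * Aᴴ) with hL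
  have hsq : ∀ x : m → ℂ, star x ⬝ᵥ x = ((∑ i, ‖x i‖ ^ 2 : ℝ) : ℂ) := fun x => by
    simp only [dotProduct, Pi.star_apply, RCLike.star_def, Complex.conj_mul']
    push_cast; rfl
  have h1 : ∀ x : m → ℂ, ∑ i, ‖(Aᴴ *ᵥ x) i‖ ^ 2 ≤ L * ∑ i, ‖x i‖ ^ 2 := fun x => by
    have h := (posSemidef_lamMax_smul_sub hpsd.isHermitian).dotProduct_mulVec_nonneg x
    rw [Matrix.sub_mulVec, dotProduct_sub, Algebra.algebraMap_eq_smul_one, Matrix.smul_mulVec,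
      Matrix.one_mulVec, dotProduct_smul, hsq, ← Matrix.mulVec_mulVec, Matrix.dotProduct_mulVec,
      show star x ᵥ* A = star (Aᴴ *ᵥ x) by rw [Matrix.star_mulVec, Matrix.conjTranspose_conjTranspose],
      hsq, Complex.real_smul, ← Complex.ofReal_mul, ← Complex.ofReal_sub] at h
    have := Complex.zero_le_real.1 h
    linarith
  set u := A *ᵥ v with hu
  set U := ∑ i, ‖u i‖ ^ 2 with hU
  set V := ∑ i, ‖v i‖ ^ 2 with hV
  have hU0 : 0 ≤ U := Finset.sum_nonneg fun _ _ => sq_nonneg _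
  have hV0 : 0 ≤ V := Finset.sum_nonneg fun _ _ => sq_nonneg _
  -- `λ_max (A Aᴴ)` directly bounds `Aᴴ`. Writing `‖A v‖² = ⟨Aᴴ A v, v⟩`, Cauchy–Schwarz transfers
  -- the bound to `A`.
  have h2 : (U : ℂ) = star (Aᴴ *ᵥ u) ⬝ᵥ v := by
    have e : star (Aᴴ *ᵥ u) = star u ᵥ* A := by
      rw [Matrix.star_mulVec, Matrix.conjTranspose_conjTranspose]
    rw [hU, ← hsq, e, ← Matrix.dotProduct_mulVec]
  have h3 : U ≤ ∑ i, ‖(Aᴴ *ᵥ u) i‖ * ‖v i‖ := by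
    have : U = ‖(U : ℂ)‖ := by rw [Complex.norm_real, Real.norm_of_nonneg hU0]
    rw [this, h2]
    refine (norm_sum_le _ _).trans (le_of_eq (Finset.sum_congr rfl fun i _ => ?_))
    rw [norm_mul, Pi.star_apply, norm_star]
  have h4 : U ^ 2 ≤ (∑ i, ‖(Aᴴ *ᵥ u) i‖ ^ 2) * V :=
    (pow_le_pow_left₀ hU0 h3 2).trans (Finset.sum_mul_sq_le_sq_mul_sq _ _ _)
  have h5 := h4.trans (mul_le_mul_of_nonneg_right (h1 u) hV0)
  rcases hU0.eq_or_lt with h | h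
  · rw [← h]
    exact (Finset.sum_nonneg fun _ _ => sq_nonneg _).trans (h1 v)
  · have : U * U ≤ U * (L * V) := by nlinarith
    exact le_of_mul_le_mul_left this h

end Spectral

/-- If the matrix polynomial with entries `h s t` contracts by `γ` on the unit circle, then
multiplication by it contracts the `ℓ²` norm of coefficients. -/
theorem sum_norm_sq_coeff_le {m : Type*} [Fintype m] (h : m → m → Polynomial ℂ)
    (p : m → Polynomial ℂ) {γ : ℝ}
    (H : ∀ z : ℂ, ‖z‖ = 1 → ∀ v : m → ℂ,
      ∑ s, ‖∑ t, (h s t).eval z * v t‖ ^ 2 ≤ γ * ∑ t, ‖v t‖ ^ 2) :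
    ∑ s, ∑ i ∈ (∑ t, h s t * p t).support, ‖(∑ t, h s t * p t).coeff i‖ ^ 2 ≤
      γ * ∑ t, ∑ i ∈ (p t).support, ‖(p t).coeff i‖ ^ 2 := by
  -- Parseval: coefficient sums become circle averages, where the hypothesis holds pointwise.
  simp_rw [Polynomial.sum_sq_norm_coeff_eq_circleAverage]
  have hint : ∀ q : Polynomial ℂ, CircleIntegrable (fun z => ‖q.eval z‖ ^ 2) 0 1 := fun q =>
    ContinuousOn.circleIntegrable' (by fun_prop)
  rw [← Real.circleAverage_fun_sum fun s _ => hint _,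
    ← Real.circleAverage_fun_sum fun s _ => hint _, ← smul_eq_mul,
    ← Real.circleAverage_fun_smul]
  refine Real.circleAverage_mono (CircleIntegrable.fun_sum _ fun s _ => hint _)
    ((CircleIntegrable.fun_sum _ fun s _ => hint _).const_smul) fun z hz => ?_
  have hz1 : ‖z‖ = 1 := by simpa using hz
  have := H z hz1 fun t => (p t).eval z
  simpa [Polynomial.eval_finsetSum] using this

theorem sum_norm_sq_coeff_le_of_finset {m : Type*} [Fintype m] (h : m → m → Polynomial ℂ)
    (p : m → Polynomial ℂ) {γ : ℝ}
    (H : ∀ z : ℂ, ‖z‖ = 1 → ∀ v : m → ℂ,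
      ∑ s, ‖∑ t, (h s t).eval z * v t‖ ^ 2 ≤ γ * ∑ t, ‖v t‖ ^ 2) (T S : Finset ℕ)
    (hS : ∀ t, (p t).support ⊆ S) :
    ∑ s, ∑ i ∈ T, ‖(∑ t, h s t * p t).coeff i‖ ^ 2 ≤
      γ * ∑ t, ∑ i ∈ S, ‖(p t).coeff i‖ ^ 2 := by
  refine (Finset.sum_le_sum fun s _ => ?_).trans ((sum_norm_sq_coeff_le h p H).trans (le_of_eq ?_))
  · set q := ∑ t, h s t * p t
    rw [← Finset.sum_subset (Finset.inter_subset_left (s₁ := T) (s₂ := q.support))]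
    · exact Finset.sum_le_sum_of_subset_of_nonneg Finset.inter_subset_right
        fun _ _ _ => sq_nonneg _
    · intro i hi hi'
      have : i ∉ q.support := fun h => hi' (Finset.mem_inter.2 ⟨hi, h⟩)
      rw [Polynomial.notMem_support_iff.1 this]; simp
  · congr 1
    refine Finset.sum_congr rfl fun t _ => Finset.sum_subset (hS t) fun i _ hi => ?_
    rw [Polynomial.notMem_support_iff.1 hi]; simp

end ARMAX
end

/-! ### Convolution inequalities and bounds for the noise polynomial. -/

noncomputable section

namespace ARMAX

theorem frobenius_norm_sq {m n α : Type*} [Fintype m] [Fintype n] [SeminormedAddCommGroup α]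
    (A : Matrix m n α) : ‖A‖ ^ 2 = ∑ i, ∑ j, ‖A i j‖ ^ 2 := by
  have h0 : 0 ≤ ∑ i, ∑ j, ‖A i j‖ ^ (2 : ℝ) :=
    Finset.sum_nonneg fun _ _ => Finset.sum_nonneg fun _ _ => Real.rpow_nonneg (norm_nonneg _) _
  rw [Matrix.frobenius_norm_def, ← Real.rpow_natCast, ← Real.rpow_mul h0]
  norm_num

theorem frobenius_norm_map_ofReal {m n : Type*} [Fintype m] [Fintype n] (A : Matrix m n ℝ) :
    ‖A.map ((↑) : ℝ → ℂ)‖ = ‖A‖ := by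
  simp [Matrix.frobenius_norm_def]

theorem sum_norm_sq_mulVec_le_frobenius {m : Type*} [Fintype m] (A : Matrix m m ℂ) (v : m → ℂ) :
    ∑ i, ‖(A *ᵥ v) i‖ ^ 2 ≤ ‖A‖ ^ 2 * ∑ i, ‖v i‖ ^ 2 := by
  rw [frobenius_norm_sq, Finset.sum_mul]
  refine Finset.sum_le_sum fun i _ => ?_
  refine le_trans (pow_le_pow_left₀ (norm_nonneg _) ?_ 2)
    (Finset.sum_mul_sq_le_sq_mul_sq Finset.univ (fun j => ‖A i j‖) fun j => ‖v j‖)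
  refine (norm_sum_le _ _).trans (le_of_eq (Finset.sum_congr rfl fun j _ => norm_mul _ _))

/-- Time-domain form of a contraction bound on the unit circle. -/
theorem sum_sq_conv_le {n : ℕ} (H : ℕ → Matrix (Fin n) (Fin n) ℝ) (J : ℕ) {γ : ℝ}
    (hH : ∀ z : ℂ, ‖z‖ = 1 → ∀ v : Fin n → ℂ,
      ∑ s, ‖((∑ m ∈ Finset.range J, z ^ (m + 1) • (H m).map ((↑) : ℝ → ℂ)) *ᵥ v) s‖ ^ 2 ≤
        γ * ∑ t, ‖v t‖ ^ 2) (x : ℕ → Fin n → ℝ) (N : ℕ) :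
    ∑ k ∈ Finset.Ico J N, ∑ s, (∑ m ∈ Finset.range J, (H m *ᵥ x (k - (m + 1))) s) ^ 2 ≤
      γ * ∑ k ∈ Finset.range N, ∑ t, x k t ^ 2 := by
  -- Generating polynomials of the kernel and of the signal cut off at `N`; their product generates
  -- the convolution.
  set h : Fin n → Fin n → Polynomial ℂ := fun s t =>
    ∑ m ∈ Finset.range J, Polynomial.C (H m s t : ℂ) * Polynomial.X ^ (m + 1) with hh
  set p : Fin n → Polynomial ℂ := fun t =>
    ∑ i ∈ Finset.range N, Polynomial.monomial i (x i t : ℂ) with hp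
  have hpc : ∀ t i, (p t).coeff i = if i < N then (x i t : ℂ) else 0 := fun t i => by
    simp only [hp, Polynomial.finsetSum_coeff, Polynomial.coeff_monomial]
    rw [Finset.sum_ite_eq']
    simp
  have key := sum_norm_sq_coeff_le_of_finset h p (γ := γ) (fun z hz v => by
    refine le_trans (le_of_eq ?_) (hH z hz v)
    refine Finset.sum_congr rfl fun s _ => ?_
    congr 2
    simp only [Matrix.mulVec, dotProduct]
    refine Finset.sum_congr rfl fun t _ => ?_
    congr 1
    simp only [hh, Polynomial.eval_finsetSum, Matrix.sum_apply, Matrix.smul_apply,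
      Matrix.map_apply, smul_eq_mul, Polynomial.eval_mul, Polynomial.eval_C, Polynomial.eval_pow,
      Polynomial.eval_X]
    exact Finset.sum_congr rfl fun m _ => mul_comm _ _)
    (Finset.Ico J N) (Finset.range N) (fun t i hi => by
      rw [Polynomial.mem_support_iff, hpc] at hi
      by_contra hc
      exact hi (if_neg (by simpa using hc)))
  rw [Finset.sum_comm]
  refine le_trans (le_of_eq ?_) (key.trans (le_of_eq ?_))
  · refine Finset.sum_congr rfl fun s _ => Finset.sum_congr rfl fun k hk => ?_
    obtain ⟨hk1, hk2⟩ := Finset.mem_Ico.1 hk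
    have e : (∑ t, h s t * p t).coeff k =
        ((∑ m ∈ Finset.range J, (H m *ᵥ x (k - (m + 1))) s : ℝ) : ℂ) := by
      simp only [Polynomial.finsetSum_coeff, hh, Finset.sum_mul, mul_assoc,
        Polynomial.coeff_C_mul, Polynomial.coeff_X_pow_mul', hpc]
      rw [Finset.sum_comm]
      push_cast
      refine Finset.sum_congr rfl fun m hm => ?_
      have hm := Finset.mem_range.1 hm
      simp only [Matrix.mulVec, dotProduct]
      push_cast
      refine Finset.sum_congr rfl fun t _ => ?_
      -- For `J ≤ k < N` the subtraction `k - (m + 1)` is not truncated and stays below the cut-off.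
      rw [if_pos (by omega), if_pos (by omega)]
    rw [e, Complex.norm_real, Real.norm_eq_abs, sq_abs]
  · rw [Finset.sum_comm]
    congr 1
    refine Finset.sum_congr rfl fun k hk => Finset.sum_congr rfl fun t _ => ?_
    rw [hpc, if_pos (Finset.mem_range.1 hk), Complex.norm_real, Real.norm_eq_abs, sq_abs]

section Convolution

variable {n l : ℕ}

/-- The coefficients of the product of the matrix polynomials `∑_{i ≤ k} D_i z^i` and
`∑_{j ≤ p} a_j z^j`. -/
def convCoeff (k p : ℕ) (D : ℕ → Matrix (Fin n) (Fin n) ℝ) (a : ℕ → Matrix (Fin n) (Fin l) ℝ)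
    (m : ℕ) : Matrix (Fin n) (Fin l) ℝ :=
  ∑ i ∈ Finset.range (k + 1), ∑ j ∈ Finset.range (p + 1), if i + j = m then D i * a j else 0

theorem convCoeff_zero (k p : ℕ) (D : ℕ → Matrix (Fin n) (Fin n) ℝ)
    (a : ℕ → Matrix (Fin n) (Fin l) ℝ) : convCoeff k p D a 0 = D 0 * a 0 := by
  rw [convCoeff, Finset.sum_eq_single 0, Finset.sum_eq_single 0]
  · simp
  · intro j _ hj; simp [hj]
  · simp
  · intro i _ hi
    exact Finset.sum_eq_zero fun j _ => by simp [hi]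
  · simp

theorem sum_convCoeff_mulVec (k p : ℕ) (D : ℕ → Matrix (Fin n) (Fin n) ℝ)
    (a : ℕ → Matrix (Fin n) (Fin l) ℝ) (v : ℕ → Fin l → ℝ) :
    ∑ m ∈ Finset.range (p + k + 1), convCoeff k p D a m *ᵥ v m =
      ∑ i ∈ Finset.range (k + 1), D i *ᵥ ∑ j ∈ Finset.range (p + 1), a j *ᵥ v (i + j) := by
  simp only [convCoeff, Matrix.sum_mulVec, Matrix.mulVec_sum]
  rw [Finset.sum_comm]
  refine Finset.sum_congr rfl fun i hi => ?_
  rw [Finset.sum_comm]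
  refine Finset.sum_congr rfl fun j hj => ?_
  rw [Finset.sum_eq_single (i + j)]
  · simp
  · intro m _ hm
    simp [Ne.symm hm]
  · intro h
    have hi := Finset.mem_range.1 hi
    have hj := Finset.mem_range.1 hj
    exact absurd (Finset.mem_range.2 (by omega)) h

theorem sum_smul_convCoeff (k p : ℕ) (D a : ℕ → Matrix (Fin n) (Fin n) ℝ) (z : ℂ) :
    ∑ m ∈ Finset.range (p + k + 1), z ^ m • (convCoeff k p D a m).map ((↑) : ℝ → ℂ) =
      (∑ i ∈ Finset.range (k + 1), z ^ i • (D i).map ((↑) : ℝ → ℂ)) *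
        ∑ j ∈ Finset.range (p + 1), z ^ j • (a j).map ((↑) : ℝ → ℂ) := by
  have hmap : ∀ M : Matrix (Fin n) (Fin n) ℝ, M.map ((↑) : ℝ → ℂ) =
      (Complex.ofRealHom.mapMatrix : Matrix (Fin n) (Fin n) ℝ →+* _) M := fun _ => rfl
  simp only [hmap]
  rw [Finset.sum_mul_sum]
  simp only [convCoeff, map_sum, Finset.smul_sum]
  rw [Finset.sum_comm]
  refine Finset.sum_congr rfl fun i hi => ?_
  rw [Finset.sum_comm]
  refine Finset.sum_congr rfl fun j hj => ?_
  rw [Finset.sum_eq_single (i + j)]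
  · rw [if_pos rfl, map_mul, smul_mul_smul_comm, pow_add]
  · intro m _ hm
    simp [Ne.symm hm]
  · intro h
    have hi := Finset.mem_range.1 hi
    have hj := Finset.mem_range.1 hj
    exact absurd (Finset.mem_range.2 (by omega)) h

/-- The coefficient sequence `a, C_0, C_1, …, C_{r-1}, 0, 0, …`. -/
def consCoeff {r : ℕ} (a : Matrix (Fin n) (Fin l) ℝ) (C : Fin r → Matrix (Fin n) (Fin l) ℝ) :
    ℕ → Matrix (Fin n) (Fin l) ℝ
  | 0 => a
  | j + 1 => if h : j < r then C ⟨j, h⟩ else 0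

theorem sum_consCoeff_mulVec {r : ℕ} (a : Matrix (Fin n) (Fin l) ℝ)
    (C : Fin r → Matrix (Fin n) (Fin l) ℝ) (v : ℕ → Fin l → ℝ) :
    ∑ j ∈ Finset.range (r + 1), consCoeff a C j *ᵥ v j =
      a *ᵥ v 0 + ∑ ν : Fin r, C ν *ᵥ v (ν + 1) := by
  rw [Finset.sum_range_succ', add_comm, Finset.sum_range]
  simp [consCoeff]

theorem sum_smul_consCoeff {r : ℕ} (C : Fin r → Matrix (Fin n) (Fin n) ℝ) (z : ℂ) :
    ∑ j ∈ Finset.range (r + 1), z ^ j • (consCoeff 1 C j).map ((↑) : ℝ → ℂ) = noisePoly C z := by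
  rw [Finset.sum_range_succ', add_comm, Finset.sum_range, noisePoly]
  simp [consCoeff]

end Convolution

section NoisePolynomial

variable {n r : ℕ} (C : Fin r → Matrix (Fin n) (Fin n) ℝ)

/-- On the circle `z⁻¹` is the conjugate of `z` and the coefficients are real; thus `C(z) Cᵀ(z⁻¹)`
is positive semidefinite there. -/
theorem noisePoly_inv_transpose {z : ℂ} (hz : ‖z‖ = 1) : (noisePoly C z⁻¹)ᵀ = (noisePoly C z)ᴴ := by
  have hz' : z⁻¹ = star z := by
    rw [Complex.inv_def, Complex.normSq_eq_norm_sq, hz]; simp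
  rw [hz']
  ext i j
  simp [noisePoly, Matrix.sum_apply, Matrix.one_apply, eq_comm]

theorem norm_noisePoly_le {z : ℂ} (hz : ‖z‖ = 1) :
    ‖noisePoly C z‖ ≤ ‖(1 : Matrix (Fin n) (Fin n) ℂ)‖ + ∑ ν, ‖C ν‖ := by
  refine (norm_add_le _ _).trans (add_le_add le_rfl ((norm_sum_le _ _).trans ?_))
  refine Finset.sum_le_sum fun ν _ => (norm_smul_le _ _).trans ?_
  rw [norm_pow, hz, one_pow, one_mul, frobenius_norm_map_ofReal]

/-- Serves to show that the supremum in `noisePolySupNorm` is over a bounded set. The factor `‖1‖`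
appears because the Frobenius norm of the identity is not `1` in general. -/
theorem lamMax_le_norm_mul {m : Type*} [Fintype m] [DecidableEq m] (H : Matrix m m ℂ) :
    lamMax H ≤ ‖H‖ * ‖(1 : Matrix m m ℂ)‖ := by
  have : CompleteSpace (Matrix m m ℂ) := FiniteDimensional.complete ℂ _
  refine Real.sSup_le (fun x hx => ?_) (by positivity)
  exact (le_abs_self x).trans (spectrum.norm_le_norm_mul_of_mem hx)

theorem sum_norm_sq_noisePoly_mulVec_le {z : ℂ} (hz : ‖z‖ = 1) (v : Fin n → ℂ) :
    ∑ i, ‖(noisePoly C z *ᵥ v) i‖ ^ 2 ≤ noisePolySupNorm C ^ 2 * ∑ i, ‖v i‖ ^ 2 := by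
  set f : ℂ → ℝ := fun z => lamMax (noisePoly C z * (noisePoly C z⁻¹)ᵀ) with hf
  have hbdd : BddAbove (f '' {z | ‖z‖ = 1}) := by
    refine ⟨(‖(1 : Matrix (Fin n) (Fin n) ℂ)‖ + ∑ ν, ‖C ν‖) ^ 2 *
      ‖(1 : Matrix (Fin n) (Fin n) ℂ)‖, ?_⟩
    rintro _ ⟨z, hz, rfl⟩
    refine (lamMax_le_norm_mul _).trans (mul_le_mul_of_nonneg_right ?_ (norm_nonneg _))
    rw [noisePoly_inv_transpose C hz, sq]
    refine (Matrix.frobenius_norm_mul _ _).trans ?_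
    rw [Matrix.frobenius_norm_conjTranspose]
    exact mul_self_le_mul_self (norm_nonneg _) (norm_noisePoly_le C hz)
  have h1 : f z ≤ sSup (f '' {z | ‖z‖ = 1}) := le_csSup hbdd ⟨z, hz, rfl⟩
  have h2 : f z ≤ noisePolySupNorm C ^ 2 := by
    -- The square root of a negative number is `0`, so the sign of the supremum has to be
    -- distinguished.
    rcases le_total 0 (sSup (f '' {z | ‖z‖ = 1})) with h | h
    · rw [noisePolySupNorm, Real.sq_sqrt h]; exact h1
    · exact (h1.trans h).trans (sq_nonneg _)
  have h3 := sum_norm_sq_mulVec_le (noisePoly C z) v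
  rw [← noisePoly_inv_transpose C hz] at h3
  exact h3.trans (mul_le_mul_of_nonneg_right h2 (Finset.sum_nonneg fun _ _ => sq_nonneg _))

end NoisePolynomial

end ARMAX
end

/-! ### The truncated inverse of the noise polynomial and its contraction. -/

noncomputable section

namespace ARMAX

section NoisePolynomial

variable {n r : ℕ} {C : Fin r → Matrix (Fin n) (Fin n) ℝ} {K ρ : ℝ}

/-- The order condition exponentiated; `log ρ < 0` reverses the inequality. The factor `K ρ ^ (k +
1) / (1 - ρ)` is the geometric bound for the tail of `C⁻¹` after degree `k`. -/
theorem sq_supNorm_mul_lt_one (hK : 0 < K) (hρ : 0 < ρ) (hρ1 : ρ < 1) {k : ℕ}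
    (hk : Real.log ((noisePolySupNorm C)⁻¹ * K⁻¹ * (1 - ρ)) / Real.log ρ - 1 < k) :
    (K * ρ ^ (k + 1) / (1 - ρ)) ^ 2 * noisePolySupNorm C ^ 2 < 1 := by
  have hM0 : 0 ≤ noisePolySupNorm C := Real.sqrt_nonneg _
  have h1ρ : 0 < 1 - ρ := by linarith
  rcases hM0.eq_or_lt with h | hM
  · rw [← h]; norm_num
  have hlog : Real.log ρ < 0 := Real.log_neg hρ hρ1
  have hpos : 0 < (noisePolySupNorm C)⁻¹ * K⁻¹ * (1 - ρ) := by positivity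
  have h1 : Real.log ((noisePolySupNorm C)⁻¹ * K⁻¹ * (1 - ρ)) / Real.log ρ < k + 1 := by linarith
  rw [div_lt_iff_of_neg hlog] at h1
  have h2 : Real.log (ρ ^ (k + 1)) < Real.log ((noisePolySupNorm C)⁻¹ * K⁻¹ * (1 - ρ)) := by
    rw [Real.log_pow]; push_cast; exact h1
  have h3 := (Real.log_lt_log_iff (by positivity) hpos).1 h2
  rw [← mul_pow]
  refine pow_lt_one₀ (by positivity) ?_ two_ne_zero
  calc K * ρ ^ (k + 1) / (1 - ρ) * noisePolySupNorm C
      < K * ((noisePolySupNorm C)⁻¹ * K⁻¹ * (1 - ρ)) / (1 - ρ) * noisePolySupNorm C := by gcongr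
    _ = 1 := by field_simp

/-- The polynomial `(∑_{i ≤ k} D_i z^i) C(z)`, where `C(z)⁻¹ = ∑ D_i z^i`, has constant
coefficient `I` and differs from `I` by a strict contraction on the unit circle. -/
theorem exists_truncated_inverse (hC : ∀ z : ℂ, ‖z‖ ≤ 1 → (noisePoly C z).det ≠ 0)
    (hKρ : IsInverseDecay C K ρ) {k : ℕ}
    (hk : Real.log ((noisePolySupNorm C)⁻¹ * K⁻¹ * (1 - ρ)) / Real.log ρ - 1 < k) :
    ∃ D : ℕ → Matrix (Fin n) (Fin n) ℝ, D 0 = 1 ∧ ∃ γ < 1, ∀ z : ℂ, ‖z‖ = 1 → ∀ v : Fin n → ℂ,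
      ∑ s, ‖((∑ m ∈ Finset.range (r + k), z ^ (m + 1) •
        (convCoeff k r D (consCoeff 1 C) (m + 1)).map ((↑) : ℝ → ℂ)) *ᵥ v) s‖ ^ 2 ≤
        γ * ∑ t, ‖v t‖ ^ 2 := by
  obtain ⟨hK, hρ, hρ1, D, hD, hDle⟩ := hKρ
  -- Evaluate the expansion at `z = 0`, where `C(0) = I`.
  have hD0 : D 0 = 1 := by
    have h1 := hD 0 (by simp)
    have h2 : HasSum (fun i => (0 : ℂ) ^ i • (D i).map ((↑) : ℝ → ℂ))
        ((D 0).map ((↑) : ℝ → ℂ)) := by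
      have := hasSum_single (f := fun i => (0 : ℂ) ^ i • (D i).map ((↑) : ℝ → ℂ)) 0
        (fun i hi => by simp [hi])
      simpa using this
    have h3 : (noisePoly C 0)⁻¹ = 1 := by simp [noisePoly]
    rw [h3] at h1
    have h4 := h2.unique h1
    ext i j
    have := congrFun (congrFun h4 i) j
    simp only [Matrix.map_apply, Matrix.one_apply] at this ⊢
    split_ifs at this ⊢ <;> exact_mod_cast this
  refine ⟨D, hD0, _, sq_supNorm_mul_lt_one hK hρ hρ1 hk, fun z hz v => ?_⟩
  set E : ℕ → Matrix (Fin n) (Fin n) ℂ := fun i => z ^ i • (D i).map ((↑) : ℝ → ℂ)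
  have hsum := hD z hz.le
  have hEle : ∀ i, ‖E i‖ ≤ K * ρ ^ i := fun i => by
    refine (norm_smul_le _ _).trans ?_
    rw [norm_pow, hz, one_pow, one_mul, frobenius_norm_map_ofReal]
    exact hDle i
  set T := ∑' i, E (i + (k + 1)) with hT
  have hFT : ∑ i ∈ Finset.range (k + 1), E i + T = (noisePoly C z)⁻¹ := by
    have := hsum.summable.sum_add_tsum_nat_add (k + 1)
    rw [hsum.tsum_eq] at this
    exact this
  have hTle : ‖T‖ ≤ K * ρ ^ (k + 1) / (1 - ρ) := by
    have hg : HasSum (fun i => K * ρ ^ (k + 1) * ρ ^ i) (K * ρ ^ (k + 1) * (1 - ρ)⁻¹) :=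
      (hasSum_geometric_of_lt_one hρ.le hρ1).mul_left _
    rw [div_eq_mul_inv]
    refine tsum_of_norm_bounded hg fun i => (hEle _).trans (le_of_eq ?_)
    ring
  -- The truncation is `C⁻¹ - T`, and `(C⁻¹ - T) C = I - T C`; cancel the constant coefficient `I`.
  have hG : ∑ m ∈ Finset.range (r + k), z ^ (m + 1) •
      (convCoeff k r D (consCoeff 1 C) (m + 1)).map ((↑) : ℝ → ℂ) = -(T * noisePoly C z) := by
    have h1 := sum_smul_convCoeff k r D (consCoeff 1 C) z
    rw [sum_smul_consCoeff, Finset.sum_range_succ', convCoeff_zero, hD0] at h1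
    have h2 : ∑ i ∈ Finset.range (k + 1), z ^ i • (D i).map ((↑) : ℝ → ℂ) =
        (noisePoly C z)⁻¹ - T := by rw [← hFT]; simp only [E, add_sub_cancel_right]
    rw [h2, sub_mul, Matrix.nonsing_inv_mul _ (isUnit_iff_ne_zero.2 (hC z hz.le))] at h1
    have h3 : z ^ 0 • ((1 : Matrix (Fin n) (Fin n) ℝ) * consCoeff 1 C 0).map ((↑) : ℝ → ℂ) = 1 := by
      rw [consCoeff]; simp
    rw [h3] at h1
    exact (add_right_cancel (h1.trans (by rw [sub_eq_add_neg, add_comm])))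
  rw [hG, Matrix.neg_mulVec, ← Matrix.mulVec_mulVec]
  simp only [Pi.neg_apply, norm_neg]
  refine (sum_norm_sq_mulVec_le_frobenius T _).trans ?_
  rw [mul_assoc]
  refine mul_le_mul (pow_le_pow_left₀ (norm_nonneg _) hTle 2)
    (sum_norm_sq_noisePoly_mulVec_le C hz v) (Finset.sum_nonneg fun _ _ => sq_nonneg _)
    (sq_nonneg _)

end NoisePolynomial

/-! ### Pathwise consequences of the energy inequality -/

/-- If the model errors `e` are dominated by a fraction of the residual errors `s + e`, then the
latter are controlled by the leverages. -/
theorem exists_sum_le_of_energy {V X E S c : ℕ → ℝ} {C₀ γ : ℝ} (hγ1 : γ < 1)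
    (hV : ∀ N, 0 ≤ V N) (hX : ∀ N, 0 ≤ X N) (hc : ∀ N, 0 ≤ c N)
    (hS : ∀ N, S N ≤ 2 * X N + 2 * E N) (hEX : ∀ N, E N ≤ C₀ + γ * X N)
    (h : ∀ ε > 0, ∃ b, ∀ N, V N + (X N - E N) ≤ ε * S N + b * (1 + c N)) :
    ∃ b, ∀ N, X N ≤ b * (1 + c N) := by
  have hg : 0 < 1 - γ := by linarith
  -- The left side keeps `(1 - γ) X`. With `S ≤ 2 X + 2 E` this choice costs at most half of it, up
  -- to constants.
  obtain ⟨b, hb⟩ := h ((1 - γ) / 8) (by positivity)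
  have hEX' : ∀ N, E N ≤ |C₀| + γ * X N := fun N => (hEX N).trans (by gcongr; exact le_abs_self _)
  refine ⟨2 / (1 - γ) * (|C₀| + (1 - γ) / 4 * |C₀| + b), fun N => ?_⟩
  have h1 := hb N
  have h2 := mul_le_mul_of_nonneg_left (hS N) (show 0 ≤ (1 - γ) / 8 by positivity)
  have h3 := mul_le_mul_of_nonneg_left (hEX' N) (show 0 ≤ (1 - γ) / 8 by positivity)
  have h4 : (1 - γ) / 8 * (γ * X N) ≤ (1 - γ) / 8 * X N := by
    have := mul_le_mul_of_nonneg_right hγ1.le (hX N)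
    rw [one_mul] at this
    gcongr
  have h5 : (1 - γ) / 2 * X N ≤ |C₀| + (1 - γ) / 4 * |C₀| + b * (1 + c N) := by
    have := hEX' N
    have := hV N
    linarith
  have h6 : 0 ≤ (|C₀| + (1 - γ) / 4 * |C₀|) * c N := by
    have := hc N
    positivity
  have h7 : (1 - γ) / 2 * X N ≤ (|C₀| + (1 - γ) / 4 * |C₀| + b) * (1 + c N) := by nlinarith
  calc X N = 2 / (1 - γ) * ((1 - γ) / 2 * X N) := by field_simp
    _ ≤ 2 / (1 - γ) * ((|C₀| + (1 - γ) / 4 * |C₀| + b) * (1 + c N)) := by gcongr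
    _ = _ := by ring

end ARMAX
end

/-! ### From the system and the algorithm to least squares regressions. -/

noncomputable section

namespace ARMAX

variable {n l p q r p' q' r' : ℕ}

/-! ### The model in regression form -/

theorem regressor_dotProduct_paramMatrix (A : Fin p → Matrix (Fin n) (Fin n) ℝ)
    (B : Fin q → Matrix (Fin n) (Fin l) ℝ) (C : Fin r → Matrix (Fin n) (Fin n) ℝ)
    (y : ℤ → Fin n → ℝ) (u : ℤ → Fin l → ℝ) (e : ℤ → Fin n → ℝ) (k : ℤ) (t : Fin n) :
    (regressor p q r y u e k ⬝ᵥ fun i => paramMatrix A B C i t) =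
      -(∑ i, A i *ᵥ y (k - (i : ℕ))) t + (∑ j, B j *ᵥ u (k - (j : ℕ))) t +
        (∑ ν, C ν *ᵥ e (k - (ν : ℕ))) t := by
  simp only [dotProduct, Fintype.sum_sum_type, Fintype.sum_prod_type, regressor, paramMatrix,
    Matrix.of_apply, Finset.sum_apply, Matrix.mulVec]
  simp only [mul_comm, mul_neg, Finset.sum_neg_distrib, add_assoc]

/-- The sequence `e` put in place of the noise is arbitrary; only the mismatch `e - w`, filtered by
the coefficients of `C`, survives. -/
theorem model_error_eq {A : Fin p → Matrix (Fin n) (Fin n) ℝ}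
    {B : Fin q → Matrix (Fin n) (Fin l) ℝ} {C : Fin r → Matrix (Fin n) (Fin n) ℝ}
    {y : ℤ → Fin n → ℝ} {u : ℤ → Fin l → ℝ} {w : ℤ → Fin n → ℝ} {k : ℤ}
    (h : y (k + 1) + ∑ i, A i *ᵥ y (k - (i : ℕ)) =
      ∑ j, B j *ᵥ u (k - (j : ℕ)) + (w (k + 1) + ∑ ν, C ν *ᵥ w (k - (ν : ℕ))))
    (e : ℤ → Fin n → ℝ) (t : Fin n) :
    y (k + 1) t - (regressor p q r y u e k ⬝ᵥ fun i => paramMatrix A B C i t) - w (k + 1) t =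
      -∑ ν, (C ν *ᵥ (e (k - (ν : ℕ)) - w (k - (ν : ℕ)))) t := by
  rw [regressor_dotProduct_paramMatrix]
  have ht := congrFun h t
  simp only [Pi.add_apply, Finset.sum_apply] at ht ⊢
  simp only [Matrix.mulVec_sub, Pi.sub_apply, Finset.sum_sub_distrib]
  linarith

/-- Multiplication of the system by `∑_{i ≤ κ} D_i z^i`. -/
theorem IsSystemPath.mul_left {A : Fin p → Matrix (Fin n) (Fin n) ℝ}
    {B : Fin q → Matrix (Fin n) (Fin l) ℝ} {C : Fin r → Matrix (Fin n) (Fin n) ℝ}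
    {y : ℤ → Fin n → ℝ} {u : ℤ → Fin l → ℝ} {w : ℤ → Fin n → ℝ} (h : IsSystemPath A B C y u w)
    {D : ℕ → Matrix (Fin n) (Fin n) ℝ} (hD : D 0 = 1) (κ : ℕ) (k : ℤ) (hk : κ ≤ k) :
    y (k + 1) + ∑ i : Fin (p + κ), convCoeff κ p D (consCoeff 1 A) (i + 1) *ᵥ y (k - (i : ℕ)) =
      ∑ j : Fin (q + κ), convCoeff κ q D (consCoeff 0 B) (j + 1) *ᵥ u (k - (j : ℕ)) +
        (w (k + 1) +
          ∑ ν : Fin (r + κ), convCoeff κ r D (consCoeff 1 C) (ν + 1) *ᵥ w (k - (ν : ℕ))) := by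
  -- One identity serves all three polynomials. The leading coefficient `a` is `1` for `A` and `C`,
  -- and `0` for `B`, which has no term in `u (k + 1)`.
  have expand : ∀ {m s : ℕ} (a : Matrix (Fin n) (Fin m) ℝ) (G : Fin s → Matrix (Fin n) (Fin m) ℝ)
      (v : ℤ → Fin m → ℝ), a *ᵥ v (k + 1) +
        ∑ i : Fin (s + κ), convCoeff κ s D (consCoeff a G) (i + 1) *ᵥ v (k - (i : ℕ)) =
      ∑ i ∈ Finset.range (κ + 1), D i *ᵥ (a *ᵥ v (k - i + 1) +
        ∑ ν, G ν *ᵥ v (k - i - (ν : ℕ))) := by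
    intro m s a G v
    have h1 := sum_convCoeff_mulVec κ s D (consCoeff a G) fun j => v (k + 1 - j)
    rw [Finset.sum_range_succ', add_comm, convCoeff_zero, hD, Matrix.one_mul, Finset.sum_range] at h1
    have e0 : consCoeff a G 0 = a := rfl
    rw [e0] at h1
    have e1 : ∀ i : ℕ, k + 1 - ((i + 1 : ℕ) : ℤ) = k - i := fun i => by push_cast; ring
    simp only [e1, Nat.cast_zero, sub_zero] at h1
    rw [h1]
    refine Finset.sum_congr rfl fun i _ => ?_
    rw [sum_consCoeff_mulVec a G fun j => v (k + 1 - ((i + j : ℕ) : ℤ))]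
    have e2 : k + 1 - ((i + 0 : ℕ) : ℤ) = k - i + 1 := by push_cast; ring
    have e3 : ∀ ν : ℕ, k + 1 - ((i + (ν + 1) : ℕ) : ℤ) = k - i - ν := fun ν => by
      push_cast; ring
    simp only [e2, e3]
  have hA := expand 1 A y
  have hB := expand 0 B u
  have hC := expand 1 C w
  simp only [Matrix.one_mulVec, Matrix.zero_mulVec, zero_add] at hA hB hC
  rw [hA, hB, hC, ← Finset.sum_add_distrib]
  refine Finset.sum_congr rfl fun i hi => ?_
  rw [← Matrix.mulVec_add, h.dynamics (k - i) (by have := Finset.mem_range.1 hi; omega)]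

/-! ### The algorithm as recursive least squares -/

section Algorithm

variable (μ : ℝ) (lam : ℕ → ℝ) (y : ℤ → Fin n → ℝ) (u : ℤ → Fin l → ℝ)

/-- Each update writes only at the new time, so an estimate never changes once made. -/
theorem noiseState_what_of_le {M : ℕ} {j : ℤ} (h : j ≤ M) :
    (noiseState p' q' r' μ y u M).what j = noiseEst p' q' r' μ y u j := by
  obtain ⟨d, rfl⟩ := Nat.exists_eq_add_of_le (show j.toNat ≤ M by omega)
  clear h
  induction d with
  | zero => rfl
  | succ d ih =>
    rw [← ih, ← add_assoc, noiseState]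
    exact Function.update_of_ne (by push_cast; omega) _ _

theorem noiseEst_of_nonpos {j : ℤ} (h : j ≤ 0) : noiseEst p' q' r' μ y u j = 0 := by
  rw [noiseEst, Int.toNat_of_nonpos h]; rfl

theorem regressor_noiseState (N : ℕ) :
    regressor p' q' r' y u (noiseState p' q' r' μ y u N).what N =
      phi p' q' r' p' q' r' μ y u N := by
  funext s
  rcases s with ⟨i, a⟩ | ⟨j, b⟩ | ⟨ν, c⟩
  · rfl
  · rfl
  · simp only [regressor, phi]
    rw [noiseState_what_of_le μ y u (by omega)]

theorem noiseState_eq (N : ℕ) :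
    (noiseState p' q' r' μ y u N).Pbar = rlsCov μ (phi p' q' r' p' q' r' μ y u) N ∧
      (noiseState p' q' r' μ y u N).α =
        rlsEst μ (phi p' q' r' p' q' r' μ y u) (fun k : ℕ => y (k + 1)) N := by
  induction N with
  | zero => exact ⟨rfl, rfl⟩
  | succ N ih =>
    constructor
    · simp only [noiseState, rlsCov]
      rw [ih.1, regressor_noiseState]
    · simp only [noiseState, rlsEst]
      rw [ih.1, ih.2, regressor_noiseState]

theorem noiseEst_succ (N : ℕ) (t : Fin n) :
    noiseEst p' q' r' μ y u (N + 1) t = y (N + 1) t - phi p' q' r' p' q' r' μ y u N ⬝ᵥ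
      fun i => rlsEst μ (phi p' q' r' p' q' r' μ y u) (fun k : ℕ => y (k + 1)) (N + 1) i t := by
  have h1 : noiseEst p' q' r' μ y u ((N : ℤ) + 1) =
      (noiseState p' q' r' μ y u (N + 1)).what ((N + 1 : ℕ) : ℤ) := by
    rw [noiseState_what_of_le μ y u le_rfl]; push_cast; rfl
  have h2 := (noiseState_eq (p' := p') (q' := q') (r' := r') μ y u (N + 1)).2
  rw [h1, ← h2]
  simp only [noiseState]
  rw [regressor_noiseState]
  push_cast
  rw [Function.update_self, Pi.sub_apply, Matrix.mulVec, dotProduct_comm]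
  rfl

theorem paramState_P (N : ℕ) :
    (paramState p q r p' q' r' μ lam y u N).P = rlsCov μ (phi p q r p' q' r' μ y u) N := by
  induction N with
  | zero => rfl
  | succ N ih => simp only [paramState, rlsCov, ih]

/-- The corrections telescope: `(I - a P_N φ φᵀ) P_N = P_{N+1}`, so a step of the algorithm carries
`P_N Ξ_{N-1}` to `P_{N+1} Ξ_{N-1}`, and the added `P_{N+1} (Ξ_N - Ξ_{N-1})` replaces it by `P_{N+1}
Ξ_N`. -/
theorem paramState_Θ (N : ℕ) :
    (paramState p q r p' q' r' μ lam y u N).Θ =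
      rlsEst μ (phi p q r p' q' r' μ y u) (fun k : ℕ => y (k + 1)) N +
        μ • (rlsCov μ (phi p q r p' q' r' μ y u) N *
          (paramState p q r p' q' r' μ lam y u N).Ξprev) := by
  induction N with
  | zero => simp [paramState, rlsEst]
  | succ N ih =>
    simp only [paramState, rlsEst, rlsCov]
    rw [paramState_P, ih]
    set S := paramState p q r p' q' r' μ lam y u N
    set Q := rlsCov μ (phi p q r p' q' r' μ y u) N
    set φ := phi p q r p' q' r' μ y u N
    set X := rlsEst μ (phi p q r p' q' r' μ y u) (fun k : ℕ => y (k + 1)) N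
    have h1 : lsStep Q φ (X + μ • (Q * S.Ξprev)) (y (N + 1)) =
        lsStep Q φ X (y (N + 1)) + μ • (covStep Q φ * S.Ξprev) := by
      have e : φ ᵥ* (Q * S.Ξprev) = (Q * S.Ξprev)ᵀ *ᵥ φ := (Matrix.mulVec_transpose _ _).symm
      rw [lsStep, lsStep, covStep_eq, Matrix.sub_mul, Matrix.smul_mul, Matrix.vecMulVec_mul,
        Matrix.vecMul_vecMul, e, Matrix.mul_vecMulVec, Matrix.mul_vecMulVec, Matrix.transpose_add,
        Matrix.add_mulVec, Matrix.transpose_smul, Matrix.smul_mulVec]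
      ext i t
      simp only [Matrix.add_apply, Matrix.smul_apply, Matrix.sub_apply, Matrix.vecMulVec_apply,
        Pi.sub_apply, Pi.add_apply, Pi.smul_apply, smul_eq_mul]
      ring
    rw [h1, Matrix.mul_sub, smul_sub]
    abel

/-- Soft thresholding only shrinks: the subtracted threshold is nonnegative, also when its
denominator vanishes. -/
theorem abs_paramState_Ξ_le (hμ : 0 < μ) (hlam : ∀ N, 0 < lam N) (N : ℕ)
    (s : RegIdx n l p q r) (t : Fin n) :
    |(paramState p q r p' q' r' μ lam y u N).Ξ s t| ≤
      |(paramState p q r p' q' r' μ lam y u N).Θ s t| := by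
  have hs : ∀ x : ℝ, |sgn x| = 1 := fun x => by unfold sgn; split_ifs <;> simp
  rcases N with _ | N
  · simp [paramState]
  simp only [paramState, Matrix.of_apply]
  rw [abs_mul, hs, one_mul, abs_of_nonneg (le_max_right _ _)]
  refine max_le ?_ (abs_nonneg _)
  rw [sub_le_self_iff]
  have := hlam N
  positivity

theorem thetaEst_succ (N : ℕ) :
    thetaEst p q r p' q' r' μ lam y u (N + 1) =
      rlsEst μ (phi p q r p' q' r' μ y u) (fun k : ℕ => y (k + 1)) (N + 1) +
        μ • (rlsCov μ (phi p q r p' q' r' μ y u) (N + 1) *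
          (paramState p q r p' q' r' μ lam y u N).Ξ) := by
  rw [thetaEst, paramState_Θ]; rfl

variable {y u}

theorem phi_zero (hy : ∀ j ≤ 0, y j = 0) (hu : ∀ j ≤ 0, u j = 0) :
    phi p q r p' q' r' μ y u 0 = 0 := by
  funext s
  rcases s with ⟨i, a⟩ | ⟨j, b⟩ | ⟨ν, c⟩
  · simp only [phi, regressor]; rw [hy _ (by simp)]; rfl
  · simp only [phi, regressor]; rw [hu _ (by simp)]; rfl
  · simp only [phi, regressor]; rw [noiseEst_of_nonpos _ _ _ (by simp)]; rfl

/-- One side sums over `1, …, N`, the other over `0, …, N`; they agree because `φ_0 = 0`. -/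
theorem infoMatrix_eq (hy : ∀ j ≤ 0, y j = 0) (hu : ∀ j ≤ 0, u j = 0) (N : ℕ) :
    infoMatrix p q r p' q' r' μ y u N = rlsInfo μ (phi p q r p' q' r' μ y u) (N + 1) := by
  rw [infoMatrix, rlsInfo, Finset.range_eq_Ico, Finset.sum_eq_sum_Ico_succ_bot (by omega),
    phi_zero μ hy hu]
  simp only [Matrix.vecMulVec_zero, zero_add]
  rfl

end Algorithm

/-! ### Sums of lagged terms -/

/-- A lag brings in zeros at negative times and drops nonnegative terms at the end. -/
theorem sum_lag_le {g : ℤ → ℝ} (hg : ∀ j, 0 ≤ g j) (hg0 : ∀ j < 0, g j = 0) (i N : ℕ) :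
    ∑ k ∈ Finset.range N, g (k - i) ≤ ∑ k ∈ Finset.range N, g k := by
  induction i generalizing N with
  | zero => simp
  | succ i ih =>
    rcases N with _ | N
    · simp
    rw [Finset.sum_range_succ']
    have e : ∀ k : ℕ, ((k + 1 : ℕ) : ℤ) - ((i + 1 : ℕ) : ℤ) = k - i := fun k => by
      push_cast; ring
    simp only [e]
    rw [hg0 _ (by push_cast; omega), add_zero]
    refine (ih N).trans ?_
    rw [Finset.sum_range_succ]
    linarith [hg N]

theorem sum_sum_lag_le {g : ℤ → ℝ} (hg : ∀ j, 0 ≤ g j) (hg0 : ∀ j < 0, g j = 0) (p N : ℕ) :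
    ∑ k ∈ Finset.range N, ∑ i : Fin p, g (k - (i : ℕ)) ≤ p * ∑ k ∈ Finset.range N, g k := by
  rw [Finset.sum_comm]
  refine (Finset.sum_le_sum fun (i : Fin p) _ => sum_lag_le hg hg0 (i : ℕ) N).trans (le_of_eq ?_)
  simp

theorem sum_regressor_sq (y : ℤ → Fin n → ℝ) (u : ℤ → Fin l → ℝ) (e : ℤ → Fin n → ℝ) (k : ℤ) :
    ∑ s, regressor p q r y u e k s ^ 2 = ∑ i : Fin p, ∑ a, y (k - (i : ℕ)) a ^ 2 +
      ∑ j : Fin q, ∑ b, u (k - (j : ℕ)) b ^ 2 + ∑ ν : Fin r, ∑ c, e (k - (ν : ℕ)) c ^ 2 := by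
  simp only [Fintype.sum_sum_type, Fintype.sum_prod_type, regressor, add_assoc]

/-- Adding lags to the regressor changes the total energy by a bounded factor. -/
theorem sum_regressor_sq_le {y : ℤ → Fin n → ℝ} {u : ℤ → Fin l → ℝ} {e : ℤ → Fin n → ℝ}
    (hy : ∀ j ≤ 0, y j = 0) (hu : ∀ j ≤ 0, u j = 0) (he : ∀ j ≤ 0, e j = 0) (hp : 0 < p)
    (hq : 0 < q) (hr : 0 < r) (N : ℕ) :
    ∑ k ∈ Finset.range N, ∑ s, regressor p' q' r' y u e k s ^ 2 ≤
      (p' + q' + r') * ∑ k ∈ Finset.range N, ∑ s, regressor p q r y u e k s ^ 2 := by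
  have nn : ∀ {m : ℕ} (x : Fin m → ℝ), 0 ≤ ∑ a, x a ^ 2 := fun x =>
    Finset.sum_nonneg fun _ _ => sq_nonneg _
  have hub : ∀ {m : ℕ} {v : ℤ → Fin m → ℝ} (hv : ∀ j ≤ 0, v j = 0) (s : ℕ),
      ∑ k ∈ Finset.range N, ∑ i : Fin s, ∑ a, v (k - (i : ℕ)) a ^ 2 ≤
        s * ∑ k ∈ Finset.range N, ∑ a, v k a ^ 2 := fun {m v} hv s =>
    sum_sum_lag_le (g := fun j => ∑ a, v j a ^ 2) (fun j => nn _)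
      (fun j hj => by simp [hv j hj.le]) s N
  have hlb : ∀ {m : ℕ} (v : ℤ → Fin m → ℝ) {s : ℕ} (hs : 0 < s),
      ∑ k ∈ Finset.range N, ∑ a, v k a ^ 2 ≤
        ∑ k ∈ Finset.range N, ∑ i : Fin s, ∑ a, v (k - (i : ℕ)) a ^ 2 := fun {m} v {s} hs =>
    Finset.sum_le_sum fun k _ => by
      have := Finset.single_le_sum (f := fun i : Fin s => ∑ a, v (k - (i : ℕ)) a ^ 2)
        (fun i _ => nn _) (Finset.mem_univ ⟨0, hs⟩)
      simpa using this
  simp only [sum_regressor_sq, Finset.sum_add_distrib]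
  have a1 := hub hy p'
  have a2 := hub hu q'
  have a3 := hub he r'
  have b1 := hlb y hp
  have b2 := hlb u hq
  have b3 := hlb e hr
  have c1 : 0 ≤ ∑ k ∈ Finset.range N, ∑ a, y k a ^ 2 := Finset.sum_nonneg fun _ _ => nn _
  have c2 : 0 ≤ ∑ k ∈ Finset.range N, ∑ a, u k a ^ 2 := Finset.sum_nonneg fun _ _ => nn _
  have c3 : 0 ≤ ∑ k ∈ Finset.range N, ∑ a, e k a ^ 2 := Finset.sum_nonneg fun _ _ => nn _
  have d1 : (0 : ℝ) ≤ p' := Nat.cast_nonneg _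
  have d2 : (0 : ℝ) ≤ q' := Nat.cast_nonneg _
  have d3 : (0 : ℝ) ≤ r' := Nat.cast_nonneg _
  set Y := ∑ k ∈ Finset.range N, ∑ a, y k a ^ 2
  set U := ∑ k ∈ Finset.range N, ∑ a, u k a ^ 2
  set E := ∑ k ∈ Finset.range N, ∑ a, e k a ^ 2
  calc _ ≤ p' * Y + q' * U + r' * E := add_le_add (add_le_add a1 a2) a3
    _ ≤ (p' + q' + r') * (Y + U + E) := by
      have := mul_nonneg d1 c2; have := mul_nonneg d1 c3; have := mul_nonneg d2 c1
      have := mul_nonneg d2 c3; have := mul_nonneg d3 c1; have := mul_nonneg d3 c2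
      nlinarith
    _ ≤ _ := mul_le_mul_of_nonneg_left (add_le_add (add_le_add b1 b2) b3) (by positivity)

end ARMAX
end

/-! ### The filtration and the energy inequality for the system. -/

noncomputable section

namespace ARMAX

variable {Ω : Type*} {m0 : MeasurableSpace Ω} {P : Measure Ω} {n l p q r p' q' r' : ℕ}
  {y : ℤ → Ω → Fin n → ℝ} {u : ℤ → Ω → Fin l → ℝ} {w : ℤ → Ω → Fin n → ℝ}

/-- The σ-algebras `𝓕_k` as a filtration. -/
def sigmaFiltration (hy : ∀ j, Measurable (y j)) (hu : ∀ j, Measurable (u j))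
    (hw : ∀ j, Measurable (w j)) : Filtration ℕ m0 where
  seq := sigmaAlg y u w
  mono' i j hij := by
    have hij' : (i : ℤ) ≤ j := by exact_mod_cast hij
    refine sup_le_sup (sup_le_sup ?_ ?_) ?_
    · exact biSup_mono fun k hk => ⟨hk.1, hk.2.trans hij'⟩
    · exact biSup_mono fun k hk => ⟨hk.1, hk.2.trans_le hij'⟩
    · exact biSup_mono fun k hk => ⟨hk.1, hk.2.trans hij'⟩
  le' k := sup_le (sup_le (iSup₂_le fun j _ => (hy j).comap_le)
    (iSup₂_le fun j _ => (hu j).comap_le)) (iSup₂_le fun j _ => (hw j).comap_le)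

theorem measurable_output {k : ℕ} {j : ℤ} (h0 : 0 ≤ j) (hj : j ≤ k) :
    Measurable[sigmaAlg y u w k] (y j) := by
  refine Measurable.of_comap_le (le_trans ?_ (le_sup_of_le_left le_sup_left))
  exact le_iSup₂ (f := fun j (_ : j ∈ Set.Icc (0 : ℤ) k) =>
    MeasurableSpace.comap (y j) inferInstance) j ⟨h0, hj⟩

theorem measurable_noise {k : ℕ} {j : ℤ} (h0 : 1 ≤ j) (hj : j ≤ k) :
    Measurable[sigmaAlg y u w k] (w j) := by
  refine Measurable.of_comap_le (le_trans ?_ le_sup_right)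
  exact le_iSup₂ (f := fun j (_ : j ∈ Set.Icc (1 : ℤ) k) =>
    MeasurableSpace.comap (w j) inferInstance) j ⟨h0, hj⟩

/-- The index is shifted: noise number `k` is `w (k + 1)`. The dominating variables are the
conditional moments of the Euclidean norm, which bounds each coordinate. -/
theorem isMomentNoise_of_isMartingaleDifferenceNoise [IsProbabilityMeasure P]
    (hy : ∀ j, Measurable (y j)) (hu : ∀ j, Measurable (u j)) (hw : ∀ j, Measurable (w j))
    (h : IsMartingaleDifferenceNoise P (sigmaAlg y u w) w) (t : Fin n) :
    IsMomentNoise P (sigmaFiltration hy hu hw) fun k ω => w (k + 1) ω t where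
  measurable k := (measurable_pi_apply t).comp (measurable_noise (y := y) (u := u) (k := k + 1)
    (j := (k : ℤ) + 1) (by omega) (by push_cast; rfl))
  integrable k hk := by
    have := h.integrable (k + 1) (by omega)
    push_cast at this
    exact this.eval t
  condExp_eq_zero k hk := by
    have hint := h.integrable (k + 1) (by omega)
    push_cast at hint
    have h1 := (ContinuousLinearMap.proj (R := ℝ) (φ := fun _ : Fin n => ℝ) t).comp_condExp_comm
      hint (m := sigmaAlg y u w k)
    filter_upwards [h1, h.condExp_eq_zero k hk] with ω h1 h2
    refine h1.symm.trans ?_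
    rw [Function.comp_apply, h2]; simp
  moment := by
    obtain ⟨β, hβ, hm⟩ := h.moment
    refine ⟨β, hβ, _, fun k => measurable_condLExp _ _ _, fun k hk A hA => ?_, hm⟩
    rw [setLIntegral_condLExp ((sigmaFiltration hy hu hw).le k) _ _ hA]
    refine lintegral_mono fun ω => ENNReal.ofReal_le_ofReal ?_
    refine Real.rpow_le_rpow (abs_nonneg _) ?_ (by linarith)
    have := PiLp.norm_apply_le (WithLp.toLp 2 (w (k + 1 : ℕ) ω)) t
    push_cast at this ⊢
    exact this

section Measurability

variable {F : Filtration ℕ m0}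

/-- Lagged values of a process that vanishes at nonpositive times are known. -/
theorem measurable_lag {d : ℕ} {g : ℤ → Ω → Fin d → ℝ} (hg0 : ∀ j ≤ 0, ∀ ω, g j ω = 0)
    (hg : ∀ k : ℕ, 1 ≤ k → ∀ a, Measurable[F k] fun ω => g k ω a) (k i : ℕ) (a : Fin d) :
    Measurable[F k] fun ω => g ((k : ℤ) - i) ω a := by
  rcases Nat.lt_or_ge i k with h | h
  · have e : (k : ℤ) - i = ((k - i : ℕ) : ℤ) := by omega
    rw [e]
    exact (hg (k - i) (by omega) a).mono (F.mono (Nat.sub_le k i)) le_rfl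
  · have e : (fun ω => g ((k : ℤ) - i) ω a) = fun _ => 0 := by
      funext ω; rw [hg0 _ (by omega)]; rfl
    rw [e]
    exact @measurable_const _ _ _ (F k) (0 : ℝ)

theorem measurable_regressor {e : ℤ → Ω → Fin n → ℝ} (hy0 : ∀ j ≤ 0, ∀ ω, y j ω = 0)
    (hu0 : ∀ j ≤ 0, ∀ ω, u j ω = 0) (he0 : ∀ j ≤ 0, ∀ ω, e j ω = 0)
    (hy : ∀ k : ℕ, 1 ≤ k → ∀ a, Measurable[F k] fun ω => y k ω a)
    (hu : ∀ k : ℕ, 1 ≤ k → ∀ a, Measurable[F k] fun ω => u k ω a)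
    (he : ∀ k : ℕ, 1 ≤ k → ∀ a, Measurable[F k] fun ω => e k ω a) (k : ℕ)
    (s : RegIdx n l p q r) :
    Measurable[F k] fun ω =>
      regressor p q r (fun j => y j ω) (fun j => u j ω) (fun j => e j ω) k s := by
  rcases s with ⟨i, a⟩ | ⟨j, b⟩ | ⟨ν, c⟩
  · exact measurable_lag hy0 hy k i a
  · exact measurable_lag hu0 hu k j b
  · exact measurable_lag he0 he k ν c

end Measurability

/-- The error `y_k - θᵀ φ_k - w_k` of a regression model. -/
def modelErr {ι κ : Type*} [Fintype ι] (θ : Matrix ι κ ℝ) (φ : ℕ → ι → ℝ) (y w : ℕ → κ → ℝ) (k : ℕ)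
    (t : κ) : ℝ :=
  y k t - (φ k ⬝ᵥ fun i => θ i t) - w k t

/-- The energy inequality for a regression model of the system with the orders `p q r`, where the
noises in the regressor are estimated with the orders `p' q' r'`. -/
theorem ae_rlsEnergy_phi_le [IsProbabilityMeasure P] {F : Filtration ℕ m0} {μ : ℝ} (hμ : 0 < μ)
    {A : Fin p → Matrix (Fin n) (Fin n) ℝ} {B : Fin q → Matrix (Fin n) (Fin l) ℝ}
    {C : Fin r → Matrix (Fin n) (Fin n) ℝ} (hy0 : ∀ j ≤ 0, ∀ ω, y j ω = 0)
    (hu0 : ∀ j ≤ 0, ∀ ω, u j ω = 0)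
    (hy : ∀ k : ℕ, 1 ≤ k → ∀ a, Measurable[F k] fun ω => y k ω a)
    (hu : ∀ k : ℕ, 1 ≤ k → ∀ a, Measurable[F k] fun ω => u k ω a)
    (he : ∀ k : ℕ, 1 ≤ k → ∀ a, Measurable[F k] fun ω =>
      noiseEst p' q' r' μ (fun j => y j ω) (fun j => u j ω) k a)
    (hwm : ∀ k : ℕ, 1 ≤ k → ∀ a, Measurable[F k] fun ω => w k ω a)
    (hw : ∀ t, IsMomentNoise P F fun k ω => w (k + 1) ω t) {K : ℕ} (hK : r ≤ K)
    (hdyn : ∀ ω, ∀ k : ℕ, K ≤ k → y (k + 1) ω + ∑ i, A i *ᵥ y (k - (i : ℕ)) ω =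
      ∑ j, B j *ᵥ u (k - (j : ℕ)) ω + (w (k + 1) ω + ∑ ν, C ν *ᵥ w (k - (ν : ℕ)) ω)) :
    ∀ᵐ ω ∂P, ∀ ε > 0, ∃ b, ∀ N,
      ∑ t, rlsEnergy μ (phi p q r p' q' r' μ (fun j => y j ω) (fun j => u j ω))
          (fun k : ℕ => y (k + 1) ω) (paramMatrix A B C) N t +
        ∑ k ∈ Finset.range N, ∑ t,
          (rlsPost μ (phi p q r p' q' r' μ (fun j => y j ω) (fun j => u j ω))
            (fun k : ℕ => y (k + 1) ω) (paramMatrix A B C) k t ^ 2 +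
          2 * modelErr (paramMatrix A B C)
            (phi p q r p' q' r' μ (fun j => y j ω) (fun j => u j ω))
            (fun k : ℕ => y (k + 1) ω) (fun k : ℕ => w (k + 1) ω) k t *
          rlsPost μ (phi p q r p' q' r' μ (fun j => y j ω) (fun j => u j ω))
            (fun k : ℕ => y (k + 1) ω) (paramMatrix A B C) k t) ≤
      ε * ∑ k ∈ Finset.range N, ∑ t,
          rlsPost μ (phi p q r p' q' r' μ (fun j => y j ω) (fun j => u j ω))
            (fun k : ℕ => y (k + 1) ω) (paramMatrix A B C) k t ^ 2 +
        b * (1 + ∑ k ∈ Finset.range N,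
          rlsLeverage μ (phi p q r p' q' r' μ (fun j => y j ω) (fun j => u j ω)) k) := by
  refine ae_rlsEnergy_add_sum_le (P := P) (F := F) hμ (paramMatrix A B C)
    (φ := fun k ω => phi p q r p' q' r' μ (fun j => y j ω) (fun j => u j ω) k)
    (y := fun k ω => y (k + 1) ω) (w := fun k ω => w (k + 1) ω)
    (fun k s => measurable_regressor hy0 hu0 (fun j hj ω => noiseEst_of_nonpos _ _ _ hj) hy hu he
      k s)
    (fun k t => by have := hy (k + 1) (by omega) t; push_cast at this; exact this) hw
    (fun k ω t => modelErr (paramMatrix A B C)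
      (phi p q r p' q' r' μ (fun j => y j ω) (fun j => u j ω))
      (fun k : ℕ => y (k + 1) ω) (fun k : ℕ => w (k + 1) ω) k t)
    (fun k ω t => by simp only [modelErr]; ring) K (fun k hk t => ?_)
  have e0 : ∀ ω, modelErr (paramMatrix A B C)
      (phi p q r p' q' r' μ (fun j => y j ω) (fun j => u j ω))
      (fun k : ℕ => y (k + 1) ω) (fun k : ℕ => w (k + 1) ω) k t = _ := fun ω =>
    model_error_eq (y := fun j => y j ω) (u := fun j => u j ω) (w := fun j => w j ω)
      (hdyn ω k hk) (noiseEst p' q' r' μ (fun j => y j ω) (fun j => u j ω)) t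
  simp only [e0]
  refine Measurable.neg (Finset.measurable_fun_sum _ fun ν _ => ?_)
  simp only [Matrix.mulVec, dotProduct, Pi.sub_apply]
  refine Finset.measurable_fun_sum _ fun c _ => Measurable.const_mul ?_ _
  -- From `ν < r ≤ K ≤ k` the lagged time is at least `1`, where the noise is adapted.
  have hν := ν.2
  have e1 : (k : ℤ) - ((ν : ℕ) : ℤ) = ((k - ν : ℕ) : ℤ) := by omega
  rw [e1]
  exact ((he _ (by omega) c).mono (F.mono (Nat.sub_le k ν)) le_rfl).sub
    ((hwm _ (by omega) c).mono (F.mono (Nat.sub_le k ν)) le_rfl)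

end ARMAX
end

/-! ### Pathwise bounds for the noise estimates and the leverages. -/

noncomputable section

namespace ARMAX

variable {n l p q r p' q' r' : ℕ}

theorem sum_range_le_add_sum_Ico {f : ℕ → ℝ} (hf : ∀ k, 0 ≤ f k) (K N : ℕ) :
    ∑ k ∈ Finset.range N, f k ≤ ∑ k ∈ Finset.range K, f k + ∑ k ∈ Finset.Ico K N, f k := by
  rcases le_total K N with h | h
  · rw [Finset.sum_range_add_sum_Ico _ h]
  · have h1 := Finset.sum_le_sum_of_subset_of_nonneg (Finset.range_mono h) fun k _ _ => hf k
    have h2 : 0 ≤ ∑ k ∈ Finset.Ico K N, f k := Finset.sum_nonneg fun k _ => hf k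
    linarith

section Path

variable {μ : ℝ} {y : ℤ → Fin n → ℝ} {u : ℤ → Fin l → ℝ} {w : ℤ → Fin n → ℝ}

/-- Since `ŵ` is the a posteriori residual of the long regression, its error is `x = s + e`. This
makes `s² + 2es = x² - e²` available. -/
theorem noiseEst_sub_noise_eq (θ : Matrix (RegIdx n l p' q' r') (Fin n) ℝ) (k : ℕ) (t : Fin n) :
    noiseEst p' q' r' μ y u (k + 1) t - w (k + 1) t =
      rlsPost μ (phi p' q' r' p' q' r' μ y u) (fun k : ℕ => y (k + 1)) θ k t +
        modelErr θ (phi p' q' r' p' q' r' μ y u) (fun k : ℕ => y (k + 1))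
          (fun k : ℕ => w (k + 1)) k t := by
  rw [noiseEst_succ, rlsPost, modelErr]
  have e : rlsErr μ (phi p' q' r' p' q' r' μ y u) (fun k : ℕ => y (k + 1)) θ (k + 1) t =
      (fun i => θ i t) - fun i =>
        rlsEst μ (phi p' q' r' p' q' r' μ y u) (fun k : ℕ => y (k + 1)) (k + 1) i t := rfl
  rw [e, dotProduct_sub]
  ring

/-- The accumulated error of the noise estimates is controlled by the leverages of the long
regressors. -/
theorem exists_sum_noise_error_le (hμ : 0 < μ) {θ : Matrix (RegIdx n l p' q' r') (Fin n) ℝ}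
    {H : ℕ → Matrix (Fin n) (Fin n) ℝ} {γ : ℝ} (hγ : γ < 1)
    (hH : ∀ z : ℂ, ‖z‖ = 1 → ∀ v : Fin n → ℂ,
      ∑ s, ‖((∑ m ∈ Finset.range r', z ^ (m + 1) • (H m).map ((↑) : ℝ → ℂ)) *ᵥ v) s‖ ^ 2 ≤
        γ * ∑ t, ‖v t‖ ^ 2)
    (herr : ∀ k : ℕ, r' ≤ k → ∀ t, modelErr θ (phi p' q' r' p' q' r' μ y u)
      (fun k : ℕ => y (k + 1)) (fun k : ℕ => w (k + 1)) k t =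
        -∑ m : Fin r', (H m *ᵥ (noiseEst p' q' r' μ y u (k - (m : ℕ)) - w (k - (m : ℕ)))) t)
    (h : ∀ ε > 0, ∃ b, ∀ N,
      ∑ t, rlsEnergy μ (phi p' q' r' p' q' r' μ y u) (fun k : ℕ => y (k + 1)) θ N t +
        ∑ k ∈ Finset.range N, ∑ t,
          (rlsPost μ (phi p' q' r' p' q' r' μ y u) (fun k : ℕ => y (k + 1)) θ k t ^ 2 +
          2 * modelErr θ (phi p' q' r' p' q' r' μ y u)
            (fun k : ℕ => y (k + 1)) (fun k : ℕ => w (k + 1)) k t *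
          rlsPost μ (phi p' q' r' p' q' r' μ y u) (fun k : ℕ => y (k + 1)) θ k t) ≤
      ε * ∑ k ∈ Finset.range N, ∑ t,
          rlsPost μ (phi p' q' r' p' q' r' μ y u) (fun k : ℕ => y (k + 1)) θ k t ^ 2 +
        b * (1 + ∑ k ∈ Finset.range N, rlsLeverage μ (phi p' q' r' p' q' r' μ y u) k)) :
    ∃ b, ∀ N, ∑ k ∈ Finset.range N, ∑ t,
        (noiseEst p' q' r' μ y u (k + 1) t - w (k + 1) t) ^ 2 ≤
      b * (1 + ∑ k ∈ Finset.range N, rlsLeverage μ (phi p' q' r' p' q' r' μ y u) k) := by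
  set ψ := phi p' q' r' p' q' r' μ y u
  set s : ℕ → Fin n → ℝ := rlsPost μ ψ (fun k : ℕ => y (k + 1)) θ with hs
  set e : ℕ → Fin n → ℝ := modelErr θ ψ (fun k : ℕ => y (k + 1)) (fun k : ℕ => w (k + 1)) with he
  set x : ℕ → Fin n → ℝ := fun k t => noiseEst p' q' r' μ y u (k + 1) t - w (k + 1) t with hx
  have hxse : ∀ k t, x k t = s k t + e k t := fun k t => noiseEst_sub_noise_eq θ k t
  have nn : ∀ (N : ℕ) (f : ℕ → Fin n → ℝ), 0 ≤ ∑ k ∈ Finset.range N, ∑ t, f k t ^ 2 := fun N f =>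
    Finset.sum_nonneg fun _ _ => Finset.sum_nonneg fun _ _ => sq_nonneg _
  refine exists_sum_le_of_energy (V := fun N => ∑ t, rlsEnergy μ ψ (fun k : ℕ => y (k + 1)) θ N t)
    (X := fun N => ∑ k ∈ Finset.range N, ∑ t, x k t ^ 2)
    (E := fun N => ∑ k ∈ Finset.range N, ∑ t, e k t ^ 2)
    (S := fun N => ∑ k ∈ Finset.range N, ∑ t, s k t ^ 2)
    (c := fun N => ∑ k ∈ Finset.range N, rlsLeverage μ ψ k)
    (C₀ := ∑ k ∈ Finset.range r', ∑ t, e k t ^ 2) hγ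
    (fun N => Finset.sum_nonneg fun t _ => dotProduct_rlsInfo_mulVec_nonneg hμ _ _ _)
    (fun N => nn N x) (fun N => Finset.sum_nonneg fun k _ => rlsLeverage_nonneg hμ _ _)
    (fun N => ?_) (fun N => ?_) (fun ε hε => ?_)
  · simp only [Finset.mul_sum, ← Finset.sum_add_distrib]
    refine Finset.sum_le_sum fun k _ => Finset.sum_le_sum fun t _ => ?_
    rw [hxse]
    nlinarith [sq_nonneg (s k t + 2 * e k t)]
  -- From time `r'` on, `e` is minus the convolution of `H` with `x` and the contraction applies;
  -- earlier errors form the constant `C₀`.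
  · refine (sum_range_le_add_sum_Ico (fun k => Finset.sum_nonneg fun t _ => sq_nonneg _)
      r' N).trans (add_le_add le_rfl ?_)
    refine le_trans (le_of_eq ?_) (sum_sq_conv_le H r' hH x N)
    refine Finset.sum_congr rfl fun k hk => Finset.sum_congr rfl fun t _ => ?_
    have hk := (Finset.mem_Ico.1 hk).1
    rw [herr k hk t, neg_sq, Finset.sum_range]
    congr 1
    refine Finset.sum_congr rfl fun m _ => ?_
    have hm := m.2
    have e1 : (k : ℤ) - ((m : ℕ) : ℤ) = ((k - (m + 1) : ℕ) : ℤ) + 1 := by omega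
    rw [e1]
    rfl
  · obtain ⟨b, hb⟩ := h ε hε
    refine ⟨b, fun N => le_trans (le_of_eq ?_) (hb N)⟩
    rw [← Finset.sum_sub_distrib]
    congr 1
    refine Finset.sum_congr rfl fun k _ => ?_
    rw [← Finset.sum_sub_distrib]
    refine Finset.sum_congr rfl fun t _ => ?_
    rw [hxse]; ring

/-- The model error of the short regression is controlled by the noise errors. -/
theorem exists_sum_modelErr_sq_le {C : Fin r → Matrix (Fin n) (Fin n) ℝ} {e : ℕ → Fin n → ℝ}
    {ξ : ℤ → Fin n → ℝ}
    (herr : ∀ k : ℕ, r ≤ k → ∀ t, e k t = -∑ ν, (C ν *ᵥ ξ (k - (ν : ℕ))) t) :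
    ∃ b, ∀ N, ∑ k ∈ Finset.range N, ∑ t, e k t ^ 2 ≤
      b * (1 + ∑ k ∈ Finset.range N, ∑ t, ξ (k + 1) t ^ 2) := by
  set M := ∑ t, ∑ ν, ∑ c, C ν t c ^ 2 with hM
  set C₀ := ∑ k ∈ Finset.range r, ∑ t, e k t ^ 2 with hC₀
  -- The noise need not vanish at nonpositive times, so the lagged sums use a version set to zero
  -- there.
  set g : ℤ → ℝ := fun j => if 1 ≤ j then ∑ c, ξ j c ^ 2 else 0 with hg
  have nn : ∀ j, 0 ≤ ∑ c, ξ j c ^ 2 := fun j => Finset.sum_nonneg fun _ _ => sq_nonneg _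
  have hg0 : ∀ j, 0 ≤ g j := fun j => by
    simp only [hg]; split_ifs
    · exact nn j
    · exact le_rfl
  have hM0 : 0 ≤ M := Finset.sum_nonneg fun _ _ => Finset.sum_nonneg fun _ _ =>
    Finset.sum_nonneg fun _ _ => sq_nonneg _
  have hC0 : 0 ≤ C₀ := Finset.sum_nonneg fun _ _ => Finset.sum_nonneg fun _ _ => sq_nonneg _
  have hk : ∀ k : ℕ, r ≤ k → ∑ t, e k t ^ 2 ≤ M * ∑ ν : Fin r, g (k - (ν : ℕ)) := fun k hk => by
    rw [hM, Finset.sum_mul]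
    refine Finset.sum_le_sum fun t _ => ?_
    rw [herr k hk t, neg_sq]
    have h1 := Finset.sum_mul_sq_le_sq_mul_sq (Finset.univ : Finset (Fin r × Fin n))
      (fun i => C i.1 t i.2) (fun i => ξ (k - (i.1 : ℕ)) i.2)
    simp only [Fintype.sum_prod_type] at h1
    refine h1.trans (le_of_eq ?_)
    congr 1
    refine Finset.sum_congr rfl fun ν _ => ?_
    have hν := ν.2
    rw [hg]; dsimp only; rw [if_pos (by omega)]
  have hshift : ∀ N : ℕ, ∑ k ∈ Finset.range N, g k ≤
      ∑ k ∈ Finset.range N, ∑ t, ξ (k + 1) t ^ 2 := fun N => by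
    have h1 := sum_lag_le (g := fun j => g (j + 1)) (fun j => hg0 _) (fun j hj => by
      simp only [hg]; rw [if_neg (by omega)]) 1 N
    simp only [Nat.cast_one, sub_add_cancel] at h1
    refine h1.trans (le_of_eq (Finset.sum_congr rfl fun k _ => ?_))
    simp only [hg]; rw [if_pos (by omega)]
  refine ⟨C₀ + M * r, fun N => ?_⟩
  have h1 := sum_range_le_add_sum_Ico (f := fun k => ∑ t, e k t ^ 2)
    (fun k => Finset.sum_nonneg fun t _ => sq_nonneg _) r N
  have h2 : ∑ k ∈ Finset.Ico r N, ∑ t, e k t ^ 2 ≤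
      M * ∑ k ∈ Finset.range N, ∑ ν : Fin r, g (k - (ν : ℕ)) := by
    rw [Finset.mul_sum]
    refine (Finset.sum_le_sum fun k h => hk k (Finset.mem_Ico.1 h).1).trans ?_
    refine Finset.sum_le_sum_of_subset_of_nonneg (fun k h => Finset.mem_range.2
      (Finset.mem_Ico.1 h).2) fun k _ _ => mul_nonneg hM0 (Finset.sum_nonneg fun _ _ => hg0 _)
  have h3 := sum_sum_lag_le hg0 (fun j hj => by simp only [hg]; rw [if_neg (by omega)]) r N
  have h4 : ∑ k ∈ Finset.range N, ∑ ν : Fin r, g (k - (ν : ℕ)) ≤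
      r * ∑ k ∈ Finset.range N, ∑ t, ξ (k + 1) t ^ 2 :=
    h3.trans (mul_le_mul_of_nonneg_left (hshift N) (Nat.cast_nonneg r))
  have h5 := mul_le_mul_of_nonneg_left h4 hM0
  have h6 : 0 ≤ ∑ k ∈ Finset.range N, ∑ t, ξ (k + 1) t ^ 2 := Finset.sum_nonneg fun _ _ => nn _
  have h7 : 0 ≤ M * r := by positivity
  nlinarith [mul_nonneg hC0 h6]

/-- A bound on the leverages by the logarithm of the trace of another information matrix. -/
theorem exists_sum_rlsLeverage_le {ι : Type*} [Fintype ι] [DecidableEq ι] (hμ : 0 < μ)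
    (φ : ℕ → ι → ℝ) {T : ℕ → ℝ} {c : ℝ} (hc : 0 < c)
    (hT : ∀ N, (rlsInfo μ φ N).trace ≤ c * T N) (hT0 : ∀ N, 0 ≤ T N) :
    ∃ b, 0 ≤ b ∧ ∀ N, ∑ k ∈ Finset.range N, rlsLeverage μ φ k ≤
      b * (1 + max (Real.log (T N)) 0) := by
  refine ⟨Fintype.card ι * (1 + |Real.log c| + |Real.log μ|), by positivity, fun N => ?_⟩
  have hd : (0 : ℝ) ≤ Fintype.card ι := Nat.cast_nonneg _
  have hm : 0 ≤ max (Real.log (T N)) 0 := le_max_right _ _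
  have h1 := sum_rlsLeverage_le hμ φ N
  have h2 : Real.log (rlsInfo μ φ N).trace ≤ |Real.log c| + max (Real.log (T N)) 0 ∨
      Fintype.card ι = 0 := by
    rcases Nat.eq_zero_or_pos (Fintype.card ι) with h | h
    · exact Or.inr h
    left
    have htr : 0 < (rlsInfo μ φ N).trace := by
      rw [rlsInfo_trace]
      have : (0 : ℝ) < Fintype.card ι := by exact_mod_cast h
      have : 0 ≤ ∑ k ∈ Finset.range N, ∑ i, φ k i ^ 2 :=
        Finset.sum_nonneg fun _ _ => Finset.sum_nonneg fun _ _ => sq_nonneg _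
      positivity
    have hTN : 0 < T N := by
      rcases (hT0 N).eq_or_lt with h0 | h0
      · have := hT N
        rw [← h0, mul_zero] at this
        linarith
      · exact h0
    refine (Real.log_le_log htr (hT N)).trans ?_
    rw [Real.log_mul hc.ne' hTN.ne']
    exact add_le_add (le_abs_self _) (le_max_left _ _)
  rcases h2 with h2 | h2
  · have h3 := mul_le_mul_of_nonneg_left h2 hd
    have h4 := mul_le_mul_of_nonneg_left (neg_abs_le (Real.log μ)) hd
    have h5 := mul_nonneg hd (mul_nonneg (abs_nonneg (Real.log c)) hm)
    have h6 := mul_nonneg hd (mul_nonneg (abs_nonneg (Real.log μ)) hm)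
    nlinarith
  · simp only [h2, Nat.cast_zero, zero_mul, sub_zero] at h1 ⊢
    exact h1

end Path

end ARMAX
end

/-! ### From the energy bound to the convergence rate. -/

noncomputable section

namespace ARMAX

theorem frobenius_norm_sq_real {ι κ : Type*} [Fintype ι] [Fintype κ] (X : Matrix ι κ ℝ) :
    ‖X‖ ^ 2 = ∑ t, ∑ i, X i t ^ 2 := by
  rw [frobenius_norm_sq, Finset.sum_comm]
  simp

theorem frobenius_norm_le_of_abs_le {ι κ : Type*} [Fintype ι] [Fintype κ] {X Y : Matrix ι κ ℝ}
    (h : ∀ i t, |X i t| ≤ |Y i t|) : ‖X‖ ≤ ‖Y‖ := by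
  refine le_of_sq_le_sq ?_ (norm_nonneg _)
  rw [frobenius_norm_sq_real, frobenius_norm_sq_real]
  exact Finset.sum_le_sum fun t _ => Finset.sum_le_sum fun i _ => sq_le_sq.2 (h i t)

/-- If `Q P = I` with `Q` symmetric, then `λ_min(Q) ‖P Y‖ ≤ ‖Y‖`. -/
theorem lamMin_mul_norm_le {ι κ : Type*} [Fintype ι] [DecidableEq ι] [Fintype κ]
    {Q P : Matrix ι ι ℝ} (hQ : Q.IsHermitian) (hPQ : Q * P = 1) (Y : Matrix ι κ ℝ) :
    lamMin Q * ‖P * Y‖ ≤ ‖Y‖ := by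
  set Z := P * Y with hZ
  have hQZ : Q * Z = Y := by rw [hZ, ← Matrix.mul_assoc, hPQ, Matrix.one_mul]
  -- `⟨Z, Q Z⟩ = ⟨Z, Y⟩`; Cauchy–Schwarz and division by `‖Z‖` then conclude.
  have h1 : lamMin Q * ‖Z‖ ^ 2 ≤ ∑ t, ∑ i, Z i t * Y i t := by
    rw [frobenius_norm_sq_real, Finset.mul_sum]
    refine Finset.sum_le_sum fun t _ => (lamMin_mul_le hQ fun i => Z i t).trans (le_of_eq ?_)
    refine Finset.sum_congr rfl fun i _ => ?_
    congr 1
    rw [← hQZ]; rfl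
  have h2 : (∑ t, ∑ i, Z i t * Y i t) ≤ ‖Z‖ * ‖Y‖ := by
    refine abs_le_of_sq_le_sq' ?_ (by positivity) |>.2
    have := Finset.sum_mul_sq_le_sq_mul_sq (Finset.univ : Finset (κ × ι))
      (fun x => Z x.2 x.1) (fun x => Y x.2 x.1)
    simp only [Fintype.sum_prod_type] at this
    rwa [mul_pow, frobenius_norm_sq_real, frobenius_norm_sq_real]
  rcases (norm_nonneg Z).eq_or_lt with h | h
  · rw [← h, mul_zero]; exact norm_nonneg _
  · have : ‖Z‖ * (lamMin Q * ‖Z‖) ≤ ‖Z‖ * ‖Y‖ := by nlinarith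
    exact le_of_mul_le_mul_left this h

theorem exists_le_of_le_add_half {a : ℕ → ℝ} {c : ℝ} {K : ℕ}
    (h : ∀ N, K ≤ N → a (N + 1) ≤ c + a N / 2) : ∃ b, ∀ N, K ≤ N → a N ≤ b := by
  -- A bound `x ≥ 2 * c` is preserved by `x ↦ c + x / 2`.
  refine ⟨max (a K) (2 * c), fun N hN => ?_⟩
  induction N, hN using Nat.le_induction with
  | base => exact le_max_left _ _
  | succ N hN ih =>
    have := le_max_right (a K) (2 * c)
    linarith [h N hN]

variable {n l p q r p' q' r' : ℕ} {μ : ℝ} {y : ℤ → Fin n → ℝ} {u : ℤ → Fin l → ℝ}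

/-- The convergence rate along a path on which the least squares energy grows at most like the
logarithm of the trace of the information matrix. -/
theorem thetaEst_sub_isBigO {lam : ℕ → ℝ} (hμ : 0 < μ) (hlam : ∀ N, 0 < lam N)
    (hy : ∀ j ≤ 0, y j = 0) (hu : ∀ j ≤ 0, u j = 0)
    (hmin : Tendsto (lmin p q r p' q' r' μ y u) atTop atTop)
    (hratio : Tendsto (ratio p q r p' q' r' μ y u) atTop (𝓝 0))
    (θ : Matrix (RegIdx n l p q r) (Fin n) ℝ)
    (hen : ∃ b, ∀ N, ∑ t, rlsEnergy μ (phi p q r p' q' r' μ y u) (fun k : ℕ => y (k + 1)) θ N t ≤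
      b * (1 + max (Real.log (rlsInfo μ (phi p q r p' q' r' μ y u) N).trace) 0)) :
    (fun N => ‖thetaEst p q r p' q' r' μ lam y u (N + 1) - θ‖) =O[atTop]
      fun N => Real.sqrt (ratio p q r p' q' r' μ y u N) := by
  rcases isEmpty_or_nonempty (RegIdx n l p q r) with hemp | hne
  · have : ∀ X : Matrix (RegIdx n l p q r) (Fin n) ℝ, ‖X‖ = 0 := fun X => by
      rw [Subsingleton.elim X 0, norm_zero]
    simp only [this]
    exact isBigO_zero _ _
  obtain ⟨b₀, hb₀⟩ := hen
  set φ := phi p q r p' q' r' μ y u with hφ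
  set X : ℕ → Matrix (RegIdx n l p q r) (Fin n) ℝ := rlsEst μ φ fun k : ℕ => y (k + 1)
  set Ξ : ℕ → Matrix (RegIdx n l p q r) (Fin n) ℝ := fun N =>
    (paramState p q r p' q' r' μ lam y u N).Ξ
  set Z : ℕ → Matrix (RegIdx n l p q r) (Fin n) ℝ := fun N => rlsCov μ φ (N + 1) * Ξ N
  set a : ℕ → ℝ := fun N => ‖thetaEst p q r p' q' r' μ lam y u N‖
  set L := lmin p q r p' q' r' μ y u
  set R := ratio p q r p' q' r' μ y u
  have hQ : ∀ N, infoMatrix p q r p' q' r' μ y u N = rlsInfo μ φ (N + 1) := infoMatrix_eq μ hy hu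
  have hH : ∀ N, (rlsInfo μ φ N).IsHermitian := fun N => (rlsInfo_posSemidef hμ φ N).isHermitian
  have hL : ∀ N, L N = lamMin (rlsInfo μ φ (N + 1)) := fun N => by rw [← hQ]; rfl
  have hR : ∀ N, R N = Real.log (lamMax (rlsInfo μ φ (N + 1))) / L N := fun N => by
    rw [← hQ]; rfl
  set b := max b₀ 0
  have hb0 : 0 ≤ b := le_max_right _ _
  set d : ℝ := (Fintype.card (RegIdx n l p q r) : ℝ)
  have hd1 : 1 ≤ d := by
    exact Nat.one_le_cast.2 Fintype.card_pos
  have hlogd : 0 ≤ Real.log d := Real.log_nonneg hd1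
  -- Once `log λ_max ≥ 1`, `1 + log d + log λ_max ≤ (2 + log d) log λ_max`.
  set β := Real.sqrt (b * (2 + Real.log d))
  have hβ0 : 0 ≤ β := Real.sqrt_nonneg _
  have hdecomp : ∀ N, thetaEst p q r p' q' r' μ lam y u (N + 1) = X (N + 1) + μ • Z N :=
    thetaEst_succ μ lam y u
  -- Inverse bound for `P_{N+1}`, then shrinkage `‖Ξ_N‖ ≤ ‖Θ_N‖`.
  have hZ : ∀ N, L N * ‖Z N‖ ≤ a N := fun N => by
    rw [hL]
    refine (lamMin_mul_norm_le (hH (N + 1))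
      (mul_eq_one_comm.1 (rlsCov_mul_rlsInfo hμ φ (N + 1)).1) (Ξ N)).trans ?_
    exact frobenius_norm_le_of_abs_le fun s t => abs_paramState_Ξ_le μ lam y u hμ hlam N s t
  have hbig : ∀ᶠ N in atTop, 1 ≤ L N ∧ 2 * μ ≤ L N ∧ R N ≤ 1 ∧ 1 / L N ≤ Real.sqrt (R N) ∧
      ‖X (N + 1) - θ‖ ≤ β * Real.sqrt (R N) := by
    -- `λ_min ≥ e` forces `log λ_max ≥ 1`, and then `1 / λ_min² ≤ log λ_max / λ_min`.
    filter_upwards [hmin.eventually_ge_atTop (Real.exp 1), hmin.eventually_ge_atTop (2 * μ),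
      hratio.eventually_le_const (show (0 : ℝ) < 1 by norm_num)] with N h1 h2 h3
    have hL1 : 1 ≤ L N := (Real.one_le_exp zero_le_one).trans h1
    have hL0 : 0 < L N := by linarith
    have hmM : L N ≤ lamMax (rlsInfo μ φ (N + 1)) := by
      rw [hL]; exact lamMin_le_lamMax (hH (N + 1))
    set lM := Real.log (lamMax (rlsInfo μ φ (N + 1)))
    have hlog1 : 1 ≤ lM := (Real.le_log_iff_exp_le (by linarith)).2 (h1.trans hmM)
    have hRN : R N = lM / L N := hR N
    refine ⟨hL1, h2, h3, ?_, ?_⟩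
    · refine Real.le_sqrt_of_sq_le ?_
      rw [hRN, div_pow, one_pow]
      refine div_le_div₀ (by linarith) hlog1 hL0 ?_
      nlinarith
    · have htr : Real.log (rlsInfo μ φ (N + 1)).trace ≤ Real.log d + lM := by
        rw [← Real.log_mul (by linarith) (by linarith)]
        rcases le_or_gt (rlsInfo μ φ (N + 1)).trace 0 with h | h
        · have h0 : (rlsInfo μ φ (N + 1)).trace = 0 :=
            le_antisymm h (rlsInfo_posSemidef hμ φ (N + 1)).trace_nonneg
          rw [h0, Real.log_zero, Real.log_mul (by linarith) (by linarith)]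
          exact add_nonneg hlogd (by linarith)
        · exact Real.log_le_log h (trace_le_card_mul_lamMax (hH (N + 1)))
      have hE : L N * ‖X (N + 1) - θ‖ ^ 2 ≤ b * (2 + Real.log d) * lM := by
        have e1 : L N * ‖X (N + 1) - θ‖ ^ 2 ≤
            ∑ t, rlsEnergy μ φ (fun k : ℕ => y (k + 1)) θ (N + 1) t := by
          rw [← norm_neg, neg_sub, frobenius_norm_sq_real, Finset.mul_sum, hL]
          exact Finset.sum_le_sum fun t _ => lamMin_mul_le (hH (N + 1)) _
        refine e1.trans ((hb₀ (N + 1)).trans ?_)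
        have hmx : max (Real.log (rlsInfo μ φ (N + 1)).trace) 0 ≤ Real.log d + lM :=
          max_le htr (by linarith)
        have hmx0 : 0 ≤ max (Real.log (rlsInfo μ φ (N + 1)).trace) 0 := le_max_right _ _
        calc _ ≤ b * (1 + max (Real.log (rlsInfo μ φ (N + 1)).trace) 0) :=
              mul_le_mul_of_nonneg_right (le_max_left _ _) (by linarith)
          _ ≤ b * ((2 + Real.log d) * lM) := by
              refine mul_le_mul_of_nonneg_left ?_ hb0
              nlinarith
          _ = _ := by ring
      refine le_of_sq_le_sq ?_ (mul_nonneg hβ0 (Real.sqrt_nonneg _))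
      rw [mul_pow, Real.sq_sqrt (by positivity), Real.sq_sqrt (by rw [hRN]; positivity), hRN,
        ← mul_div_assoc, le_div_iff₀ hL0]
      linarith
  obtain ⟨K, hK⟩ := eventually_atTop.1 hbig
  have hZ2 : ∀ N, K ≤ N → μ * ‖Z N‖ ≤ μ * a N * (1 / L N) := fun N hN => by
    have hL0 : 0 < L N := by linarith [(hK N hN).1]
    rw [mul_one_div, le_div_iff₀ hL0]
    nlinarith [hZ N]
  -- With `λ_min ≥ 2μ` the correction is at most half the previous norm, so `Θ_N` stays bounded.
  obtain ⟨c, hc⟩ := exists_le_of_le_add_half (a := a) (c := ‖θ‖ + β) (K := K) fun N hN => by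
    obtain ⟨h1, h2, h3, -, h5⟩ := hK N hN
    have hs : Real.sqrt (R N) ≤ 1 := Real.sqrt_le_one.2 h3
    have hL0 : 0 < L N := by linarith
    have ha : 0 ≤ a N := norm_nonneg _
    have e1 : a (N + 1) ≤ ‖θ‖ + ‖X (N + 1) - θ‖ + μ * ‖Z N‖ := by
      have e2 : thetaEst p q r p' q' r' μ lam y u (N + 1) = θ + (X (N + 1) - θ) + μ • Z N := by
        rw [hdecomp]; abel
      change ‖thetaEst p q r p' q' r' μ lam y u (N + 1)‖ ≤ _
      rw [e2]
      refine (norm_add_le _ _).trans (add_le_add (norm_add_le _ _) ?_)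
      rw [norm_smul, Real.norm_of_nonneg hμ.le]
    have e3 : μ * a N * (1 / L N) ≤ a N / 2 := by
      rw [mul_one_div, div_le_div_iff₀ hL0 two_pos]
      nlinarith
    have e4 : β * Real.sqrt (R N) ≤ β := mul_le_of_le_one_right hβ0 hs
    linarith [hZ2 N hN]
  refine IsBigO.of_bound (β + μ * c) (eventually_atTop.2 ⟨K, fun N hN => ?_⟩)
  obtain ⟨h1, -, -, h4, h5⟩ := hK N hN
  have hL0 : 0 < L N := by linarith
  rw [norm_norm, Real.norm_of_nonneg (Real.sqrt_nonneg _)]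
  have e1 : ‖thetaEst p q r p' q' r' μ lam y u (N + 1) - θ‖ ≤ ‖X (N + 1) - θ‖ + μ * ‖Z N‖ := by
    have e2 : thetaEst p q r p' q' r' μ lam y u (N + 1) - θ = (X (N + 1) - θ) + μ • Z N := by
      rw [hdecomp]; abel
    rw [e2]
    refine (norm_add_le _ _).trans (add_le_add le_rfl ?_)
    rw [norm_smul, Real.norm_of_nonneg hμ.le]
  have e3 : μ * a N * (1 / L N) ≤ μ * c * Real.sqrt (R N) := by
    have h6 : 0 ≤ c := (norm_nonneg _).trans (hc N hN)
    have h7 : 0 ≤ 1 / L N := by positivity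
    exact mul_le_mul (mul_le_mul_of_nonneg_left (hc N hN) hμ.le) h4 h7 (by positivity)
  linarith [hZ2 N hN]

end ARMAX
end

/-! ### The energy of the regression with the true orders. -/

noncomputable section

namespace ARMAX

section Path

variable {n l p q r p' q' r' : ℕ} {μ : ℝ} {y : ℤ → Fin n → ℝ} {u : ℤ → Fin l → ℝ}
  {w : ℤ → Fin n → ℝ}

theorem modelErr_phi_eq {A : Fin p → Matrix (Fin n) (Fin n) ℝ}
    {B : Fin q → Matrix (Fin n) (Fin l) ℝ} {C : Fin r → Matrix (Fin n) (Fin n) ℝ} {k : ℕ}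
    (h : y (k + 1) + ∑ i, A i *ᵥ y (k - (i : ℕ)) =
      ∑ j, B j *ᵥ u (k - (j : ℕ)) + (w (k + 1) + ∑ ν, C ν *ᵥ w (k - (ν : ℕ)))) (t : Fin n) :
    modelErr (paramMatrix A B C) (phi p q r p' q' r' μ y u) (fun k : ℕ => y (k + 1))
        (fun k : ℕ => w (k + 1)) k t =
      -∑ ν, (C ν *ᵥ (noiseEst p' q' r' μ y u (k - (ν : ℕ)) - w (k - (ν : ℕ)))) t :=
  model_error_eq h _ t

/-- As `p`, `q`, `r` are positive, the short regressor contains the current `y`, `u` and `ŵ`, hence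
controls all lags of the long one. The leverages of the long regression are thereby bounded through
the short information matrix. The `+ 1` makes the factor positive for any orders. -/
theorem rlsInfo_phi_trace_le (hμ : 0 < μ) (hy : ∀ j ≤ 0, y j = 0) (hu : ∀ j ≤ 0, u j = 0)
    (hp : 0 < p) (hq : 0 < q) (hr : 0 < r) (N : ℕ) :
    (rlsInfo μ (phi p' q' r' p' q' r' μ y u) N).trace ≤
      (p' + q' + r' + 1) * (rlsInfo μ (phi p q r p' q' r' μ y u) N).trace := by
  have h1 := sum_regressor_sq_le (p' := p') (q' := q') (r' := r') hy hu
    (fun j hj => noiseEst_of_nonpos (p' := p') (q' := q') (r' := r') μ y u hj) hp hq hr N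
  have h2 : 0 ≤ ∑ k ∈ Finset.range N, ∑ s, phi p q r p' q' r' μ y u k s ^ 2 :=
    Finset.sum_nonneg fun _ _ => Finset.sum_nonneg fun _ _ => sq_nonneg _
  have h3 : (Fintype.card (RegIdx n l p' q' r') : ℝ) ≤
      (p' + q' + r') * Fintype.card (RegIdx n l p q r) := by
    have : Fintype.card (RegIdx n l p' q' r') ≤
        (p' + q' + r') * Fintype.card (RegIdx n l p q r) := by
      simp only [RegIdx, Fintype.card_sum, Fintype.card_prod, Fintype.card_fin]
      have a1 : p' * n ≤ p' * (p * n) := Nat.mul_le_mul_left _ (Nat.le_mul_of_pos_left n hp)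
      have a2 : q' * l ≤ q' * (q * l) := Nat.mul_le_mul_left _ (Nat.le_mul_of_pos_left l hq)
      have a3 : r' * n ≤ r' * (r * n) := Nat.mul_le_mul_left _ (Nat.le_mul_of_pos_left n hr)
      nlinarith [Nat.zero_le (p' * (q * l)), Nat.zero_le (p' * (r * n)),
        Nat.zero_le (q' * (p * n)), Nat.zero_le (q' * (r * n)),
        Nat.zero_le (r' * (p * n)), Nat.zero_le (r' * (q * l))]
    exact_mod_cast this
  have h4 := mul_le_mul_of_nonneg_right h3 hμ.le
  have h5 : 0 ≤ (Fintype.card (RegIdx n l p q r) : ℝ) * μ := by positivity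
  rw [rlsInfo_trace, rlsInfo_trace]
  have h1' : ∑ k ∈ Finset.range N, ∑ s, phi p' q' r' p' q' r' μ y u k s ^ 2 ≤
      (p' + q' + r') * ∑ k ∈ Finset.range N, ∑ s, phi p q r p' q' r' μ y u k s ^ 2 := h1
  linarith

/-- The least squares energy grows at most like the logarithm of the trace of the information
matrix. -/
theorem exists_sum_rlsEnergy_le (hμ : 0 < μ) (hy : ∀ j ≤ 0, y j = 0) (hu : ∀ j ≤ 0, u j = 0)
    (hp : 0 < p) (hq : 0 < q) (hr : 0 < r) {θ : Matrix (RegIdx n l p q r) (Fin n) ℝ}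
    {C : Fin r → Matrix (Fin n) (Fin n) ℝ}
    (hξ : ∃ b, ∀ N, ∑ k ∈ Finset.range N, ∑ t,
        (noiseEst p' q' r' μ y u (k + 1) t - w (k + 1) t) ^ 2 ≤
      b * (1 + ∑ k ∈ Finset.range N, rlsLeverage μ (phi p' q' r' p' q' r' μ y u) k))
    (herr : ∀ k : ℕ, r ≤ k → ∀ t, modelErr θ (phi p q r p' q' r' μ y u)
      (fun k : ℕ => y (k + 1)) (fun k : ℕ => w (k + 1)) k t =
        -∑ ν, (C ν *ᵥ (noiseEst p' q' r' μ y u (k - (ν : ℕ)) - w (k - (ν : ℕ)))) t)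
    (h : ∃ b, ∀ N,
      ∑ t, rlsEnergy μ (phi p q r p' q' r' μ y u) (fun k : ℕ => y (k + 1)) θ N t +
        ∑ k ∈ Finset.range N, ∑ t,
          (rlsPost μ (phi p q r p' q' r' μ y u) (fun k : ℕ => y (k + 1)) θ k t ^ 2 +
          2 * modelErr θ (phi p q r p' q' r' μ y u)
            (fun k : ℕ => y (k + 1)) (fun k : ℕ => w (k + 1)) k t *
          rlsPost μ (phi p q r p' q' r' μ y u) (fun k : ℕ => y (k + 1)) θ k t) ≤
      1 / 2 * ∑ k ∈ Finset.range N, ∑ t,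
          rlsPost μ (phi p q r p' q' r' μ y u) (fun k : ℕ => y (k + 1)) θ k t ^ 2 +
        b * (1 + ∑ k ∈ Finset.range N, rlsLeverage μ (phi p q r p' q' r' μ y u) k)) :
    ∃ b, ∀ N, ∑ t, rlsEnergy μ (phi p q r p' q' r' μ y u) (fun k : ℕ => y (k + 1)) θ N t ≤
      b * (1 + max (Real.log (rlsInfo μ (phi p q r p' q' r' μ y u) N).trace) 0) := by
  set φ := phi p q r p' q' r' μ y u
  set ψ := phi p' q' r' p' q' r' μ y u
  set s : ℕ → Fin n → ℝ := rlsPost μ φ (fun k : ℕ => y (k + 1)) θ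
  set e : ℕ → Fin n → ℝ := modelErr θ φ (fun k : ℕ => y (k + 1)) (fun k : ℕ => w (k + 1))
  have hT : ∀ N, 0 ≤ (rlsInfo μ φ N).trace := fun N => (rlsInfo_posSemidef hμ φ N).trace_nonneg
  obtain ⟨bφ, hbφ, hφ⟩ := exists_sum_rlsLeverage_le hμ φ one_pos
    (T := fun N => (rlsInfo μ φ N).trace) (fun N => by rw [one_mul]) hT
  obtain ⟨bψ, hbψ, hψ⟩ := exists_sum_rlsLeverage_le hμ ψ (c := p' + q' + r' + 1) (by positivity)
    (T := fun N => (rlsInfo μ φ N).trace)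
    (fun N => rlsInfo_phi_trace_le hμ hy hu hp hq hr N) hT
  obtain ⟨b₁, h₁⟩ := hξ
  obtain ⟨b₂, h₂⟩ := exists_sum_modelErr_sq_le
    (ξ := fun j => noiseEst p' q' r' μ y u j - w j) (e := e) herr
  obtain ⟨b₃, h₃⟩ := h
  refine ⟨2 * (|b₂| * (1 + |b₁| * (1 + bψ))) + |b₃| * (1 + bφ), fun N => ?_⟩
  set m := 1 + max (Real.log (rlsInfo μ φ N).trace) 0 with hm
  have hm1 : 1 ≤ m := le_add_of_nonneg_right (le_max_right _ _)
  have step : ∀ {b x b' : ℝ}, 0 ≤ x → x ≤ b' * m → b * (1 + x) ≤ |b| * (1 + b') * m :=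
    fun {b x b'} hx hxm => by
      have h1 := mul_le_mul_of_nonneg_right (le_abs_self b) (by positivity : 0 ≤ 1 + x)
      have h2 := mul_le_mul_of_nonneg_left (add_le_add hm1 hxm) (abs_nonneg b)
      linarith
  have hlev : ∀ {ι : Type} [Fintype ι] [DecidableEq ι] (φ : ℕ → ι → ℝ),
      0 ≤ ∑ k ∈ Finset.range N, rlsLeverage μ φ k := fun φ =>
    Finset.sum_nonneg fun _ _ => rlsLeverage_nonneg hμ _ _
  have i₁ := (h₁ N).trans (step (hlev ψ) (hψ N))
  have i₂ := (h₂ N).trans (step (Finset.sum_nonneg fun _ _ =>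
    Finset.sum_nonneg fun _ _ => sq_nonneg _) i₁)
  have i₃ := step (b := b₃) (hlev φ) (hφ N)
  -- Young's inequality `s² + 2es ≥ s² / 2 - 2e²`; the half of `∑ s²` cancels the one allowed by `ε
  -- = 1 / 2`.
  have key : 1 / 2 * ∑ k ∈ Finset.range N, ∑ t, s k t ^ 2 ≤
      ∑ k ∈ Finset.range N, ∑ t, (s k t ^ 2 + 2 * e k t * s k t) +
        2 * ∑ k ∈ Finset.range N, ∑ t, e k t ^ 2 := by
    simp only [Finset.mul_sum, ← Finset.sum_add_distrib]
    refine Finset.sum_le_sum fun k _ => Finset.sum_le_sum fun t _ => ?_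
    nlinarith [sq_nonneg (s k t + 2 * e k t)]
  have i₄ := h₃ N
  linarith

end Path

end ARMAX

end

/-! ### The convergence theorem. -/

theorem theorem1 {Ω : Type*} [MeasurableSpace Ω] (P : Measure Ω) [IsProbabilityMeasure P]
    (n l p q r : ℕ) (hp : 0 < p) (hq : 0 < q) (hr : 0 < r)
    (A : Fin p → Matrix (Fin n) (Fin n) ℝ) (B : Fin q → Matrix (Fin n) (Fin l) ℝ)
    (C : Fin r → Matrix (Fin n) (Fin n) ℝ)
    (y : ℤ → Ω → Fin n → ℝ) (u : ℤ → Ω → Fin l → ℝ) (w : ℤ → Ω → Fin n → ℝ)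
    (hy : ∀ j, Measurable (y j)) (hu : ∀ j, Measurable (u j)) (hw : ∀ j, Measurable (w j))
    -- the ARMAX system
    (hsys : ∀ ω, ARMAX.IsSystemPath A B C (fun j => y j ω) (fun j => u j ω) (fun j => w j ω))
    -- the tuning parameters of the algorithm
    (μ : ℝ) (hμ : 0 < μ) (lam : ℕ → Ω → ℝ) (hlam : ∀ N ω, 0 < lam N ω)
    -- `det C(z) ≠ 0` in the closed unit disc
    (hC : ∀ z : ℂ, ‖z‖ ≤ 1 → (ARMAX.noisePoly C z).det ≠ 0)
    -- the orders of the noise estimator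
    (K ρ : ℝ) (hKρ : ARMAX.IsInverseDecay C K ρ) (k p' q' r' : ℕ) (hk : 0 < k)
    (hk' : Real.log ((ARMAX.noisePolySupNorm C)⁻¹ * K⁻¹ * (1 - ρ)) / Real.log ρ - 1 < k)
    (hp' : p' = p + k) (hq' : q' = q + k) (hr' : r' = r + k)
    -- the noise is a martingale difference sequence with bounded conditional moments
    (hnoise : ARMAX.IsMartingaleDifferenceNoise P (ARMAX.sigmaAlg y u w) w)
    -- `φ_N` is `𝓕_N`-measurable
    (hφ : ∀ N : ℕ, 1 ≤ N → Measurable[ARMAX.sigmaAlg y u w N]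
      (fun ω => ARMAX.phi p q r p' q' r' μ (fun j => y j ω) (fun j => u j ω) N))
    -- excitation
    (hexc : ∀ᵐ ω ∂P,
      Tendsto (ARMAX.lmin p q r p' q' r' μ (fun j => y j ω) (fun j => u j ω)) atTop atTop ∧
      Tendsto (ARMAX.ratio p q r p' q' r' μ (fun j => y j ω) (fun j => u j ω)) atTop (𝓝 0))
    -- regularization coefficients
    (hreg : ∀ᵐ ω ∂P,
      (fun N => lam N ω) =O[atTop] (fun N =>
        Real.sqrt (ARMAX.ratio p q r p' q' r' μ (fun j => y j ω) (fun j => u j ω) N)) ∧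
      (fun N => ARMAX.ratio p q r p' q' r' μ (fun j => y j ω) (fun j => u j ω) N) =o[atTop]
        (fun N => lam N ω)) :
    ∀ᵐ ω ∂P,
      (fun N => ‖ARMAX.thetaEst p q r p' q' r' μ (fun N => lam N ω) (fun j => y j ω)
          (fun j => u j ω) (N + 1) - ARMAX.paramMatrix A B C‖) =O[atTop]
        (fun N => Real.sqrt
          (ARMAX.ratio p q r p' q' r' μ (fun j => y j ω) (fun j => u j ω) N)) := by

  subst hp' hq' hr'
  have hy0 : ∀ j ≤ 0, ∀ ω, y j ω = 0 := fun j hj ω => (hsys ω).output_init j hj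
  have hu0 : ∀ j ≤ 0, ∀ ω, u j ω = 0 := fun j hj ω => (hsys ω).input_init j hj
  have hym : ∀ j : ℕ, 1 ≤ j → ∀ a,
      Measurable[ARMAX.sigmaFiltration hy hu hw j] fun ω => y j ω a := fun j _ a =>
    (measurable_pi_apply a).comp (ARMAX.measurable_output (by omega) le_rfl)
  have hwm : ∀ j : ℕ, 1 ≤ j → ∀ a,
      Measurable[ARMAX.sigmaFiltration hy hu hw j] fun ω => w j ω a := fun j hj a =>
    (measurable_pi_apply a).comp (ARMAX.measurable_noise (by omega) le_rfl)
  -- `u_j` is not among the generators of `𝓕_j`. It is a coordinate of `φ_j` because `q > 0`;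
  -- likewise `ŵ_j` because `r > 0`.
  have hum : ∀ j : ℕ, 1 ≤ j → ∀ b,
      Measurable[ARMAX.sigmaFiltration hy hu hw j] fun ω => u j ω b := fun j hj b => by
    have := (measurable_pi_apply (.inr (.inl (⟨0, hq⟩, b)))).comp (hφ j hj)
    simp only [Function.comp_def, ARMAX.phi, ARMAX.regressor, Nat.cast_zero, sub_zero] at this
    exact this
  have hem : ∀ j : ℕ, 1 ≤ j → ∀ c, Measurable[ARMAX.sigmaFiltration hy hu hw j] fun ω =>
      ARMAX.noiseEst (p + k) (q + k) (r + k) μ (fun j => y j ω) (fun j => u j ω) j c :=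
    fun j hj c => by
      have := (measurable_pi_apply (.inr (.inr (⟨0, hr⟩, c)))).comp (hφ j hj)
      simp only [Function.comp_def, ARMAX.phi, ARMAX.regressor, Nat.cast_zero, sub_zero] at this
      exact this
  have hnm := ARMAX.isMomentNoise_of_isMartingaleDifferenceNoise hy hu hw hnoise
  obtain ⟨D, hD, γ, hγ, hH⟩ := ARMAX.exists_truncated_inverse hC hKρ hk'
  -- The same path obeys two regressions: the long one, multiplied by the truncated inverse, has the
  -- orders of the noise estimator, and the short one has the parameter `Θ`.
  have hlong : ∀ ω, ∀ j : ℕ, r + k ≤ j → _ := fun ω j hj =>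
    (hsys ω).mul_left hD k (j : ℤ) (by omega)
  have hshort : ∀ ω, ∀ j : ℕ, r ≤ j → _ := fun ω j _ =>
    (hsys ω).dynamics (j : ℤ) (by omega)
  filter_upwards [hexc, ARMAX.ae_rlsEnergy_phi_le hμ hy0 hu0 hym hum hem hwm hnm le_rfl hlong,
    ARMAX.ae_rlsEnergy_phi_le hμ hy0 hu0 hym hum hem hwm hnm le_rfl hshort]
    with ω hω hl hs
  have hyω : ∀ j ≤ 0, (fun j => y j ω) j = 0 := fun j hj => hy0 j hj ω
  have huω : ∀ j ≤ 0, (fun j => u j ω) j = 0 := fun j hj => hu0 j hj ω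
  have hξ := ARMAX.exists_sum_noise_error_le
    (H := fun m => ARMAX.convCoeff k r D (ARMAX.consCoeff 1 C) (m + 1)) (w := fun j => w j ω)
    hμ hγ hH (fun j hj t => ARMAX.modelErr_phi_eq (y := fun j => y j ω)
      (u := fun j => u j ω) (w := fun j => w j ω) (hlong ω j hj) t) hl
  have herr : ∀ j : ℕ, r ≤ j → ∀ t, _ := fun j hj t =>
    ARMAX.modelErr_phi_eq (p' := p + k) (q' := q + k) (r' := r + k) (μ := μ)
      (y := fun j => y j ω) (u := fun j => u j ω) (w := fun j => w j ω) (hshort ω j hj) t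
  have hen := ARMAX.exists_sum_rlsEnergy_le (p' := p + k) (q' := q + k) (r' := r + k)
    (y := fun j => y j ω) (u := fun j => u j ω) (w := fun j => w j ω)
    (θ := ARMAX.paramMatrix A B C) (C := C) hμ hyω huω hp hq hr hξ herr (hs (1 / 2) one_half_pos)
  exact ARMAX.thetaEst_sub_isBigO hμ (fun N => hlam N ω) hyω huω hω.1 hω.2 _ hen
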